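/- Let $n\ge 1$ and $s\in(0,\infty)\setminus\mathbb N$, with integer part $[s]$ and fractional part $\{s\}=s-[s]$. A Young function is a convex, left-continuous function $A:[0,\infty)\to[0,\infty]$ with $A(0)=0$ which on $(0,\infty)$ is neither identically $0$ nor identically $\infty$; set $A(\infty)=\infty$. For a Lebesgue measurable function $f$ on $\mathbb R^n$, with values in $\mathbb R$ or in a Euclidean space, and $\sigma\in(0,1)$, let $$\|f\|_{L^A}=\inf\Big\{\lambda>0:\int_{\mathbb R^n}A\Big(\frac{|f(x)|}{\lambda}\Big)\,dx\le1\Big\},$$ $$|f|_{\sigma,A}=\inf\Big\{\lambda>0:\int_{\mathbb R^n}\int_{\mathbb R^n}A\Big(\frac{|f(x)-f(y)|}{\lambda|x-y|^{\sigma}}\Big)\frac{dx\,dy}{|x-y|^n}\le1\Big\},$$ where $\inf\emptyset=\infty$, and let $L^A(\mathbb R^n)$ be the set of measurable $u:\mathbb R^n\to\mathbb R$ with $\|u\|_{L^A}<\infty$. Let $\nabla^ku$ be the vector of all weak derivatives $\partial^\alpha u$ of order $|\alpha|=k$ (with $\nabla^0u=u$). Then $W^{s,A}(\mathbb R^n)$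 is the set of those $u\in L^A(\mathbb R^n)$ that have weak derivatives of all orders $k=1,\dots,[s]$ with $\|\nabla^ku\|_{L^A}<\infty$, and satisfy $|\nabla^{[s]}u|_{\{s\},A}<\infty$. It is equipped with the norm $$\|u\|_{W^{s,A}}=\sum_{k=0}^{[s]}\|\nabla^ku\|_{L^A}+|\nabla^{[s]}u|_{\{s\},A}.$$ For measurable $u:\mathbb R^n\to\mathbb R$, $x\in\mathbb R^n$ and $r>0$, let $$\operatorname{osc}^su(x,r)=\inf_{q}\frac1{|B_r(x)|}\int_{B_r(x)}\frac{|u(y)-q(y)|}{r^s}\,dy,$$ where $q$ ranges over the real polynomials on $\mathbb R^n$ of degree at most $[s]$ and $B_r(x)$ is the ball of radius $r$ centered at $x$, and let $$|u|_{\mathcal O^{s,A}}=\inf\Big\{\lambda>0:\int_0^1\int_{\mathbb R^n}A\Big(\frac{\operatorname{osc}^su(x,r)}{\lambda}\Big)\,dx\,\frac{dr}{r}\le1\Big\}.$$ The oscillation space is $\mathcal O^{s,A}(\mathbb R^n)=\{u\in L^A(\mathbb R^n):|u|_{\mathcal O^{s,A}}<\infty\}$, with norm $\|u\|_{\mathcal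 O^{s,A}}=\|u\|_{L^A}+|u|_{\mathcal O^{s,A}}$. Theorem. There exist constants $c_1,c_2\in(0,\infty)$, depending only on $n$ and $s$, such that for every Young function $A$ one has $\mathcal O^{s,A}(\mathbb R^n)=W^{s,A}(\mathbb R^n)$, and $$c_1\|u\|_{W^{s,A}}\le\|u\|_{\mathcal O^{s,A}}\le c_2\|u\|_{W^{s,A}}\qquad\text{for every }u\in W^{s,A}(\mathbb R^n).$$ -/

import Mathlib

open MeasureTheory
open scoped NNReal ENNReal

noncomputable section

namespace OrliczOsc

/-- A Young function `A : [0, ∞) → [0, ∞]`: convex, left-continuous, vanishing at `0`, and,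
on `(0, ∞)`, neither identically `0` nor identically `∞`. -/
structure IsYoung (A : ℝ≥0 → ℝ≥0∞) : Prop where
  convexOn : ConvexOn ℝ≥0 Set.univ A
  leftContinuous : ∀ t : ℝ≥0, ContinuousWithinAt A (Set.Iio t) t
  map_zero : A 0 = 0
  exists_ne_zero : ∃ t : ℝ≥0, A t ≠ 0
  exists_ne_top : ∃ t : ℝ≥0, 0 < t ∧ A t ≠ ∞

/-- The extension of `A` to `[0, ∞]` by `A(∞) = ∞`. -/
def youngExtend (A : ℝ≥0 → ℝ≥0∞) (t : ℝ≥0∞) : ℝ≥0∞ :=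
  if t = ∞ then ∞ else A t.toNNReal

/-- The Luxemburg functional `inf {l > 0 : ρ(l) ≤ 1}` (with `inf ∅ = ∞`). -/
def luxemburg (ρ : ℝ≥0 → ℝ≥0∞) : ℝ≥0∞ :=
  ⨅ (l : ℝ≥0) (_ : 0 < l) (_ : ρ l ≤ 1), (l : ℝ≥0∞)

/-- `ℝⁿ` with its Euclidean norm. -/
abbrev Rn (n : ℕ) : Type := EuclideanSpace ℝ (Fin n)

variable {n : ℕ}

/-- The Luxemburg norm `‖f‖_{L^A(ℝⁿ)}` of a real- or vector-valued function. -/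
def orliczNorm {F : Type*} [NormedAddCommGroup F] (A : ℝ≥0 → ℝ≥0∞) (f : Rn n → F) : ℝ≥0∞ :=
  luxemburg fun l => ∫⁻ x, youngExtend A (‖f x‖ₑ / l)

/-- The Orlicz space `L^A(ℝⁿ)` of real-valued (Lebesgue) measurable functions. -/
def orliczSpace (n : ℕ) (A : ℝ≥0 → ℝ≥0∞) : Set (Rn n → ℝ) :=
  {u | AEMeasurable u ∧ orliczNorm A u < ∞}

/-- The Gagliardo-Slobodeckij seminorm `|f|_{σ,A,ℝⁿ}`, for `σ ∈ (0, 1)`. -/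
def gagliardo {F : Type*} [NormedAddCommGroup F] (A : ℝ≥0 → ℝ≥0∞) (σ : ℝ) (f : Rn n → F) :
    ℝ≥0∞ :=
  luxemburg fun l =>
    ∫⁻ x, ∫⁻ y, youngExtend A (‖f x - f y‖ₑ / (l * ‖x - y‖ₑ ^ σ)) / ‖x - y‖ₑ ^ n

/-- The classical partial derivative `∂_i φ`. -/
def partialD (i : Fin n) (φ : Rn n → ℝ) : Rn n → ℝ :=
  fun x => fderiv ℝ φ x (EuclideanSpace.single i 1)

/-- The classical derivative `∂_1^{α_1} ⋯ ∂_n^{α_n} φ`. -/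
def multiD (α : Fin n → ℕ) (φ : Rn n → ℝ) : Rn n → ℝ :=
  (List.finRange n).foldr (fun i ψ => (partialD i)^[α i] ψ) φ

/-- `g` is a weak derivative `∂^α u`. -/
def IsWeakDeriv (α : Fin n → ℕ) (u g : Rn n → ℝ) : Prop :=
  LocallyIntegrable u ∧ LocallyIntegrable g ∧
    ∀ φ : Rn n → ℝ, ContDiff ℝ (⊤ : ℕ∞) φ → HasCompactSupport φ →
      ∫ x, u x * multiD α φ x = (-1) ^ (∑ i, α i) * ∫ x, g x * φ x

open Classical in
/-- The weak derivative `∂^α u` (unique up to null sets), with `∂^0 u = u`. The value is `0` when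
`u` has no such weak derivative; it is only used when there is one. -/
def weakDeriv (α : Fin n → ℕ) (u : Rn n → ℝ) : Rn n → ℝ :=
  if α = 0 then u else if h : ∃ g, IsWeakDeriv α u g then h.choose else 0

/-- The multi-indices `α ∈ ℕⁿ` of order `|α| = k`. -/
abbrev MultiIndex (n k : ℕ) : Type :=
  {α : Fin n → ℕ // α ∈ Finset.piAntidiag (Finset.univ : Finset (Fin n)) k}

/-- The vector `∇^k u` of all weak derivatives of order `k`, with its Euclidean norm. -/
def weakGrad (k : ℕ) (u : Rn n → ℝ) : Rn n → EuclideanSpace ℝ (MultiIndex n k) :=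
  fun x => WithLp.toLp 2 fun α => weakDeriv α.1 u x

/-- The norm of `W^{m,A}(ℝⁿ)`, `m ∈ ℕ`. -/
def sobolevNorm (m : ℕ) (A : ℝ≥0 → ℝ≥0∞) (u : Rn n → ℝ) : ℝ≥0∞ :=
  ∑ k ∈ Finset.range (m + 1), orliczNorm A (weakGrad k u)

/-- The Orlicz-Sobolev space `W^{m,A}(ℝⁿ)`, `m ∈ ℕ` (with `W^{0,A} = L^A`). -/
def sobolevSpace (n m : ℕ) (A : ℝ≥0 → ℝ≥0∞) : Set (Rn n → ℝ) :=
  {u | u ∈ orliczSpace n A ∧ ∀ k ∈ Finset.Icc 1 m,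
    (∀ α : MultiIndex n k, ∃ g, IsWeakDeriv α.1 u g) ∧ orliczNorm A (weakGrad k u) < ∞}

/-- The norm of the fractional space `W^{s,A}(ℝⁿ)`, `s ∈ (0, ∞) \ ℕ`. -/
def fracSobolevNorm (s : ℝ) (A : ℝ≥0 → ℝ≥0∞) (u : Rn n → ℝ) : ℝ≥0∞ :=
  sobolevNorm ⌊s⌋₊ A u + gagliardo A (Int.fract s) (weakGrad ⌊s⌋₊ u)

/-- The fractional Orlicz-Sobolev space `W^{s,A}(ℝⁿ)`, `s ∈ (0, ∞) \ ℕ`. -/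
def fracSobolevSpace (n : ℕ) (s : ℝ) (A : ℝ≥0 → ℝ≥0∞) : Set (Rn n → ℝ) :=
  {u | u ∈ sobolevSpace n ⌊s⌋₊ A ∧ gagliardo A (Int.fract s) (weakGrad ⌊s⌋₊ u) < ∞}

/-- The oscillation `osc^s u(x, r)`: the infimum, over the polynomials `q` of degree at most `[s]`,
of the average over the ball `B_r(x)` of `|u - q| / r^s`. -/
def osc (s : ℝ) (u : Rn n → ℝ) (x : Rn n) (r : ℝ) : ℝ≥0∞ :=
  ⨅ (q : MvPolynomial (Fin n) ℝ) (_ : q.totalDegree ≤ ⌊s⌋₊),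
    (∫⁻ y in Metric.ball x r,
      ‖u y - MvPolynomial.eval (fun i => y i) q‖ₑ / ENNReal.ofReal (r ^ s)) /
        volume (Metric.ball x r)

/-- The seminorm `|u|_{O^{s,A}(ℝⁿ)}`. -/
def oscSeminorm (s : ℝ) (A : ℝ≥0 → ℝ≥0∞) (u : Rn n → ℝ) : ℝ≥0∞ :=
  luxemburg fun l =>
    ∫⁻ r in Set.Ioo (0 : ℝ) 1, (∫⁻ x, youngExtend A (osc s u x r / l)) / ENNReal.ofReal r

/-- The norm of the oscillation space `O^{s,A}(ℝⁿ)`. -/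
def oscNorm (s : ℝ) (A : ℝ≥0 → ℝ≥0∞) (u : Rn n → ℝ) : ℝ≥0∞ :=
  orliczNorm A u + oscSeminorm s A u

/-- The oscillation space `O^{s,A}(ℝⁿ)`. -/
def oscSpace (n : ℕ) (s : ℝ) (A : ℝ≥0 → ℝ≥0∞) : Set (Rn n → ℝ) :=
  {u | u ∈ orliczSpace n A ∧ oscSeminorm s A u < ∞}

end OrliczOsc

end

open MeasureTheory Filter Topology
open scoped NNReal ENNReal

noncomputable section

namespace OrliczOsc

variable {n : ℕ}

/-! Write m = [s] and σ = s - m. Both inequalities come from pointwise estimates at fixed scales,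
followed by a Jensen inequality and an integration over scales. The constants do not depend on A
because a Young function enters only through monotonicity and B(θt) ≤ θB(t) for θ ≤ 1 (`Gauge`).
These already yield Jensen's inequality with a loss of 1/2 (`Gauge.half_lintegral_le`), and a loss
inside the argument of B only changes the multiple of the Luxemburg norm.

Oscillation from derivatives. Taylor's formula, centred at a point z of B_r(x), approximates a
mollification of u by a polynomial of degree at most m. Its error is |h|^m times a mean over t of
|∇^m u(z+th) - ∇^m u(z)|. After averaging over z and h and letting the mollification disappear,
osc^s u(x,r) is bounded by an average of the quotients |∇^m u(z+th) - ∇^m u(z)| / |th|^σ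
(`exists_osc_le_quotients`). Jensen, Fubini in x, the bound ∫_{|h|<2r} r^{-n} dr/r ≤ C|h|^{-n} and
the dilation invariance of dh/|h|^n, which removes t, give the Gagliardo modular
(`exists_oscSeminorm_le`).

Derivatives from oscillation. Take a mollifier φ that reproduces the polynomials of degree at most
m. A polynomial q may then be subtracted from u without changing the difference of ∂^α φ_{ρ/2} * u
and ∂^α φ_ρ * u, so this difference is at most C ρ^{s-|α|} osc^s u(x,ρ) (`exists_mollified_sub_le`).
The exponent is positive for |α| ≤ m because s is not an integer, so the telescoping series over the
scales ρ/2^j is controlled by a geometric weight. This produces the weak derivatives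
(`exists_isWeakDeriv_of_osc`) and bounds ∇^k u by a local mean of |u| plus a weighted dyadic sum of
oscillations.

For increments of ∇^m u between x and y, the telescoping stops at scale |x-y|. What remains is an
increment of ∂^α φ_ρ * u, controlled by osc^s u(x, 2|x-y|), since ∂^α q is constant when |α| = m
(`exists_weakGrad_sub_le`). For |x-y| < 1/2, polar coordinates turn dx dy/|x-y|^n into dx dr/r, the
measure of the oscillation seminorm. For |x-y| ≥ 1/2 the L^A norm of ∇^m u suffices, since
|h|^{-n-σ} is integrable at infinity (`exists_modular_gagliardo_le`). -/

/-- The properties of the extension of a Young function to `[0, ∞]` that are used below. -/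
structure Gauge (B : ℝ≥0∞ → ℝ≥0∞) : Prop where
  mono : Monotone B
  mul_le : ∀ θ t, θ ≤ 1 → B (θ * t) ≤ θ * B t
  top : B ∞ = ∞
  exists_pos : ∃ t, t ≠ ∞ ∧ B t ≠ 0

/-! ### Young functions and Jensen's inequality -/

theorem IsYoung.mul_le {A : ℝ≥0 → ℝ≥0∞} (hA : IsYoung A) {θ : ℝ≥0} (hθ : θ ≤ 1) (t : ℝ≥0) :
    A (θ * t) ≤ θ * A t := by
  obtain ⟨-, hc⟩ := hA.convexOn
  have h := hc (Set.mem_univ t) (Set.mem_univ 0) (a := θ) (b := 1 - θ)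
    bot_le bot_le (by rw [add_tsub_cancel_of_le hθ])
  simpa [hA.map_zero, ENNReal.smul_def] using h

theorem IsYoung.mono {A : ℝ≥0 → ℝ≥0∞} (hA : IsYoung A) : Monotone A := by
  intro a b hab
  rcases eq_or_ne b 0 with rfl | hb
  · rw [nonpos_iff_eq_zero.1 hab]
  · have h1 : a / b ≤ 1 := div_le_one_of_le₀ hab bot_le
    have h := hA.mul_le h1 b
    rw [div_mul_cancel₀ _ hb] at h
    refine h.trans ?_
    calc ((a / b : ℝ≥0) : ℝ≥0∞) * A b ≤ 1 * A b := by gcongr; exact_mod_cast h1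
      _ = A b := one_mul _

theorem IsYoung.gauge {A : ℝ≥0 → ℝ≥0∞} (hA : IsYoung A) : Gauge (youngExtend A) where
  mono := by
    intro a b hab
    unfold youngExtend
    by_cases hb : b = ∞
    · simp [hb]
    · have ha : a ≠ ∞ := ne_top_of_le_ne_top hb hab
      rw [if_neg ha, if_neg hb]
      exact hA.mono (ENNReal.toNNReal_mono hb hab)
  mul_le := by
    intro θ t hθ
    have hθ' : θ ≠ ∞ := ne_top_of_le_ne_top ENNReal.one_ne_top hθ
    lift θ to ℝ≥0 using hθ'
    have hθ1 : θ ≤ 1 := by exact_mod_cast hθ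
    unfold youngExtend
    rcases eq_or_ne t ∞ with rfl | ht
    · rcases eq_or_ne θ 0 with rfl | h0
      · simp [hA.map_zero]
      · simp [h0, ENNReal.mul_top]
    · lift t to ℝ≥0 using ht
      rw [← ENNReal.coe_mul, if_neg ENNReal.coe_ne_top, if_neg ENNReal.coe_ne_top,
        ENNReal.toNNReal_coe, ENNReal.toNNReal_coe]
      exact hA.mul_le hθ1 t
  top := by simp [youngExtend]
  exists_pos := by
    obtain ⟨t, ht⟩ := hA.exists_ne_zero
    exact ⟨t, ENNReal.coe_ne_top, by simpa [youngExtend] using ht⟩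

namespace Gauge

variable {B : ℝ≥0∞ → ℝ≥0∞}

theorem zero (hB : Gauge B) : B 0 = 0 := by
  simpa using hB.mul_le 0 0 zero_le_one

theorem measurable (hB : Gauge B) : Measurable B := hB.mono.measurable

/-- This is the monotonicity of B(t)/t, cleared of denominators so that infinite values are allowed.
-/
theorem mul_le_mul (hB : Gauge B) {b t : ℝ≥0∞} (hb0 : b ≠ 0) (hbt : b ≤ t) :
    B b * t ≤ b * B t := by
  rcases eq_or_ne t ∞ with rfl | ht
  · rw [hB.top, ENNReal.mul_top hb0]; exact le_top
  · have ht0 : t ≠ 0 := (lt_of_lt_of_le (pos_iff_ne_zero.2 hb0) hbt).ne'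
    have h := hB.mul_le (b / t) t (ENNReal.div_le_of_le_mul (by simpa using hbt))
    rw [ENNReal.div_mul_cancel ht0 ht] at h
    calc B b * t ≤ (b / t * B t) * t := by gcongr
      _ = (b / t * t) * B t := by ring
      _ = b * B t := by rw [ENNReal.div_mul_cancel ht0 ht]

/-- On the set where f is at least b, f is at most (b / B b) B(f). This is a Chebyshev-type bound
for the part of f above the level b. -/
theorem mul_setLIntegral_le {Ω : Type*} [MeasurableSpace Ω] {μ : Measure Ω} (hB : Gauge B)
    {f : Ω → ℝ≥0∞} (hf : AEMeasurable f μ) {b : ℝ≥0∞} (hb0 : b ≠ 0) (hb : b ≠ ∞) :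
    B b * ∫⁻ x, {t | b ≤ t}.indicator id (f x) ∂μ ≤ b * ∫⁻ x, B (f x) ∂μ := by
  have hm : MeasurableSet {t : ℝ≥0∞ | b ≤ t} := measurableSet_Ici
  have hf' : AEMeasurable (fun x => {t | b ≤ t}.indicator id (f x)) μ :=
    (measurable_id.indicator hm).comp_aemeasurable hf
  rw [← lintegral_const_mul'' _ hf',
    ← lintegral_const_mul' _ _ hb]
  refine lintegral_mono fun x => ?_
  by_cases h : b ≤ f x
  · simpa [Set.indicator, h] using hB.mul_le_mul hb0 h
  · simp [Set.indicator, h]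

theorem lintegral_le_add {Ω : Type*} [MeasurableSpace Ω] {μ : Measure Ω}
    (f : Ω → ℝ≥0∞) (b : ℝ≥0∞) :
    ∫⁻ x, f x ∂μ ≤ b * μ Set.univ + ∫⁻ x, {t | b ≤ t}.indicator id (f x) ∂μ := by
  have hm : MeasurableSet {t : ℝ≥0∞ | b ≤ t} := measurableSet_Ici
  rw [← lintegral_const, ← lintegral_add_left measurable_const]
  refine lintegral_mono fun x => ?_
  by_cases h : b ≤ f x
  · simp [Set.indicator, h]
  · simpa [Set.indicator, h] using (not_le.1 h).le

/-- Jensen's inequality, up to the factor `1/2`. -/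
theorem half_lintegral_le {Ω : Type*} [MeasurableSpace Ω] {μ : Measure Ω} (hB : Gauge B)
    (hμ : μ Set.univ ≤ 1) {f : Ω → ℝ≥0∞} (hf : AEMeasurable f μ) :
    B ((∫⁻ x, f x ∂μ) / 2) ≤ ∫⁻ x, B (f x) ∂μ := by
  set a := ∫⁻ x, f x ∂μ with ha
  rcases eq_or_ne a 0 with h0 | h0
  · simp [h0, hB.zero]
  rcases eq_or_ne a ∞ with h1 | h1
  · obtain ⟨b, hb, hBb⟩ := hB.exists_pos
    have hb0 : b ≠ 0 := by rintro rfl; exact hBb hB.zero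
    have h2 := lintegral_le_add (μ := μ) f b
    rw [← ha, h1] at h2
    have h3 : ∫⁻ x, {t | b ≤ t}.indicator id (f x) ∂μ = ∞ := by
      by_contra h
      exact (ENNReal.add_lt_top.2 ⟨ENNReal.mul_lt_top hb.lt_top (hμ.trans_lt ENNReal.one_lt_top),
        lt_top_iff_ne_top.2 h⟩).not_ge h2
    have h4 := hB.mul_setLIntegral_le hf hb0 hb
    rw [h3, ENNReal.mul_top hBb, top_le_iff] at h4
    rw [ENNReal.mul_eq_top] at h4
    have h5 : ∫⁻ x, B (f x) ∂μ = ∞ := by tauto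
    rw [h5]; exact le_top
  -- Cut at half of the mean. The part of f below a/2 contributes at most a/2 because the mass is at
  -- most one, so the part above still carries a/2.
  · have hb0 : a / 2 ≠ 0 := by simp [h0]
    have hb : a / 2 ≠ ∞ := (ENNReal.div_lt_top h1 two_ne_zero).ne
    have h2 := lintegral_le_add (μ := μ) f (a / 2)
    rw [← ha] at h2
    have h3 : a / 2 ≤ ∫⁻ x, {t | a / 2 ≤ t}.indicator id (f x) ∂μ := by
      have : a / 2 + a / 2 ≤ a / 2 + ∫⁻ x, {t | a / 2 ≤ t}.indicator id (f x) ∂μ := by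
        rw [ENNReal.add_halves]
        refine h2.trans ?_
        gcongr
        calc a / 2 * μ Set.univ ≤ a / 2 * 1 := by gcongr
          _ = a / 2 := mul_one _
      exact (ENNReal.add_le_add_iff_left hb).1 this
    have h4 := hB.mul_setLIntegral_le hf hb0 hb
    have h5 : a / 2 * B (a / 2) ≤ a / 2 * ∫⁻ x, B (f x) ∂μ := by
      refine le_trans ?_ h4
      rw [mul_comm]; gcongr
    exact (ENNReal.mul_le_mul_iff_right hb0 hb).1 h5

/-- Linear growth from below: it is what makes a function with finite modular locally integrable. -/
theorem exists_le_add (hB : Gauge B) :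
    ∃ b M : ℝ≥0∞, b ≠ ∞ ∧ M ≠ ∞ ∧ ∀ t, t ≤ b + M * B t := by
  obtain ⟨b, hb, hBb⟩ := hB.exists_pos
  have hb0 : b ≠ 0 := by rintro rfl; exact hBb hB.zero
  -- The added 1 matters when B b is infinite: then b / B b = 0, and the product with B t = ∞ must
  -- not vanish.
  refine ⟨b, b / B b + 1, hb, by simp [ENNReal.div_eq_top, hb, hBb], fun t => ?_⟩
  rcases le_total t b with h | h
  · exact h.trans le_self_add
  refine le_trans ?_ le_add_self
  rcases eq_or_ne (B b) ∞ with h1 | h1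
  · have : B t = ∞ := top_le_iff.1 (h1 ▸ hB.mono h)
    simp [this]
  · have h2 := hB.mul_le_mul hb0 h
    calc t = B b * t / B b := by
          rw [mul_comm, ENNReal.mul_div_cancel_right hBb h1]
      _ ≤ b * B t / B b := by gcongr
      _ = b / B b * B t := by rw [mul_comm, mul_div_assoc, mul_comm]
      _ ≤ _ := by gcongr; exact le_self_add

/-- The midpoint is at most the larger of the two numbers, so monotonicity alone suffices. -/
theorem half_add_le (hB : Gauge B) (a b : ℝ≥0∞) : B ((a + b) / 2) ≤ B a + B b := by
  rcases le_total a b with h | h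
  · refine (hB.mono ?_).trans le_add_self
    refine ENNReal.div_le_of_le_mul ?_
    rw [mul_two]; gcongr
  · refine (hB.mono ?_).trans le_self_add
    refine ENNReal.div_le_of_le_mul ?_
    rw [mul_two]; gcongr

/-- This turns a modular bounded by N into one bounded by 1, at the price of the factor N in the
norm. -/
theorem div_le (hB : Gauge B) {N : ℝ≥0∞} (hN : 1 ≤ N) (t : ℝ≥0∞) : B (t / N) ≤ B t / N := by
  rw [ENNReal.div_eq_inv_mul, ENNReal.div_eq_inv_mul]
  exact hB.mul_le _ _ (ENNReal.inv_le_one.2 hN)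

/-- Jensen's inequality for the counting measure with density w, to be used with normalized
geometric weights. -/
theorem tsum_le (hB : Gauge B) {w : ℕ → ℝ≥0∞} (hw : ∑' j, w j ≤ 1) (a : ℕ → ℝ≥0∞) :
    B ((∑' j, w j * a j) / 2) ≤ ∑' j, w j * B (a j) := by
  have h := hB.half_lintegral_le (μ := Measure.count.withDensity w)
    (by rw [withDensity_apply _ MeasurableSet.univ]; simpa [lintegral_count] using hw)
    (f := a) (measurable_of_countable a).aemeasurable
  have e : ∀ g : ℕ → ℝ≥0∞, ∫⁻ x, g x ∂(Measure.count.withDensity w) = ∑' j, w j * g j := by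
    intro g
    rw [lintegral_withDensity_eq_lintegral_mul _ (measurable_of_countable w)
      (measurable_of_countable g), lintegral_count]
    rfl
  rwa [e, e] at h

end Gauge

/-! ### Luxemburg functionals -/

theorem luxemburg_lt_top {ρ : ℝ≥0 → ℝ≥0∞} :
    luxemburg ρ < ∞ ↔ ∃ l : ℝ≥0, 0 < l ∧ ρ l ≤ 1 := by
  simp only [luxemburg, iInf_lt_iff]
  constructor
  · rintro ⟨l, h1, h2, -⟩; exact ⟨l, h1, h2⟩
  · rintro ⟨l, h1, h2⟩; exact ⟨l, h1, h2, ENNReal.coe_lt_top⟩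

theorem luxemburg_le {ρ : ℝ≥0 → ℝ≥0∞} {l : ℝ≥0} (hl : 0 < l) (h : ρ l ≤ 1) : luxemburg ρ ≤ l :=
  iInf_le_of_le l (iInf_le_of_le hl (iInf_le_of_le h le_rfl))

/-- Reduces a norm inequality to an implication between modulars. The infima need not be attained,
so each is approached within ε / (2C). -/
theorem luxemburg_le_mul_add {ρ ρ₁ ρ₂ : ℝ≥0 → ℝ≥0∞} {C : ℝ≥0} (hC : 0 < C)
    (h : ∀ l₁ l₂, 0 < l₁ → 0 < l₂ → ρ₁ l₁ ≤ 1 → ρ₂ l₂ ≤ 1 → ρ (C * (l₁ + l₂)) ≤ 1) :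
    luxemburg ρ ≤ C * (luxemburg ρ₁ + luxemburg ρ₂) := by
  refine ENNReal.le_of_forall_pos_le_add fun ε hε hfin => ?_
  have hfin' : luxemburg ρ₁ + luxemburg ρ₂ < ∞ :=
    ENNReal.lt_top_of_mul_ne_top_right hfin.ne (by exact_mod_cast hC.ne')
  have hδ : (0 : ℝ≥0∞) < (ε / (2 * C) : ℝ≥0) := by
    have : 0 < ε / (2 * C) := by positivity
    exact_mod_cast this
  have key : ∀ ρ : ℝ≥0 → ℝ≥0∞, luxemburg ρ < ∞ →
      ∃ l : ℝ≥0, 0 < l ∧ ρ l ≤ 1 ∧ (l : ℝ≥0∞) ≤ luxemburg ρ + (ε / (2 * C) : ℝ≥0) := by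
    intro ρ hρ
    have : luxemburg ρ < luxemburg ρ + (ε / (2 * C) : ℝ≥0) :=
      ENNReal.lt_add_right hρ.ne hδ.ne'
    conv_lhs at this => rw [luxemburg]
    simp only [iInf_lt_iff] at this
    obtain ⟨l, h1, h2, h3⟩ := this
    exact ⟨l, h1, h2, h3.le⟩
  obtain ⟨l₁, h1, h2, h3⟩ := key ρ₁ (lt_of_le_of_lt le_self_add hfin')
  obtain ⟨l₂, h1', h2', h3'⟩ := key ρ₂ (lt_of_le_of_lt le_add_self hfin')
  refine (luxemburg_le (by positivity) (h l₁ l₂ h1 h1' h2 h2')).trans ?_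
  push_cast
  calc (C : ℝ≥0∞) * (l₁ + l₂)
      ≤ C * ((luxemburg ρ₁ + (ε / (2 * C) : ℝ≥0)) + (luxemburg ρ₂ + (ε / (2 * C) : ℝ≥0))) := by
        gcongr
    _ = C * (luxemburg ρ₁ + luxemburg ρ₂) + (C * (2 * (ε / (2 * C))) : ℝ≥0) := by
        push_cast; ring
    _ = C * (luxemburg ρ₁ + luxemburg ρ₂) + ε := by
        congr 2; field_simp

theorem luxemburg_le_mul {ρ ρ₁ : ℝ≥0 → ℝ≥0∞} {C : ℝ≥0} (hC : 0 < C)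
    (h : ∀ l, 0 < l → ρ₁ l ≤ 1 → ρ (C * l) ≤ 1) : luxemburg ρ ≤ C * luxemburg ρ₁ := by
  refine ENNReal.le_of_forall_pos_le_add fun ε hε hfin => ?_
  have hfin' : luxemburg ρ₁ < ∞ :=
    ENNReal.lt_top_of_mul_ne_top_right hfin.ne (by exact_mod_cast hC.ne')
  have hδ : (0 : ℝ≥0∞) < (ε / C : ℝ≥0) := by
    have : 0 < ε / C := by positivity
    exact_mod_cast this
  have : luxemburg ρ₁ < luxemburg ρ₁ + (ε / C : ℝ≥0) :=
    ENNReal.lt_add_right hfin'.ne hδ.ne'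
  conv_lhs at this => rw [luxemburg]
  simp only [iInf_lt_iff] at this
  obtain ⟨l, h1, h2, h3⟩ := this
  refine (luxemburg_le (by positivity) (h l h1 h2)).trans ?_
  push_cast
  calc (C : ℝ≥0∞) * l ≤ C * (luxemburg ρ₁ + (ε / C : ℝ≥0)) := by gcongr
    _ = C * luxemburg ρ₁ + (C * (ε / C) : ℝ≥0) := by push_cast; ring
    _ = C * luxemburg ρ₁ + ε := by congr 2; field_simp

theorem locallyIntegrable_of_mem_orliczSpace {n : ℕ} {A : ℝ≥0 → ℝ≥0∞} (hA : IsYoung A)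
    {u : Rn n → ℝ} (hu : u ∈ orliczSpace n A) : LocallyIntegrable u := by
  obtain ⟨hm, hfin⟩ := hu
  obtain ⟨l, hl, hl1⟩ := luxemburg_lt_top.1 hfin
  obtain ⟨b, M, hb, hM, hbM⟩ := hA.gauge.exists_le_add
  rw [MeasureTheory.locallyIntegrable_iff]
  intro K hK
  refine ⟨hm.aestronglyMeasurable.restrict, ?_⟩
  have hl0 : (l : ℝ≥0∞) ≠ 0 := by exact_mod_cast hl.ne'
  have h1 : ∫⁻ x in K, ‖u x‖ₑ / l ≤ b * volume K + M * 1 := by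
    calc ∫⁻ x in K, ‖u x‖ₑ / l ≤ ∫⁻ x in K, (b + M * youngExtend A (‖u x‖ₑ / l)) :=
          lintegral_mono fun x => hbM _
      _ = b * volume K + M * ∫⁻ x in K, youngExtend A (‖u x‖ₑ / l) := by
          rw [lintegral_add_left measurable_const, lintegral_const_mul' _ _ hM]
          simp
      _ ≤ _ := by
          gcongr
          exact (setLIntegral_le_lintegral _ _).trans hl1
  have h2 : ∫⁻ x in K, ‖u x‖ₑ / l < ∞ := by
    refine h1.trans_lt (ENNReal.add_lt_top.2
      ⟨ENNReal.mul_lt_top hb.lt_top hK.measure_lt_top, by simpa using hM.lt_top⟩)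
  simp only [div_eq_mul_inv] at h2
  rw [lintegral_mul_const' _ _ (by simpa using hl0)] at h2
  exact ENNReal.lt_top_of_mul_ne_top_left h2.ne (by simp)

/-! ### Polar coordinates and dilations -/

theorem lintegral_fun_norm (hn : 1 ≤ n) {f : ℝ → ℝ≥0∞} (hf : Measurable f) :
    ∫⁻ x : Rn n, f ‖x‖ =
      n * volume (Metric.ball (0 : Rn n) 1) *
        ∫⁻ r in Set.Ioi (0 : ℝ), ENNReal.ofReal (r ^ (n - 1)) * f r := by
  have : Nonempty (Fin n) := ⟨⟨0, hn⟩⟩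
  have hfr : Module.finrank ℝ (Rn n) = n := by simp
  calc ∫⁻ x : Rn n, f ‖x‖
      = ∫⁻ x : ({(0)}ᶜ : Set (Rn n)), f (‖x.1‖) ∂(volume.comap Subtype.val) := by
        rw [lintegral_subtype_comap (measurableSet_singleton _).compl fun x => f (‖x‖),
          restrict_compl_singleton]
    _ = ∫⁻ x, f x.2 ∂(volume : Measure (Rn n)).toSphere.prod (.volumeIoiPow (n - 1)) := by
        have h := (Measure.measurePreserving_homeomorphUnitSphereProd
          (volume : Measure (Rn n))).lintegral_comp_emb
          (Homeomorph.measurableEmbedding _) (f ∘ Subtype.val ∘ Prod.snd)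
        rw [hfr] at h
        simpa using h
    _ = (volume : Measure (Rn n)).toSphere Set.univ *
          ∫⁻ x : Set.Ioi (0 : ℝ), f x ∂.volumeIoiPow (n - 1) := by
        rw [lintegral_prod _ (by fun_prop)]
        simp only [lintegral_const]
        rw [mul_comm]
    _ = _ := by
        rw [Measure.toSphere_apply_univ, hfr, Measure.volumeIoiPow,
          lintegral_withDensity_eq_lintegral_mul _ (by fun_prop) (by fun_prop),
          ← lintegral_subtype_comap measurableSet_Ioi]
        rfl

/-- The weight |x|^{-n} turns r^{n-1} dr into dr/r, the scale measure of the oscillation seminorm.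
-/
theorem lintegral_fun_norm_div (hn : 1 ≤ n) {f : ℝ → ℝ≥0∞} (hf : Measurable f) :
    ∫⁻ x : Rn n, f ‖x‖ / ‖x‖ₑ ^ n =
      n * volume (Metric.ball (0 : Rn n) 1) *
        ∫⁻ r in Set.Ioi (0 : ℝ), f r / ENNReal.ofReal r := by
  have h := lintegral_fun_norm hn (f := fun r => f r / ENNReal.ofReal r ^ n) (by fun_prop)
  have e : ∀ x : Rn n, ENNReal.ofReal ‖x‖ = ‖x‖ₑ := fun x => ofReal_norm x
  simp only [e] at h
  rw [h]
  congr 1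
  refine setLIntegral_congr_fun measurableSet_Ioi fun r hr => ?_
  have hr : 0 < r := hr
  have h0 : ENNReal.ofReal r ≠ 0 := by simpa using hr
  rw [ENNReal.ofReal_pow hr.le]
  obtain ⟨k, rfl⟩ : ∃ k, n = k + 1 := ⟨n - 1, by omega⟩
  simp only [Nat.add_sub_cancel]
  rw [← mul_div_assoc, pow_succ, ENNReal.mul_div_mul_left _ _ (pow_ne_zero _ h0)
    (ENNReal.pow_ne_top ENNReal.ofReal_ne_top)]

theorem lintegral_comp_smul {c : ℝ} (hc : c ≠ 0) (Φ : Rn n → ℝ≥0∞) :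
    ‖c‖ₑ ^ n * ∫⁻ h, Φ (c • h) = ∫⁻ h, Φ h := by
  have e : ∫⁻ h, Φ (c • h) = ∫⁻ h, Φ h ∂(Measure.map (c • ·) (volume : Measure (Rn n))) :=
    (lintegral_map_equiv Φ (Homeomorph.smulOfNeZero c hc : Rn n ≃ₜ Rn n).toMeasurableEquiv).symm
  rw [e, Measure.map_addHaar_smul _ hc, lintegral_smul_measure]
  simp only [finrank_euclideanSpace, Fintype.card_fin, smul_eq_mul, abs_inv, abs_pow]
  rw [← mul_assoc, ENNReal.ofReal_inv_of_pos (by positivity), ENNReal.ofReal_pow (abs_nonneg _),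
    Real.enorm_eq_ofReal_abs, ENNReal.mul_inv_cancel, one_mul]
  · exact pow_ne_zero _ (by simpa using hc)
  · exact ENNReal.pow_ne_top ENNReal.ofReal_ne_top

/-- The measure dh/|h|^n is invariant under dilations, since the Jacobian cancels against the
weight. -/
theorem lintegral_comp_smul_div {c : ℝ} (hc : c ≠ 0) (Φ : Rn n → ℝ≥0∞) :
    ∫⁻ h, Φ (c • h) / ‖h‖ₑ ^ n = ∫⁻ h, Φ h / ‖h‖ₑ ^ n := by
  rw [← lintegral_comp_smul hc fun h => Φ h / ‖h‖ₑ ^ n, ← lintegral_const_mul' _ _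
    (ENNReal.pow_ne_top enorm_ne_top)]
  refine lintegral_congr fun h => ?_
  rw [enorm_smul, mul_pow, ← mul_div_assoc, ENNReal.mul_div_mul_left _ _
    (pow_ne_zero _ (by simpa using hc)) (ENNReal.pow_ne_top enorm_ne_top)]

/-! ### The oscillation and its measurability -/

theorem osc_congr {s : ℝ} {u v : Rn n → ℝ} (h : u =ᵐ[volume] v) : osc s u = osc s v := by
  funext x r
  unfold osc
  refine iInf_congr fun q => iInf_congr fun _ => ?_
  congr 1
  refine lintegral_congr_ae (ae_restrict_of_ae ?_)
  filter_upwards [h] with y hy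
  rw [hy]

/-- If `X` is at most `c` times the integral of `|u - q|` over a ball, for all polynomials `q` of
degree at most `[s]`, then it is controlled by the oscillation. -/
theorem le_osc {s : ℝ} {u : Rn n → ℝ} {x : Rn n} {r : ℝ} (hr : 0 < r) {X c : ℝ≥0∞}
    (hc : c ≠ ∞)
    (h : ∀ q : MvPolynomial (Fin n) ℝ, q.totalDegree ≤ ⌊s⌋₊ →
      X ≤ c * ∫⁻ y in Metric.ball x r, ‖u y - MvPolynomial.eval (fun i => y i) q‖ₑ) :
    X ≤ c * ENNReal.ofReal (r ^ s) * volume (Metric.ball x r) * osc s u x r := by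
  have hV0 : volume (Metric.ball x r) ≠ 0 := (Metric.measure_ball_pos _ _ hr).ne'
  have hV : volume (Metric.ball x r) ≠ ∞ := measure_ball_lt_top.ne
  have hs0 : ENNReal.ofReal (r ^ s) ≠ 0 := by simpa using Real.rpow_pos_of_pos hr s
  have hs : ENNReal.ofReal (r ^ s) ≠ ∞ := ENNReal.ofReal_ne_top
  have hfin : c * ENNReal.ofReal (r ^ s) * volume (Metric.ball x r) ≠ ∞ :=
    ENNReal.mul_ne_top (ENNReal.mul_ne_top hc hs) hV
  -- A constant is moved into the infimum only if it is neither 0 nor ∞; for c = 0 the hypothesis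
  -- already gives X = 0.
  rcases eq_or_ne c 0 with rfl | hc0
  · simpa using h 0 (by simp)
  have hne : c * ENNReal.ofReal (r ^ s) * volume (Metric.ball x r) ≠ 0 :=
    mul_ne_zero (mul_ne_zero hc0 hs0) hV0
  unfold osc
  rw [ENNReal.mul_iInf_of_ne hne hfin]
  refine le_iInf fun q => ?_
  rw [ENNReal.mul_iInf_of_ne hne hfin]
  refine le_iInf fun hq => (h q hq).trans (le_of_eq ?_)
  simp only [div_eq_mul_inv]
  rw [lintegral_mul_const' _ _ (by simpa using hs0)]
  set I := ∫⁻ y in Metric.ball x r, ‖u y - MvPolynomial.eval (fun i => y i) q‖ₑ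
  set S := ENNReal.ofReal (r ^ s)
  set V := volume (Metric.ball x r)
  calc c * I = c * I * (S * S⁻¹) * (V * V⁻¹) := by
        rw [ENNReal.mul_inv_cancel hs0 hs, ENNReal.mul_inv_cancel hV0 hV, mul_one, mul_one]
    _ = _ := by ring

theorem osc_le {s : ℝ} {u : Rn n → ℝ} {x : Rn n} {r : ℝ} {q : MvPolynomial (Fin n) ℝ}
    (hq : q.totalDegree ≤ ⌊s⌋₊) :
    osc s u x r ≤ (∫⁻ y in Metric.ball x r,
      ‖u y - MvPolynomial.eval (fun i => y i) q‖ₑ / ENNReal.ofReal (r ^ s)) /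
        volume (Metric.ball x r) :=
  iInf₂_le q hq

theorem measurable_setLIntegral_ball {T : Type*} [MeasurableSpace T] {c : T → Rn n} {ρ : T → ℝ}
    (hc : Measurable c) (hρ : Measurable ρ) {f : T × Rn n → ℝ≥0∞} (hf : Measurable f) :
    Measurable fun p : T => ∫⁻ y in Metric.ball (c p) (ρ p), f (p, y) := by
  have hS : MeasurableSet {z : T × Rn n | dist z.2 (c z.1) < ρ z.1} :=
    measurableSet_lt (by fun_prop) (by fun_prop)
  have h := (hf.indicator hS).lintegral_prod_right' (ν := volume)
  convert h using 2 with p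
  rw [← lintegral_indicator measurableSet_ball]
  refine lintegral_congr fun y => ?_
  simp only [Set.indicator, Metric.mem_ball, Set.mem_ofPred_eq]

/-- Each coefficient is rounded to within ε / (|K| + 1), where K bounds the sum of the absolute
values of the monomials on the ball. It serves to replace the infimum in `osc` by a countable one.
-/
theorem exists_rat_approx (q : MvPolynomial (Fin n) ℝ) (x : Rn n) (r : ℝ) {ε : ℝ} (hε : 0 < ε) :
    ∃ q' : MvPolynomial (Fin n) ℚ, q'.totalDegree ≤ q.totalDegree ∧ ∀ y ∈ Metric.ball x r,
      |MvPolynomial.eval (fun i => y i) q -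
        MvPolynomial.eval (fun i => y i) (q'.map (algebraMap ℚ ℝ))| ≤ ε := by
  obtain ⟨K, hK⟩ : ∃ K : ℝ, ∀ y ∈ Metric.closedBall x r,
      ‖∑ d ∈ q.support, |∏ i, (y i) ^ (d i)|‖ ≤ K :=
    (isCompact_closedBall x r).exists_bound_of_continuousOn
      (f := fun y : Rn n => ∑ d ∈ q.support, |∏ i, (y i) ^ (d i)|) (by fun_prop)
  have hK' : 0 < |K| + 1 := by positivity
  choose c hc using fun d => exists_rat_near (q.coeff d) (div_pos hε hK')
  refine ⟨∑ d ∈ q.support, MvPolynomial.monomial d (c d), ?_, fun y hy => ?_⟩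
  · refine MvPolynomial.totalDegree_finsetSum_le fun d hd => ?_
    refine (MvPolynomial.totalDegree_monomial_le _ _).trans ?_
    exact MvPolynomial.le_totalDegree hd
  · have h1 := hK y (Metric.ball_subset_closedBall hy)
    rw [map_sum, map_sum, MvPolynomial.eval_eq', ← Finset.sum_sub_distrib]
    simp only [MvPolynomial.map_monomial, MvPolynomial.eval_monomial]
    calc |∑ d ∈ q.support, (q.coeff d * ∏ i, y i ^ d i -
            algebraMap ℚ ℝ (c d) * d.prod fun i e => y i ^ e)|
        ≤ ∑ d ∈ q.support, ε / (|K| + 1) * |∏ i, y i ^ d i| := by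
          refine (Finset.abs_sum_le_sum_abs _ _).trans (Finset.sum_le_sum fun d _ => ?_)
          rw [Finsupp.prod_fintype _ _ (by simp), ← sub_mul, abs_mul]
          gcongr
          exact (hc d).le
      _ = ε / (|K| + 1) * ∑ d ∈ q.support, |∏ i, y i ^ d i| := by rw [Finset.mul_sum]
      _ ≤ ε / (|K| + 1) * (|K| + 1) := by
          gcongr
          exact (le_abs_self _).trans (h1.trans ((le_abs_self K).trans (by linarith)))
      _ = ε := by field_simp

theorem osc_eq_iInf_rat {s : ℝ} (u : Rn n → ℝ) (x : Rn n) {r : ℝ} (hr : 0 < r) :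
    osc s u x r = ⨅ q : {q : MvPolynomial (Fin n) ℚ // q.totalDegree ≤ ⌊s⌋₊},
      (∫⁻ y in Metric.ball x r,
      ‖u y - MvPolynomial.eval (fun i => y i) (q.1.map (algebraMap ℚ ℝ))‖ₑ /
        ENNReal.ofReal (r ^ s)) / volume (Metric.ball x r) := by
  have hV0 : volume (Metric.ball x r) ≠ 0 := (Metric.measure_ball_pos _ _ hr).ne'
  have hV : volume (Metric.ball x r) ≠ ∞ := measure_ball_lt_top.ne
  have hs : 0 < r ^ s := Real.rpow_pos_of_pos hr s
  apply le_antisymm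
  · refine le_iInf fun q => osc_le ?_
    exact (Finset.sup_mono (MvPolynomial.support_map_subset _ _)).trans q.2
  · refine le_iInf₂ fun q hq => ?_
    refine ENNReal.le_of_forall_pos_le_add fun ε hε _ => ?_
    obtain ⟨q', hq', hqq⟩ := exists_rat_approx q x r (ε := ε * r ^ s) (by positivity)
    refine (iInf_le _ ⟨q', hq'.trans hq⟩).trans ?_
    have h1 : ∀ y ∈ Metric.ball x r,
        ‖u y - MvPolynomial.eval (fun i => y i) (q'.map (algebraMap ℚ ℝ))‖ₑ /
          ENNReal.ofReal (r ^ s) ≤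
        ‖u y - MvPolynomial.eval (fun i => y i) q‖ₑ / ENNReal.ofReal (r ^ s) + ε := by
      intro y hy
      rw [ENNReal.div_le_iff (by simpa using hs) ENNReal.ofReal_ne_top, add_mul,
        ENNReal.div_mul_cancel (by simpa using hs) ENNReal.ofReal_ne_top]
      have e : (ε : ℝ≥0∞) * ENNReal.ofReal (r ^ s) = ENNReal.ofReal (ε * r ^ s) := by
        rw [ENNReal.ofReal_mul (by positivity), ENNReal.ofReal_coe_nnreal]
      rw [e, ← ofReal_norm, ← ofReal_norm, ← ENNReal.ofReal_add (by positivity) (by positivity)]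
      apply ENNReal.ofReal_le_ofReal
      have h2 := hqq y hy
      rw [← Real.norm_eq_abs] at h2
      refine le_trans ?_ (add_le_add_right h2 _)
      refine le_trans (le_of_eq ?_) (norm_add_le _ _)
      congr 1; ring
    calc _ ≤ (∫⁻ y in Metric.ball x r,
        (‖u y - MvPolynomial.eval (fun i => y i) q‖ₑ / ENNReal.ofReal (r ^ s) + ε)) /
          volume (Metric.ball x r) := by
          refine ENNReal.div_le_div_right (setLIntegral_mono' measurableSet_ball h1) _
      _ = _ := by
          rw [lintegral_add_right _ measurable_const, lintegral_const, ENNReal.add_div]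
          congr 1
          rw [Measure.restrict_apply_univ, ENNReal.mul_div_cancel_right hV0 hV]

/-- For positive radii `osc` is an infimum over the countable family of rational polynomials. For r
≤ 0 the ball is empty and the convention 0/0 = 0 makes `osc` vanish. -/
theorem measurable_osc {s : ℝ} {u : Rn n → ℝ} (hu : AEMeasurable u) :
    Measurable fun p : Rn n × ℝ => osc s u p.1 p.2 := by
  rw [osc_congr hu.ae_eq_mk]
  have hm := hu.measurable_mk
  set v := hu.mk u
  have hcount : Countable {q : MvPolynomial (Fin n) ℚ // q.totalDegree ≤ ⌊s⌋₊} := by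
    have : Countable (MvPolynomial (Fin n) ℚ) :=
      Function.Injective.countable (f := fun q : MvPolynomial (Fin n) ℚ =>
        AddMonoidAlgebra.coeff (R := ℚ) (M := Fin n →₀ ℕ) q)
        fun a b h => by cases a; cases b; simpa using h
    infer_instance
  have h1 : Measurable fun p : Rn n × ℝ =>
      ⨅ q : {q : MvPolynomial (Fin n) ℚ // q.totalDegree ≤ ⌊s⌋₊},
      (∫⁻ y in Metric.ball p.1 p.2,
      ‖v y - MvPolynomial.eval (fun i => y i) (q.1.map (algebraMap ℚ ℝ))‖ₑ /
        ENNReal.ofReal (p.2 ^ s)) / volume (Metric.ball p.1 p.2) := by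
    refine Measurable.iInf fun q => ?_
    refine Measurable.div ?_ ?_
    · refine measurable_setLIntegral_ball (f := fun z : (Rn n × ℝ) × Rn n =>
        ‖v z.2 - MvPolynomial.eval (fun i => z.2 i) (q.1.map (algebraMap ℚ ℝ))‖ₑ /
        ENNReal.ofReal (z.1.2 ^ s)) measurable_fst measurable_snd ?_
      have hp : Measurable fun y : Rn n =>
          MvPolynomial.eval (fun i => y i) (q.1.map (algebraMap ℚ ℝ)) := by
        have : Continuous fun y : Rn n =>
          MvPolynomial.eval (fun i => y i) (q.1.map (algebraMap ℚ ℝ)) :=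
          (MvPolynomial.continuous_eval _).comp (by fun_prop)
        exact this.measurable
      refine Measurable.div ?_ ?_
      · exact ((hm.comp measurable_snd).sub (hp.comp measurable_snd)).enorm
      · fun_prop
    · have := measurable_setLIntegral_ball (n := n) (T := Rn n × ℝ) (f := fun _ => 1)
        measurable_fst measurable_snd measurable_const
      simpa using this
  have hS : MeasurableSet {p : Rn n × ℝ | 0 < p.2} := measurableSet_lt measurable_const measurable_snd
  have h2 := h1.indicator hS
  convert h2 using 2 with p
  by_cases hp : 0 < p.2
  · rw [Set.indicator_of_mem (by exact hp), osc_eq_iInf_rat v p.1 hp]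
  · rw [Set.indicator_of_notMem (by exact hp)]
    refine nonpos_iff_eq_zero.1 ((osc_le (q := 0) (by simp)).trans ?_)
    rw [Metric.ball_eq_empty.2 (not_lt.1 hp)]
    simp

/-! ### Iterated partial derivatives -/

/-- The iterated partial derivative along a list of coordinates. -/
def listD (l : List (Fin n)) (f : Rn n → ℝ) : Rn n → ℝ := l.foldr partialD f

@[simp] theorem listD_nil (f : Rn n → ℝ) : listD [] f = f := rfl

@[simp] theorem listD_cons (i : Fin n) (l : List (Fin n)) (f : Rn n → ℝ) :
    listD (i :: l) f = partialD i (listD l f) := rfl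

theorem listD_append (l l' : List (Fin n)) (f : Rn n → ℝ) :
    listD (l ++ l') f = listD l (listD l' f) := List.foldr_append

theorem listD_replicate (k : ℕ) (i : Fin n) (f : Rn n → ℝ) :
    listD (List.replicate k i) f = (partialD i)^[k] f := by
  induction k with
  | zero => rfl
  | succ k ih => rw [List.replicate_succ, listD_cons, ih, Function.iterate_succ_apply']

/-- A list of coordinates in which `i` occurs `α i` times. -/
def listOf (α : Fin n → ℕ) : List (Fin n) :=
  (List.finRange n).flatMap fun i => List.replicate (α i) i

theorem multiD_eq_listD (α : Fin n → ℕ) (f : Rn n → ℝ) : multiD α f = listD (listOf α) f := by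
  unfold multiD listOf
  induction List.finRange n with
  | nil => rfl
  | cons i L ih => rw [List.foldr_cons, ih, List.flatMap_cons, listD_append, listD_replicate]

theorem count_listOf (α : Fin n → ℕ) (i : Fin n) : (listOf α).count i = α i := by
  unfold listOf
  rw [List.count_flatMap]
  have : ∀ j : Fin n, (List.count i ∘ fun j => List.replicate (α j) j) j =
      if j = i then α i else 0 := by
    intro j
    by_cases h : j = i
    · subst h; simp
    · simp [List.count_replicate, h]
  rw [List.map_congr_left fun j _ => this j, ← Fin.sum_univ_def]
  simp

theorem length_listOf (α : Fin n → ℕ) : (listOf α).length = ∑ i, α i := by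
  unfold listOf
  rw [List.length_flatMap, Fin.sum_univ_def]
  simp

theorem contDiff_partialD {f : Rn n → ℝ} (hf : ContDiff ℝ (⊤ : ℕ∞) f) (i : Fin n) :
    ContDiff ℝ (⊤ : ℕ∞) (partialD i f) :=
  (hf.fderiv_right (m := (⊤ : ℕ∞)) (by exact_mod_cast le_top)).clm_apply contDiff_const

theorem contDiff_listD {f : Rn n → ℝ} (hf : ContDiff ℝ (⊤ : ℕ∞) f) (l : List (Fin n)) :
    ContDiff ℝ (⊤ : ℕ∞) (listD l f) := by
  induction l with
  | nil => exact hf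
  | cons i l ih => exact contDiff_partialD ih i

theorem tsupport_partialD_subset (f : Rn n → ℝ) (i : Fin n) :
    tsupport (partialD i f) ⊆ tsupport f := by
  refine closure_minimal (fun x hx => ?_) isClosed_closure
  by_contra h
  apply hx
  have : fderiv ℝ f x = 0 := by
    by_contra h'
    exact h (support_fderiv_subset ℝ (f := f) h')
  simp [partialD, this]

theorem tsupport_listD_subset (f : Rn n → ℝ) (l : List (Fin n)) :
    tsupport (listD l f) ⊆ tsupport f := by
  induction l with
  | nil => exact subset_rfl
  | cons i l ih => exact (tsupport_partialD_subset _ i).trans ih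

theorem hasCompactSupport_listD {f : Rn n → ℝ} (hf : HasCompactSupport f) (l : List (Fin n)) :
    HasCompactSupport (listD l f) :=
  hf.of_isClosed_subset isClosed_closure (tsupport_listD_subset f l)

theorem partialD_comm {f : Rn n → ℝ} (hf : ContDiff ℝ (⊤ : ℕ∞) f) (i j : Fin n) :
    partialD i (partialD j f) = partialD j (partialD i f) := by
  have hd : Differentiable ℝ (fderiv ℝ f) :=
    (hf.fderiv_right (m := (⊤ : ℕ∞)) (by exact_mod_cast le_top)).differentiable (by simp)
  funext x
  have hs : IsSymmSndFDerivAt ℝ f x :=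
    hf.contDiffAt.isSymmSndFDerivAt (by simpa using WithTop.coe_le_coe.2 (le_top : (2 : ℕ∞) ≤ ⊤))
  have key : ∀ i j : Fin n, partialD i (partialD j f) x =
      fderiv ℝ (fderiv ℝ f) x (EuclideanSpace.single i 1) (EuclideanSpace.single j 1) := by
    intro i j
    unfold partialD
    rw [fderiv_clm_apply (hd x) (differentiableAt_const _)]
    simp
  rw [key, key, hs.eq]

/-- By the symmetry of second derivatives only the multiplicities of the coordinates count. This
links lists, on which one can induct, with multi-indices. -/
theorem listD_perm {f : Rn n → ℝ} (hf : ContDiff ℝ (⊤ : ℕ∞) f) {l l' : List (Fin n)}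
    (h : l.Perm l') : listD l f = listD l' f := by
  induction h with
  | nil => rfl
  | cons i _ ih => rw [listD_cons, listD_cons, ih]
  | swap i j l => simp only [listD_cons]; exact partialD_comm (contDiff_listD hf l) _ _
  | trans _ _ h1 h2 => rw [h1, h2]

theorem partialD_affine {f : Rn n → ℝ} (hf : ContDiff ℝ (⊤ : ℕ∞) f) (a : Rn n) (b c : ℝ)
    (i : Fin n) : partialD i (fun y => c * f (a + b • y)) =
      fun y => c * b * partialD i f (a + b • y) := by
  funext y
  have hfd : HasFDerivAt f (fderiv ℝ f (a + b • y)) (a + b • y) :=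
    (hf.differentiable (by simp) _).hasFDerivAt
  have h1 : HasFDerivAt (fun y : Rn n => a + b • y) (b • ContinuousLinearMap.id ℝ (Rn n)) y :=
    ((hasFDerivAt_id y).const_smul b).const_add a
  have h2 := (hfd.comp y h1).const_mul c
  unfold partialD
  have h3 : fderiv ℝ (fun y => c * f (a + b • y)) y = _ := h2.fderiv
  rw [h3]
  simp
  ring

/-- Used with b = -1 for the reflections y ↦ x - y inside convolutions and with b = 1/ρ for dilated
mollifiers. -/
theorem listD_affine {f : Rn n → ℝ} (hf : ContDiff ℝ (⊤ : ℕ∞) f) (a : Rn n) (b c : ℝ)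
    (l : List (Fin n)) : listD l (fun y => c * f (a + b • y)) =
      fun y => c * b ^ l.length * listD l f (a + b • y) := by
  induction l with
  | nil => simp
  | cons i l ih =>
    rw [listD_cons, ih, partialD_affine (contDiff_listD hf l)]
    funext y
    simp only [List.length_cons, pow_succ, mul_assoc]
    rfl

theorem integral_mul_partialD {f g : Rn n → ℝ} (hf : ContDiff ℝ (⊤ : ℕ∞) f)
    (hg : ContDiff ℝ (⊤ : ℕ∞) g) (hgc : HasCompactSupport g) (i : Fin n) :
    ∫ x, f x * partialD i g x = -∫ x, partialD i f x * g x := by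
  have hg' : HasCompactSupport (partialD i g) := hasCompactSupport_listD hgc [i]
  refine integral_mul_fderiv_eq_neg_fderiv_mul_of_integrable ?_ ?_ ?_
    (fun x _ => hf.differentiable (by simp) x) (fun x _ => hg.differentiable (by simp) x)
  · exact ((contDiff_partialD hf i).continuous.mul hg.continuous).integrable_of_hasCompactSupport
      hgc.mul_left
  · exact (hf.continuous.mul (contDiff_partialD hg i).continuous).integrable_of_hasCompactSupport
      hg'.mul_left
  · exact (hf.continuous.mul hg.continuous).integrable_of_hasCompactSupport hgc.mul_left

theorem integral_mul_listD {f g : Rn n → ℝ} (hf : ContDiff ℝ (⊤ : ℕ∞) f)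
    (hg : ContDiff ℝ (⊤ : ℕ∞) g) (hgc : HasCompactSupport g) (l : List (Fin n)) :
    ∫ x, f x * listD l g x = (-1) ^ l.length * ∫ x, listD l f x * g x := by
  induction l generalizing f with
  | nil => simp
  | cons i l ih =>
    rw [listD_cons, integral_mul_partialD hf (contDiff_listD hg l) (hasCompactSupport_listD hgc l),
      ih (contDiff_partialD hf i)]
    -- Integration by parts moves the derivatives onto f in the opposite order, so they have to be
    -- permuted.
    have : listD l (partialD i f) = listD (i :: l) f := by
      have h1 : listD (l ++ [i]) f = listD l (partialD i f) := listD_append l [i] f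
      rw [← h1]
      exact listD_perm hf (List.perm_append_comm (l₁ := l) (l₂ := [i]))
    rw [this, List.length_cons, pow_succ]
    simp

/-! ### Polynomial functions -/

/-- The function on `ℝⁿ` defined by a polynomial. -/
def polyFun (q : MvPolynomial (Fin n) ℝ) : Rn n → ℝ :=
  fun y => MvPolynomial.eval (fun i => y i) q

theorem contDiff_polyFun (q : MvPolynomial (Fin n) ℝ) : ContDiff ℝ (⊤ : ℕ∞) (polyFun q) := by
  have : polyFun q = fun y : Rn n => ∑ d ∈ q.support, q.coeff d * ∏ i, y i ^ d i := by
    funext y; exact MvPolynomial.eval_eq' _ _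
  rw [this]
  fun_prop

theorem partialD_polyFun (q : MvPolynomial (Fin n) ℝ) (i : Fin n) :
    partialD i (polyFun q) = polyFun (MvPolynomial.pderiv i q) := by
  have hd : ∀ (q : MvPolynomial (Fin n) ℝ) x, DifferentiableAt ℝ (polyFun q) x :=
    fun q x => (contDiff_polyFun q).differentiable (by simp) x
  funext x
  induction q using MvPolynomial.induction_on with
  | C a =>
    have : polyFun (n := n) (MvPolynomial.C a) = fun _ => a := by funext; simp [polyFun]
    simp [partialD, this]
    simp [polyFun]
  | add p q hp hq =>
    have : polyFun (p + q) = polyFun p + polyFun q := by funext; simp [polyFun]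
    unfold partialD at *
    rw [this, fderiv_add (hd _ _) (hd _ _), map_add]
    simp only [_root_.add_apply, hp, hq]
    simp [polyFun]
  | mul_X p j hp =>
    have h1 : polyFun (p * MvPolynomial.X j) = fun y => polyFun p y * y j := by
      funext; simp [polyFun]
    have h2 : HasFDerivAt (fun y : Rn n => y j) (EuclideanSpace.proj j : Rn n →L[ℝ] ℝ) x :=
      (EuclideanSpace.proj j : Rn n →L[ℝ] ℝ).hasFDerivAt
    unfold partialD at *
    have h3 : fderiv ℝ (fun y : Rn n => polyFun p y * y j) x = _ :=
      ((hd p x).hasFDerivAt.mul h2).fderiv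
    rw [h1, h3]
    rw [MvPolynomial.pderiv_mul, MvPolynomial.pderiv_X]
    simp only [_root_.add_apply, _root_.smul_apply, hp, smul_eq_mul]
    by_cases hij : i = j
    · subst hij; simp [polyFun]; ring
    · simp [polyFun, Ne.symm hij]; ring

theorem totalDegree_pderiv_le (q : MvPolynomial (Fin n) ℝ) (i : Fin n) :
    (MvPolynomial.pderiv i q).totalDegree ≤ q.totalDegree - 1 := by
  conv_lhs => rw [MvPolynomial.as_sum q, map_sum]
  refine MvPolynomial.totalDegree_finsetSum_le fun d hd => ?_
  rw [MvPolynomial.pderiv_monomial]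
  by_cases h0 : d i = 0
  · simp [h0]
  refine (MvPolynomial.totalDegree_monomial_le _ _).trans ?_
  have h1 : (d.sum fun _ e => e) ≤ q.totalDegree := MvPolynomial.le_totalDegree hd
  have h2 : (d.sum fun _ e => e) = ((d - Finsupp.single i 1).sum fun _ e => e) + 1 := by
    have h3 : d = (d - Finsupp.single i 1) + Finsupp.single i 1 := by
      refine (tsub_add_cancel_of_le ?_).symm
      rw [Finsupp.single_le_iff]; omega
    conv_lhs => rw [h3]
    rw [Finsupp.sum_add_index' (by simp) (by simp), Finsupp.sum_single_index rfl]
  change ((d - Finsupp.single i 1).sum fun _ e => e) ≤ _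
  omega

theorem exists_listD_polyFun (q : MvPolynomial (Fin n) ℝ) (l : List (Fin n)) :
    ∃ q' : MvPolynomial (Fin n) ℝ, q'.totalDegree ≤ q.totalDegree - l.length ∧
      listD l (polyFun q) = polyFun q' := by
  induction l with
  | nil => exact ⟨q, by simp, rfl⟩
  | cons i l ih =>
    obtain ⟨q', h1, h2⟩ := ih
    refine ⟨MvPolynomial.pderiv i q', ?_, ?_⟩
    · refine (totalDegree_pderiv_le q' i).trans ?_
      simp only [List.length_cons]; omega
    · rw [listD_cons, h2, partialD_polyFun]

/-! ### Convolutions -/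

/-- The convolution `x ↦ ∫ f (x - y) u y dy`. -/
def conv (f u : Rn n → ℝ) (x : Rn n) : ℝ := ∫ y, f (x - y) * u y

theorem conv_eq_convolution (f u : Rn n → ℝ) :
    conv f u = convolution f u (ContinuousLinearMap.mul ℝ ℝ) volume := by
  funext x; exact convolution_mul_swap.symm

theorem integrable_conv {f u : Rn n → ℝ} (hf : Continuous f) (hfc : HasCompactSupport f)
    (hu : LocallyIntegrable u) (x : Rn n) : Integrable fun y => f (x - y) * u y := by
  have h := hfc.convolutionExists_left (ContinuousLinearMap.mul ℝ ℝ) (μ := volume) hf hu x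
  have h2 := h.integrable_swap
  simpa using h2

theorem contDiff_conv {f u : Rn n → ℝ} (hf : ContDiff ℝ (⊤ : ℕ∞) f) (hfc : HasCompactSupport f)
    (hu : LocallyIntegrable u) : ContDiff ℝ (⊤ : ℕ∞) (conv f u) := by
  rw [conv_eq_convolution]
  exact hfc.contDiff_convolution_left _ hf hu

theorem partialD_conv {f u : Rn n → ℝ} (hf : ContDiff ℝ (⊤ : ℕ∞) f) (hfc : HasCompactSupport f)
    (hu : LocallyIntegrable u) (i : Fin n) : partialD i (conv f u) = conv (partialD i f) u := by
  funext x
  have h := hfc.hasFDerivAt_convolution_left (ContinuousLinearMap.mul ℝ ℝ) (μ := volume)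
    (hf.of_le (by exact_mod_cast le_top)) hu x
  have hc : Continuous (fderiv ℝ f) := hf.continuous_fderiv (by simp)
  have h2 := (hfc.fderiv ℝ).convolutionExists_left
    ((ContinuousLinearMap.mul ℝ ℝ).precompL (Rn n)) (μ := volume) hc hu x
  unfold partialD
  rw [conv_eq_convolution, h.fderiv, convolution_eq_swap,
    ContinuousLinearMap.integral_apply h2.integrable_swap]
  rfl

theorem listD_conv {f u : Rn n → ℝ} (hf : ContDiff ℝ (⊤ : ℕ∞) f) (hfc : HasCompactSupport f)
    (hu : LocallyIntegrable u) (l : List (Fin n)) : listD l (conv f u) = conv (listD l f) u := by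
  induction l with
  | nil => rfl
  | cons i l ih =>
    rw [listD_cons, ih, partialD_conv (contDiff_listD hf l) (hasCompactSupport_listD hfc l) hu]
    rfl

/-- The test function is y ↦ f(x - y). The sign (-1)^|α| from the chain rule cancels the one in the
definition of the weak derivative. -/
theorem IsWeakDeriv.conv_multiD {α : Fin n → ℕ} {u g f : Rn n → ℝ} (h : IsWeakDeriv α u g)
    (hf : ContDiff ℝ (⊤ : ℕ∞) f) (hfc : HasCompactSupport f) :
    conv (multiD α f) u = conv f g := by
  funext x
  have e : (fun y : Rn n => f (x - y)) = fun y => 1 * f (x + (-1 : ℝ) • y) := by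
    funext y; rw [one_mul, neg_one_smul, sub_eq_add_neg]
  have h1 : ContDiff ℝ (⊤ : ℕ∞) fun y => f (x - y) := hf.comp (contDiff_const.sub contDiff_id)
  have h2 : HasCompactSupport fun y => f (x - y) :=
    hfc.comp_homeomorph (Homeomorph.subLeft x)
  have h3 := h.2.2 _ h1 h2
  rw [multiD_eq_listD, e, listD_affine hf, length_listOf] at h3
  unfold conv
  rw [multiD_eq_listD]
  have e1 : ∫ y, u y * (1 * (-1) ^ (∑ i, α i) * listD (listOf α) f (x + (-1 : ℝ) • y)) =
      (-1) ^ (∑ i, α i) * ∫ y, listD (listOf α) f (x - y) * u y := by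
    rw [← integral_const_mul]
    congr 1; funext y
    rw [neg_one_smul, ← sub_eq_add_neg]; ring
  have e2 : ∫ y, g y * f (x - y) = ∫ y, f (x - y) * g y := by
    congr 1; funext y; ring
  rw [e1, e2] at h3
  exact mul_left_cancel₀ (pow_ne_zero _ (by norm_num)) h3

/-! ### Taylor's formula -/

/-- The vector of all classical partial derivatives of order `k`. -/
def smoothGrad (k : ℕ) (f : Rn n → ℝ) : Rn n → EuclideanSpace ℝ (MultiIndex n k) :=
  fun x => WithLp.toLp 2 fun α => multiD α.1 f x

theorem sum_multiIndex {k : ℕ} (α : MultiIndex n k) : ∑ i, α.1 i = k :=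
  (Finset.mem_piAntidiag.1 α.2).1

/-- A multi-index of order `k` as an element of `MultiIndex n k`. -/
def toMultiIndex {k : ℕ} (α : Fin n → ℕ) (h : ∑ i, α i = k) : MultiIndex n k :=
  ⟨α, Finset.mem_piAntidiag.2 ⟨h, fun _ _ => Finset.mem_univ _⟩⟩

theorem enorm_apply_le {ι : Type*} [Fintype ι] (v : EuclideanSpace ℝ ι) (i : ι) : ‖v i‖ₑ ≤ ‖v‖ₑ := by
  rw [← ofReal_norm, ← ofReal_norm]
  exact ENNReal.ofReal_le_ofReal (PiLp.norm_apply_le v i)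

theorem enorm_le_sum {ι : Type*} [Fintype ι] (v : EuclideanSpace ℝ ι) : ‖v‖ₑ ≤ ∑ i, ‖v i‖ₑ := by
  classical
  have h : v = ∑ i, EuclideanSpace.single i (v i) := by
    ext j; simp
  conv_lhs => rw [h]
  refine (enorm_sum_le _ _).trans (Finset.sum_le_sum fun i _ => ?_)
  rw [← ofReal_norm, PiLp.norm_single, ofReal_norm]

theorem multiD_partialD {f : Rn n → ℝ} (hf : ContDiff ℝ (⊤ : ℕ∞) f) (i : Fin n) (α : Fin n → ℕ) :
    multiD α (partialD i f) = multiD (α + Pi.single i 1) f := by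
  have h1 : listD (listOf α) (partialD i f) = listD (listOf α ++ [i]) f :=
    (listD_append _ [i] f).symm
  rw [multiD_eq_listD, h1, multiD_eq_listD]
  refine listD_perm hf (List.perm_iff_count.2 fun j => ?_)
  rw [List.count_append, count_listOf, count_listOf, Pi.add_apply, List.count_singleton]
  congr 1
  by_cases h : j = i
  · subst h; simp
  · simp [h, Ne.symm h]

theorem enorm_smoothGrad_partialD_le {f : Rn n → ℝ} (hf : ContDiff ℝ (⊤ : ℕ∞) f) (i : Fin n)
    (k : ℕ) (x y : Rn n) :
    ‖smoothGrad k (partialD i f) x - smoothGrad k (partialD i f) y‖ₑ ≤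
      Fintype.card (MultiIndex n k) * ‖smoothGrad (k + 1) f x - smoothGrad (k + 1) f y‖ₑ := by
  refine (enorm_le_sum _).trans ?_
  rw [← Finset.card_univ, ← nsmul_eq_mul, ← Finset.sum_const]
  refine Finset.sum_le_sum fun α _ => ?_
  have hα : ∑ j, (α.1 + Pi.single i 1 : Fin n → ℕ) j = k + 1 := by
    simp [Finset.sum_add_distrib, sum_multiIndex α]
  refine le_trans (le_of_eq ?_) (enorm_apply_le _ (toMultiIndex _ hα))
  simp [smoothGrad, multiD_partialD hf, toMultiIndex]

theorem continuous_smoothGrad {f : Rn n → ℝ} (hf : ContDiff ℝ (⊤ : ℕ∞) f) (k : ℕ) :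
    Continuous (smoothGrad k f) := by
  refine (PiLp.continuous_toLp 2 _).comp (continuous_pi fun α => ?_)
  rw [multiD_eq_listD]
  exact (contDiff_listD hf _).continuous

theorem sum_smul_single (h : Rn n) : ∑ i, h i • EuclideanSpace.single i (1 : ℝ) = h := by
  ext j; simp [Pi.single_apply]

theorem fderiv_eq_sum_partialD (f : Rn n → ℝ) (x h : Rn n) :
    fderiv ℝ f x h = ∑ i, h i * partialD i f x := by
  conv_lhs => rw [← sum_smul_single h]
  simp [partialD]

theorem sub_eq_integral_partialD {f : Rn n → ℝ} (hf : ContDiff ℝ (⊤ : ℕ∞) f) (z h : Rn n) :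
    f (z + h) - f z = ∫ t in (0 : ℝ)..1, ∑ i, h i * partialD i f (z + t • h) := by
  have hd : ∀ t ∈ Set.uIcc (0 : ℝ) 1, HasDerivAt (fun t : ℝ => f (z + t • h))
      (∑ i, h i * partialD i f (z + t • h)) t := by
    intro t _
    have h1 : HasDerivAt (fun t : ℝ => z + t • h) h t := by
      simpa using ((hasDerivAt_id t).smul_const h).const_add z
    have h2 := ((hf.differentiable (by simp) (z + t • h)).hasFDerivAt).comp_hasDerivAt t h1
    rw [fderiv_eq_sum_partialD] at h2
    exact h2
  have hc : Continuous fun t : ℝ => ∑ i, h i * partialD i f (z + t • h) := by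
    refine continuous_finsetSum _ fun i _ => continuous_const.mul ?_
    exact (contDiff_partialD hf i).continuous.comp (by fun_prop)
  rw [intervalIntegral.integral_eq_sub_of_hasDerivAt hd (hc.intervalIntegrable _ _)]
  simp

/-- The polynomial `h ↦ ∫ t in 0..1, q (t h)`. -/
def rayIntegral (q : MvPolynomial (Fin n) ℝ) : MvPolynomial (Fin n) ℝ :=
  ∑ d ∈ q.support, MvPolynomial.monomial d (q.coeff d / ((∑ i, d i : ℕ) + 1))

theorem totalDegree_rayIntegral_le (q : MvPolynomial (Fin n) ℝ) :
    (rayIntegral q).totalDegree ≤ q.totalDegree :=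
  MvPolynomial.totalDegree_finsetSum_le fun _ hd =>
    (MvPolynomial.totalDegree_monomial_le _ _).trans (MvPolynomial.le_totalDegree hd)

theorem integral_polyFun_smul (q : MvPolynomial (Fin n) ℝ) (h : Rn n) :
    ∫ t in (0 : ℝ)..1, polyFun q (t • h) = polyFun (rayIntegral q) h := by
  have e : ∀ t : ℝ, polyFun q (t • h) =
      ∑ d ∈ q.support, (q.coeff d * ∏ i, h i ^ d i) * t ^ (∑ i, d i) := by
    intro t
    unfold polyFun
    rw [MvPolynomial.eval_eq']
    refine Finset.sum_congr rfl fun d _ => ?_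
    simp only [PiLp.smul_apply, smul_eq_mul, mul_pow, Finset.prod_mul_distrib,
      Finset.prod_pow_eq_pow_sum]
    ring
  simp_rw [e]
  rw [intervalIntegral.integral_finsetSum
    fun d _ => (by fun_prop : Continuous _).intervalIntegrable _ _]
  unfold polyFun rayIntegral
  rw [map_sum]
  refine Finset.sum_congr rfl fun d _ => ?_
  rw [intervalIntegral.integral_const_mul, integral_pow, MvPolynomial.eval_monomial,
    Finsupp.prod_fintype _ _ (by simp)]
  simp
  ring

theorem totalDegree_add_sum_X_mul_le {m : ℕ} (a : ℝ) {p : Fin n → MvPolynomial (Fin n) ℝ}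
    (hp : ∀ i, (p i).totalDegree ≤ m) :
    (MvPolynomial.C a + ∑ i, MvPolynomial.X i * p i).totalDegree ≤ m + 1 := by
  refine (MvPolynomial.totalDegree_add _ _).trans (max_le (by simp) ?_)
  refine MvPolynomial.totalDegree_finsetSum_le fun i _ => ?_
  refine (MvPolynomial.totalDegree_mul _ _).trans ?_
  rw [MvPolynomial.totalDegree_X]
  have := hp i
  omega

/-- Taylor's formula with integral remainder, the remainder being expressed by the increments of
the derivatives of highest order along the segment. -/
theorem exists_taylor (n m : ℕ) : ∃ (κ : Measure ℝ) (N : ℝ≥0), IsProbabilityMeasure κ ∧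
    (∀ᵐ t ∂κ, t ∈ Set.Ioc (0 : ℝ) 1) ∧
    ∀ f : Rn n → ℝ, ContDiff ℝ (⊤ : ℕ∞) f → ∀ z : Rn n,
      ∃ q : MvPolynomial (Fin n) ℝ, q.totalDegree ≤ m ∧ ∀ h : Rn n,
        ‖f (z + h) - polyFun q h‖ₑ ≤ ‖h‖ₑ ^ m * (N *
          ∫⁻ t, ‖smoothGrad m f (z + t • h) - smoothGrad m f z‖ₑ ∂κ) := by
  induction m with
  | zero =>
    -- For m = 0 the remainder is f(z+h) - f(z) itself, the increment at t = 1.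
    refine ⟨Measure.dirac 1, 1, inferInstance, by simp [ae_dirac_eq], fun f _ z =>
      ⟨MvPolynomial.C (f z), by simp, fun h => ?_⟩⟩
    rw [lintegral_dirac]
    have h1 : polyFun (MvPolynomial.C (f z)) h = f z := by simp [polyFun]
    have h2 : ∀ x, f x = smoothGrad 0 f x (toMultiIndex 0 (by simp)) := by
      intro x
      have : multiD (0 : Fin n → ℕ) f = f := by
        rw [multiD_eq_listD]
        have : listOf (0 : Fin n → ℕ) = [] := List.eq_nil_of_length_eq_zero (by
          rw [length_listOf]; simp)
        rw [this]; rfl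
      simp [smoothGrad, toMultiIndex, this]
    rw [h1, pow_zero, one_mul, ENNReal.coe_one, one_mul, one_smul, h2 (z + h), h2 z,
      ← PiLp.sub_apply]
    exact enorm_apply_le _ _
  | succ m ih =>
    obtain ⟨κ, N, hκ, hκ1, H⟩ := ih
    set ν : Measure ℝ := volume.restrict (Set.Ioc (0 : ℝ) 1) with hν
    have hνp : IsProbabilityMeasure ν := ⟨by simp [hν]⟩
    have hmul : Measurable fun p : ℝ × ℝ => p.1 * p.2 := by fun_prop
    -- The new measure is the law of the product of a uniform variable t on (0,1] and an independent
    -- variable τ of law κ. Indeed the induction hypothesis is applied to ∂_i f at the point z + th,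
    -- and its remainder involves increments at z + τth. The factor n counts the i, and the
    -- cardinality bounds a vector by its components.
    refine ⟨(ν.prod κ).map fun p => p.1 * p.2, n * (N * Fintype.card (MultiIndex n m)),
      Measure.isProbabilityMeasure_map hmul.aemeasurable, ?_, fun f hf z => ?_⟩
    · refine (ae_map_iff hmul.aemeasurable (p := (· ∈ Set.Ioc (0 : ℝ) 1)) measurableSet_Ioc).2 ?_
      have h1 : ∀ᵐ p ∂(ν.prod κ), p.1 ∈ Set.Ioc (0 : ℝ) 1 :=
        Measure.quasiMeasurePreserving_fst.ae (ae_restrict_mem measurableSet_Ioc)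
      have h2 : ∀ᵐ p ∂(ν.prod κ), p.2 ∈ Set.Ioc (0 : ℝ) 1 :=
        Measure.quasiMeasurePreserving_snd.ae hκ1
      filter_upwards [h1, h2] with p hp1 hp2
      exact ⟨mul_pos hp1.1 hp2.1, mul_le_one₀ hp1.2 hp2.1.le hp2.2⟩
    · choose q hq1 hq2 using fun i => H (partialD i f) (contDiff_partialD hf i) z
      -- Integrating the Taylor polynomials of the ∂_i f along the ray gives the Taylor polynomial
      -- of f, of degree one higher.
      refine ⟨MvPolynomial.C (f z) + ∑ i, MvPolynomial.X i * rayIntegral (q i),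
        totalDegree_add_sum_X_mul_le _ fun i => (totalDegree_rayIntegral_le _).trans (hq1 i),
        fun h => ?_⟩
      set F : ℝ → ℝ≥0∞ := fun t => ‖smoothGrad (m + 1) f (z + t • h) - smoothGrad (m + 1) f z‖ₑ
        with hF
      have hFm : Measurable F := by
        have : Continuous F := by
          have := continuous_smoothGrad hf (m + 1)
          fun_prop
        exact this.measurable
      have hc1 : ∀ i, Continuous fun t : ℝ => partialD i f (z + t • h) := fun i =>
        (contDiff_partialD hf i).continuous.comp (by fun_prop)
      have hc2 : ∀ i, Continuous fun t : ℝ => polyFun (q i) (t • h) := fun i =>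
        (contDiff_polyFun (q i)).continuous.comp (by fun_prop)
      have e : f (z + h) - polyFun (MvPolynomial.C (f z) +
          ∑ i, MvPolynomial.X i * rayIntegral (q i)) h =
          ∫ t in (0 : ℝ)..1, ∑ i, h i * (partialD i f (z + t • h) - polyFun (q i) (t • h)) := by
        have e1 : polyFun (MvPolynomial.C (f z) +
            ∑ i, MvPolynomial.X i * rayIntegral (q i)) h =
            f z + ∑ i, h i * ∫ t in (0 : ℝ)..1, polyFun (q i) (t • h) := by
          simp_rw [integral_polyFun_smul]
          simp [polyFun]
        have e2 : ∑ i, h i * ∫ t in (0 : ℝ)..1, polyFun (q i) (t • h) =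
            ∫ t in (0 : ℝ)..1, ∑ i, h i * polyFun (q i) (t • h) := by
          have h3 : ∀ i, IntervalIntegrable (fun t => h i * polyFun (q i) (t • h)) volume 0 1 :=
            fun i => (continuous_const.mul (hc2 i)).intervalIntegrable _ _
          rw [intervalIntegral.integral_finsetSum fun i _ => h3 i]
          simp_rw [intervalIntegral.integral_const_mul]
        rw [e1, e2, ← sub_sub, sub_eq_integral_partialD hf, ← intervalIntegral.integral_sub]
        · simp_rw [mul_sub, Finset.sum_sub_distrib]
        · exact (continuous_finsetSum _ fun i _ =>
            continuous_const.mul (hc1 i)).intervalIntegrable _ _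
        · exact (continuous_finsetSum _ fun i _ =>
            continuous_const.mul (hc2 i)).intervalIntegrable _ _
      rw [e, intervalIntegral.integral_of_le zero_le_one, lintegral_map hFm hmul,
        lintegral_prod _ (by fun_prop)]
      refine (enorm_integral_le_lintegral_enorm _).trans ?_
      have hin : ∀ t ∈ Set.Ioc (0 : ℝ) 1,
          ‖∑ i, h i * (partialD i f (z + t • h) - polyFun (q i) (t • h))‖ₑ ≤
          ‖h‖ₑ ^ (m + 1) * ((n * (N * Fintype.card (MultiIndex n m)) : ℝ≥0) *
            ∫⁻ τ, F (t * τ) ∂κ) := by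
        intro t ht
        have h1 : ∀ i, ‖h i * (partialD i f (z + t • h) - polyFun (q i) (t • h))‖ₑ ≤
            ‖h‖ₑ * (‖h‖ₑ ^ m * (N * (Fintype.card (MultiIndex n m) * ∫⁻ τ, F (t * τ) ∂κ))) := by
          intro i
          rw [enorm_mul]
          refine mul_le_mul' (enorm_apply_le h i) ((hq2 i (t • h)).trans ?_)
          have ht' : ‖t • h‖ₑ ≤ ‖h‖ₑ := by
            rw [← ofReal_norm, ← ofReal_norm, norm_smul, Real.norm_of_nonneg ht.1.le]
            exact ENNReal.ofReal_le_ofReal (mul_le_of_le_one_left (norm_nonneg _) ht.2)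
          gcongr
          rw [← lintegral_const_mul' _ _ (ENNReal.natCast_ne_top _)]
          refine lintegral_mono fun τ => ?_
          rw [smul_smul, mul_comm τ t]
          exact enorm_smoothGrad_partialD_le hf i m _ z
        refine (enorm_sum_le _ _).trans ((Finset.sum_le_sum fun i _ => h1 i).trans (le_of_eq ?_))
        rw [Finset.sum_const, Finset.card_univ, Fintype.card_fin, nsmul_eq_mul]
        push_cast
        ring
      refine (setLIntegral_mono' measurableSet_Ioc hin).trans (le_of_eq ?_)
      rw [lintegral_const_mul' _ _ (ENNReal.pow_ne_top enorm_ne_top),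
        lintegral_const_mul' _ _ ENNReal.coe_ne_top]

/-! ### Mollification -/

/-- A smooth function of integral one, vanishing outside the unit ball. -/
structure IsMollifier (φ : Rn n → ℝ) : Prop where
  contDiff : ContDiff ℝ (⊤ : ℕ∞) φ
  eq_zero : ∀ x, 1 ≤ ‖x‖ → φ x = 0
  integral_eq : ∫ x, φ x = 1

/-- The dilation `x ↦ ρ⁻ⁿ φ (x / ρ)`. -/
def dil (φ : Rn n → ℝ) (ρ : ℝ) : Rn n → ℝ := fun x => (ρ ^ n)⁻¹ * φ (ρ⁻¹ • x)

namespace IsMollifier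

variable {φ : Rn n → ℝ}

theorem hasCompactSupport (h : IsMollifier φ) : HasCompactSupport φ := by
  refine HasCompactSupport.intro (isCompact_closedBall (0 : Rn n) 1) fun x hx => h.eq_zero x ?_
  simp at hx
  exact hx.le

theorem contDiff_dil (h : IsMollifier φ) (ρ : ℝ) : ContDiff ℝ (⊤ : ℕ∞) (dil φ ρ) :=
  contDiff_const.mul (h.contDiff.comp (contDiff_const_smul _))

theorem dil_eq_zero (h : IsMollifier φ) {ρ : ℝ} (hρ : 0 < ρ) {x : Rn n} (hx : ρ ≤ ‖x‖) :
    dil φ ρ x = 0 := by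
  unfold dil
  rw [h.eq_zero, mul_zero]
  rw [norm_smul, norm_inv, Real.norm_of_nonneg hρ.le]
  rwa [← div_eq_inv_mul, one_le_div hρ]

theorem hasCompactSupport_dil (h : IsMollifier φ) {ρ : ℝ} (hρ : 0 < ρ) :
    HasCompactSupport (dil φ ρ) := by
  refine HasCompactSupport.intro (isCompact_closedBall (0 : Rn n) ρ)
    fun x hx => h.dil_eq_zero hρ ?_
  simp at hx
  exact hx.le

end IsMollifier

theorem exists_isMollifier (n : ℕ) : ∃ φ : Rn n → ℝ, IsMollifier φ := by
  let b : ContDiffBump (0 : Rn n) := ⟨1 / 2, 1, by norm_num, by norm_num⟩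
  refine ⟨b.normed volume, b.contDiff_normed, fun x hx => ?_, b.integral_normed⟩
  have h : x ∉ Function.support (b.normed volume) := by
    rw [b.support_normed_eq]
    simpa [b] using hx
  simpa using h

theorem integral_comp_sub_smul (f : Rn n → ℝ) (x : Rn n) {ρ : ℝ} (hρ : 0 < ρ) :
    ∫ w, f (x - ρ • w) = (ρ ^ n)⁻¹ * ∫ y, f y := by
  have h := Measure.integral_comp_smul (volume : Measure (Rn n)) (fun y => f (x - y)) ρ
  rw [h]
  simp only [finrank_euclideanSpace, Fintype.card_fin, smul_eq_mul]
  rw [abs_of_pos (by positivity), integral_sub_left_eq_self]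

theorem conv_dil (φ g : Rn n → ℝ) {ρ : ℝ} (hρ : 0 < ρ) (x : Rn n) :
    conv (dil φ ρ) g x = ∫ w, φ w * g (x - ρ • w) := by
  have h := integral_comp_sub_smul (fun y => φ (ρ⁻¹ • (x - y)) * g y) x hρ
  have e : ∀ w : Rn n, φ (ρ⁻¹ • (x - (x - ρ • w))) = φ w := by
    intro w
    rw [sub_sub_cancel, smul_smul, inv_mul_cancel₀ hρ.ne', one_smul]
  simp only [e] at h
  rw [h, ← integral_const_mul]
  unfold conv dil
  simp only [mul_assoc]

/-- Continuity of translations in L¹, read off from the continuity of the translation action on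
`Lp`. -/
theorem tendsto_lintegral_translate {G : Rn n → ℝ} (hG : Integrable G) :
    Tendsto (fun h : Rn n => ∫⁻ z, ‖G (h + z) - G z‖ₑ) (𝓝 0) (𝓝 0) := by
  have hG1 : MemLp G 1 volume := memLp_one_iff_integrable.2 hG
  have : Fact ((1 : ℝ≥0∞) ≠ ∞) := ⟨ENNReal.one_ne_top⟩
  have hc : Continuous fun h : Rn n => (DomAddAct.mk h) +ᵥ hG1.toLp G :=
    (DomAddAct.continuous_mk).vadd continuous_const
  have h1 : Tendsto (fun h : Rn n => edist ((DomAddAct.mk h) +ᵥ hG1.toLp G) (hG1.toLp G))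
      (𝓝 0) (𝓝 0) := by
    have h2 := (hc.tendsto 0).edist (tendsto_const_nhds (x := hG1.toLp G))
    simpa using h2
  refine h1.congr fun h => ?_
  rw [DomAddAct.mk_vadd_toLp, Lp.edist_toLp_toLp, eLpNorm_one_eq_lintegral_enorm]
  rfl

theorem conv_congr_right {f g g' : Rn n → ℝ} (h : g =ᵐ[volume] g') : conv f g = conv f g' := by
  funext x
  refine integral_congr_ae ?_
  filter_upwards [h] with y hy
  rw [hy]

/-- An approximate identity converges in L¹ on balls. The mollifier may change sign, as the
polynomial-reproducing ones may, so the estimate carries the factor ∫|φ|. The error is a mean of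
translation increments. -/
theorem tendsto_conv_dil {φ : Rn n → ℝ} (hφ : IsMollifier φ) {g : Rn n → ℝ}
    (hg : LocallyIntegrable g) (x₀ : Rn n) (R : ℝ) :
    Tendsto (fun ρ => ∫⁻ z in Metric.ball x₀ R, ‖conv (dil φ ρ) g z - g z‖ₑ) (𝓝[>] 0) (𝓝 0) := by
  obtain ⟨g', hg'm, hgg'⟩ := hg.aestronglyMeasurable
  have e : ∀ ρ, ∫⁻ z in Metric.ball x₀ R, ‖conv (dil φ ρ) g z - g z‖ₑ =
      ∫⁻ z in Metric.ball x₀ R, ‖conv (dil φ ρ) g' z - g' z‖ₑ := by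
    intro ρ
    rw [conv_congr_right hgg']
    refine lintegral_congr_ae (ae_restrict_of_ae ?_)
    filter_upwards [hgg'] with z hz
    rw [hz]
  simp only [e]
  have hg' : LocallyIntegrable g' := hg.congr hgg'
  have hm : Measurable g' := hg'm.measurable
  clear e hgg' hg hg'm
  -- For ρ < 1 the translates z - ρw of points of the ball stay in the ball of radius R + 1, so
  -- cutting off there changes nothing and gives an integrable function.
  set G : Rn n → ℝ := (Metric.ball x₀ (R + 1)).indicator g' with hGdef
  have hG : Integrable G :=
    (hg'.integrableOn_isCompact (isCompact_closedBall x₀ (R + 1))).mono_set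
      Metric.ball_subset_closedBall |>.integrable_indicator measurableSet_ball
  have hT := tendsto_lintegral_translate hG
  have hφfin : ∫⁻ w, ‖φ w‖ₑ ≠ ∞ :=
    (hφ.contDiff.continuous.integrable_of_hasCompactSupport hφ.hasCompactSupport).2.ne
  have hb : Tendsto (fun ρ : ℝ => ⨆ h ∈ Metric.ball (0 : Rn n) ρ, ∫⁻ z, ‖G (h + z) - G z‖ₑ)
      (𝓝[>] 0) (𝓝 0) := by
    rw [ENNReal.tendsto_nhds_zero] at hT ⊢
    intro ε hε
    obtain ⟨δ, hδ, hδ2⟩ := Metric.eventually_nhds_iff_ball.1 (hT ε hε)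
    filter_upwards [Ioo_mem_nhdsGT hδ] with ρ hρ
    exact iSup₂_le fun h hh => hδ2 h (Metric.ball_subset_ball hρ.2.le hh)
  have hb2 := ENNReal.Tendsto.const_mul (a := ∫⁻ w, ‖φ w‖ₑ) hb (Or.inr hφfin)
  rw [mul_zero] at hb2
  refine tendsto_of_tendsto_of_tendsto_of_le_of_le' tendsto_const_nhds hb2
    (Eventually.of_forall fun _ => bot_le) ?_
  filter_upwards [Ioo_mem_nhdsGT (zero_lt_one' ℝ)] with ρ hρ
  set K := ⨆ h ∈ Metric.ball (0 : Rn n) ρ, ∫⁻ z, ‖G (h + z) - G z‖ₑ with hK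
  have h1 : ∀ z, ‖conv (dil φ ρ) g' z - g' z‖ₑ ≤
      ∫⁻ w, ‖φ w‖ₑ * ‖g' (z - ρ • w) - g' z‖ₑ := by
    intro z
    have hint : Integrable fun w => φ w * g' (z - ρ • w) := by
      have h2 := integrable_conv (hφ.contDiff_dil ρ).continuous (hφ.hasCompactSupport_dil hρ.1) hg' z
      have h3 : Integrable fun y => dil φ ρ y * g' (z - y) := by
        have := h2.comp_sub_left z
        simpa using this
      have h4 := ((h3.comp_smul hρ.1.ne').const_mul (ρ ^ n))
      refine h4.congr (Eventually.of_forall fun w => ?_)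
      simp only [dil, smul_smul, inv_mul_cancel₀ hρ.1.ne', one_smul]
      rw [← mul_assoc, ← mul_assoc, mul_inv_cancel₀ (pow_pos hρ.1 n).ne', one_mul]
    have hint2 : Integrable fun w => φ w * g' z :=
      (hφ.contDiff.continuous.integrable_of_hasCompactSupport hφ.hasCompactSupport).mul_const _
    have h2 : conv (dil φ ρ) g' z - g' z = ∫ w, φ w * (g' (z - ρ • w) - g' z) := by
      simp_rw [mul_sub]
      rw [integral_sub hint hint2, integral_mul_const, hφ.integral_eq, one_mul,
        conv_dil _ _ hρ.1]
    rw [h2]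
    refine (enorm_integral_le_lintegral_enorm _).trans (le_of_eq ?_)
    simp_rw [enorm_mul]
  calc ∫⁻ z in Metric.ball x₀ R, ‖conv (dil φ ρ) g' z - g' z‖ₑ
      ≤ ∫⁻ z in Metric.ball x₀ R, ∫⁻ w, ‖φ w‖ₑ * ‖g' (z - ρ • w) - g' z‖ₑ :=
        lintegral_mono fun z => h1 z
    _ = ∫⁻ w, ∫⁻ z in Metric.ball x₀ R, ‖φ w‖ₑ * ‖g' (z - ρ • w) - g' z‖ₑ := by
        refine lintegral_lintegral_swap ?_
        have := hφ.contDiff.continuous.measurable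
        exact Measurable.aemeasurable (by fun_prop)
    _ ≤ ∫⁻ w, ‖φ w‖ₑ * K := by
        refine lintegral_mono fun w => ?_
        rw [lintegral_const_mul' _ _ enorm_ne_top]
        by_cases hw : 1 ≤ ‖w‖
        · simp [hφ.eq_zero w hw]
        gcongr
        have hw' : ‖ρ • w‖ < ρ := by
          rw [norm_smul, Real.norm_of_nonneg hρ.1.le]
          exact mul_lt_of_lt_one_right hρ.1 (not_le.1 hw)
        have h2 : ∀ z ∈ Metric.ball x₀ R, ‖g' (z - ρ • w) - g' z‖ₑ =
            ‖G (-(ρ • w) + z) - G z‖ₑ := by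
          intro z hz
          rw [Metric.mem_ball, dist_eq_norm] at hz
          have h3 : z ∈ Metric.ball x₀ (R + 1) := by
            rw [Metric.mem_ball, dist_eq_norm]; linarith
          have h4 : -(ρ • w) + z ∈ Metric.ball x₀ (R + 1) := by
            rw [Metric.mem_ball, dist_eq_norm]
            calc ‖-(ρ • w) + z - x₀‖ = ‖-(ρ • w) + (z - x₀)‖ := by congr 1; abel
              _ ≤ ‖-(ρ • w)‖ + ‖z - x₀‖ := norm_add_le _ _
              _ < R + 1 := by rw [norm_neg]; linarith [hρ.2]
          rw [hGdef, Set.indicator_of_mem h3, Set.indicator_of_mem h4]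
          congr 3; abel
        rw [setLIntegral_congr_fun measurableSet_ball h2]
        refine (setLIntegral_le_lintegral _ _).trans ?_
        refine le_iSup₂_of_le (f := fun h (_ : h ∈ Metric.ball (0 : Rn n) ρ) =>
          ∫⁻ z, ‖G (h + z) - G z‖ₑ) (-(ρ • w)) ?_ le_rfl
        simpa using hw'
    _ = (∫⁻ w, ‖φ w‖ₑ) * K := by
        rw [lintegral_mul_const _ (by
          have := hφ.contDiff.continuous.measurable
          fun_prop)]

/-! ### The oscillation and the increments of the derivatives of order [s] -/

theorem mul_osc_le {s : ℝ} (u : Rn n → ℝ) (x : Rn n) {r : ℝ} (hr : 0 < r)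
    {q : MvPolynomial (Fin n) ℝ} (hq : q.totalDegree ≤ ⌊s⌋₊) :
    volume (Metric.ball x r) * (ENNReal.ofReal (r ^ s) * osc s u x r) ≤
      ∫⁻ y in Metric.ball x r, ‖u y - polyFun q y‖ₑ := by
  have hV0 : volume (Metric.ball x r) ≠ 0 := (Metric.measure_ball_pos _ _ hr).ne'
  have hV : volume (Metric.ball x r) ≠ ∞ := measure_ball_lt_top.ne
  have hs0 : ENNReal.ofReal (r ^ s) ≠ 0 := by simpa using Real.rpow_pos_of_pos hr s
  calc _ ≤ volume (Metric.ball x r) * (ENNReal.ofReal (r ^ s) * _) :=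
        mul_le_mul_right (mul_le_mul_right (osc_le hq) _) _
    _ = _ := by
        simp only [div_eq_mul_inv]
        rw [lintegral_mul_const' _ _ (by simpa using hs0)]
        set I := ∫⁻ y in Metric.ball x r, ‖u y - MvPolynomial.eval (fun i => y i) q‖ₑ
        set S := ENNReal.ofReal (r ^ s)
        set V := volume (Metric.ball x r)
        calc V * (S * (I * S⁻¹ * V⁻¹)) = I * (S * S⁻¹) * (V * V⁻¹) := by ring
          _ = I := by
            rw [ENNReal.mul_inv_cancel hs0 ENNReal.ofReal_ne_top, ENNReal.mul_inv_cancel hV0 hV,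
              mul_one, mul_one]

theorem exists_polyFun_sub (q : MvPolynomial (Fin n) ℝ) (z : Rn n) :
    ∃ q' : MvPolynomial (Fin n) ℝ, q'.totalDegree ≤ q.totalDegree ∧
      ∀ y, polyFun q' y = polyFun q (y - z) := by
  refine ⟨∑ d ∈ q.support, MvPolynomial.C (q.coeff d) *
    ∏ i, (MvPolynomial.X i - MvPolynomial.C (z i)) ^ d i, ?_, fun y => ?_⟩
  · refine MvPolynomial.totalDegree_finsetSum_le fun d hd => ?_
    refine (MvPolynomial.totalDegree_mul _ _).trans ?_
    rw [MvPolynomial.totalDegree_C, zero_add]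
    refine (MvPolynomial.totalDegree_finsetProd _ _).trans ?_
    refine le_trans ?_ (MvPolynomial.le_totalDegree hd)
    rw [Finsupp.sum_fintype _ _ (by simp)]
    refine Finset.sum_le_sum fun i _ => ?_
    refine (MvPolynomial.totalDegree_pow _ _).trans ?_
    refine (Nat.mul_le_mul_left _ ((MvPolynomial.totalDegree_sub_C_le _ _).trans
      (MvPolynomial.totalDegree_X i).le)).trans (by simp)
  · unfold polyFun
    rw [MvPolynomial.eval_eq' _ q, map_sum]
    simp

theorem smoothGrad_conv {k : ℕ} {u f : Rn n → ℝ} {G : Rn n → EuclideanSpace ℝ (MultiIndex n k)}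
    (hG : ∀ α : MultiIndex n k, IsWeakDeriv α.1 u fun x => G x α) (hu : LocallyIntegrable u)
    (hf : ContDiff ℝ (⊤ : ℕ∞) f) (hfc : HasCompactSupport f) (x : Rn n) (α : MultiIndex n k) :
    smoothGrad k (conv f u) x α = conv f (fun x => G x α) x := by
  rw [← (hG α).conv_multiD hf hfc, multiD_eq_listD, ← listD_conv hf hfc hu]
  simp [smoothGrad, multiD_eq_listD]

theorem tendsto_lintegral_smoothGrad {φ : Rn n → ℝ} (hφ : IsMollifier φ) {k : ℕ} {u : Rn n → ℝ}
    {G : Rn n → EuclideanSpace ℝ (MultiIndex n k)} (hGm : Measurable G)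
    (hG : ∀ α : MultiIndex n k, IsWeakDeriv α.1 u fun x => G x α) (hu : LocallyIntegrable u)
    (x : Rn n) (R : ℝ) :
    Tendsto (fun ρ => ∫⁻ z in Metric.ball x R, ‖smoothGrad k (conv (dil φ ρ) u) z - G z‖ₑ)
      (𝓝[>] 0) (𝓝 0) := by
  have h1 : Tendsto (fun ρ => ∑ α : MultiIndex n k,
      ∫⁻ z in Metric.ball x R, ‖conv (dil φ ρ) (fun x => G x α) z - G z α‖ₑ) (𝓝[>] 0) (𝓝 0) := by
    have := tendsto_finsetSum (Finset.univ : Finset (MultiIndex n k)) fun α _ =>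
      tendsto_conv_dil hφ (hG α).2.1 x R
    simpa using this
  refine tendsto_of_tendsto_of_tendsto_of_le_of_le' tendsto_const_nhds h1
    (Eventually.of_forall fun _ => bot_le) ?_
  filter_upwards [self_mem_nhdsWithin] with ρ hρ
  have hρ : 0 < ρ := hρ
  have hm : ∀ α : MultiIndex n k, Measurable fun x => G x α := fun α =>
    (PiLp.continuous_apply 2 _ α).measurable.comp hGm
  rw [← lintegral_finsetSum]
  · refine lintegral_mono fun z => (enorm_le_sum _).trans (le_of_eq ?_)
    refine Finset.sum_congr rfl fun α _ => ?_
    rw [PiLp.sub_apply, smoothGrad_conv hG hu (hφ.contDiff_dil ρ) (hφ.hasCompactSupport_dil hρ)]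
  · intro α _
    have := (contDiff_conv (hφ.contDiff_dil ρ) (hφ.hasCompactSupport_dil hρ) (hG α).2.1).continuous
    exact (this.measurable.sub (hm α)).enorm

/-- The mean of `e (z + t h)` is controlled by the integral of `e` over a larger ball. -/
theorem lintegral_segment_le {e : Rn n → ℝ≥0∞} (he : Measurable e) {κ : Measure ℝ}
    [IsProbabilityMeasure κ] (hκ : ∀ᵐ t ∂κ, t ∈ Set.Ioc (0 : ℝ) 1) (x : Rn n) (r : ℝ) :
    ∫⁻ z in Metric.ball x r, ∫⁻ h in Metric.ball (0 : Rn n) (2 * r), ∫⁻ t, e (z + t • h) ∂κ ≤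
      volume (Metric.ball (0 : Rn n) (2 * r)) * ∫⁻ z in Metric.ball x (3 * r), e z := by
  have hm : Measurable fun p : Rn n × Rn n => ∫⁻ t, e (p.1 + t • p.2) ∂κ :=
    Measurable.lintegral_prod_right' (f := fun p : (Rn n × Rn n) × ℝ =>
      e (p.1.1 + p.2 • p.1.2)) (by fun_prop)
  rw [lintegral_lintegral_swap (f := fun z h => ∫⁻ t, e (z + t • h) ∂κ) hm.aemeasurable]
  calc ∫⁻ h in Metric.ball (0 : Rn n) (2 * r), ∫⁻ z in Metric.ball x r, ∫⁻ t, e (z + t • h) ∂κ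
      ≤ ∫⁻ _ in Metric.ball (0 : Rn n) (2 * r), ∫⁻ z in Metric.ball x (3 * r), e z := by
        refine setLIntegral_mono' measurableSet_ball fun h hh => ?_
        rw [lintegral_lintegral_swap (f := fun z t => e (z + t • h))
          (Measurable.aemeasurable (by fun_prop))]
        calc ∫⁻ t, (∫⁻ z in Metric.ball x r, e (z + t • h)) ∂κ
            ≤ ∫⁻ _, (∫⁻ z in Metric.ball x (3 * r), e z) ∂κ := by
              refine lintegral_mono_ae ?_
              filter_upwards [hκ] with t ht
              rw [← lintegral_indicator measurableSet_ball, ← lintegral_indicator measurableSet_ball,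
                ← lintegral_add_right_eq_self ((Metric.ball x (3 * r)).indicator e) (t • h)]
              refine lintegral_mono fun z => ?_
              by_cases hz : z ∈ Metric.ball x r
              · rw [Set.indicator_of_mem hz, Set.indicator_of_mem]
                rw [Metric.mem_ball, dist_eq_norm] at hz ⊢
                have h1 : ‖t • h‖ < 2 * r := by
                  rw [norm_smul, Real.norm_of_nonneg ht.1.le]
                  rw [mem_ball_zero_iff] at hh
                  exact (mul_le_of_le_one_left (norm_nonneg _) ht.2).trans_lt hh
                calc ‖z + t • h - x‖ = ‖(z - x) + t • h‖ := by congr 1; abel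
                  _ ≤ ‖z - x‖ + ‖t • h‖ := norm_add_le _ _
                  _ < 3 * r := by linarith
              · simp [Set.indicator_of_notMem hz]
          _ = ∫⁻ z in Metric.ball x (3 * r), e z := by simp
    _ = _ := by simp [mul_comm]

theorem lintegral_triple_add {X Y Z : Type*} [MeasurableSpace X] [MeasurableSpace Y]
    [MeasurableSpace Z] (μ : Measure X) (ν : Measure Y) (κ : Measure Z) [SFinite ν] [SFinite κ]
    (f : X → Y → Z → ℝ≥0∞) {g : X → Y → Z → ℝ≥0∞}
    (hg : Measurable fun p : (X × Y) × Z => g p.1.1 p.1.2 p.2) :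
    ∫⁻ x, ∫⁻ y, ∫⁻ z, (f x y z + g x y z) ∂κ ∂ν ∂μ =
      ∫⁻ x, ∫⁻ y, ∫⁻ z, f x y z ∂κ ∂ν ∂μ + ∫⁻ x, ∫⁻ y, ∫⁻ z, g x y z ∂κ ∂ν ∂μ := by
  have h1 : Measurable fun p : X × Y => ∫⁻ z, g p.1 p.2 z ∂κ := hg.lintegral_prod_right'
  have h2 : Measurable fun x : X => ∫⁻ y, ∫⁻ z, g x y z ∂κ ∂ν := h1.lintegral_prod_right'
  rw [← lintegral_add_right _ h2]
  refine lintegral_congr fun x => ?_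
  have h1x : Measurable fun y : Y => ∫⁻ z, g x y z ∂κ := h1.comp measurable_prodMk_left
  rw [← lintegral_add_right _ h1x]
  refine lintegral_congr fun y => ?_
  have h0 : Measurable (g x y) := hg.comp (measurable_prodMk_left (x := (x, y)))
  rw [lintegral_add_right _ h0]

/-- Replacing F by G costs two L¹ distances, one at z and one at z + th. Both points lie in the ball
of radius 3r because |z - x| < r and |th| < 2r. -/
theorem lintegral_increments_le {E : Type*} [NormedAddCommGroup E] [MeasurableSpace E]
    [BorelSpace E] [SecondCountableTopology E] {F G : Rn n → E} (hF : Measurable F)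
    (hG : Measurable G) {κ : Measure ℝ} [IsProbabilityMeasure κ]
    (hκ : ∀ᵐ t ∂κ, t ∈ Set.Ioc (0 : ℝ) 1) (x : Rn n) (r : ℝ) :
    ∫⁻ z in Metric.ball x r, ∫⁻ h in Metric.ball (0 : Rn n) (2 * r),
      ∫⁻ t, ‖F (z + t • h) - F z‖ₑ ∂κ ≤
    (∫⁻ z in Metric.ball x r, ∫⁻ h in Metric.ball (0 : Rn n) (2 * r),
      ∫⁻ t, ‖G (z + t • h) - G z‖ₑ ∂κ) +
      volume (Metric.ball (0 : Rn n) (2 * r)) * (∫⁻ z in Metric.ball x (3 * r), ‖F z - G z‖ₑ) +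
      volume (Metric.ball (0 : Rn n) (2 * r)) * ∫⁻ z in Metric.ball x (3 * r), ‖F z - G z‖ₑ := by
  set e : Rn n → ℝ≥0∞ := fun y => ‖F y - G y‖ₑ with he
  have hem : Measurable e := (hF.sub hG).enorm
  calc _ ≤ ∫⁻ z in Metric.ball x r, ∫⁻ h in Metric.ball (0 : Rn n) (2 * r),
        ∫⁻ t, (‖G (z + t • h) - G z‖ₑ + e (z + t • h) + e z) ∂κ := by
        refine lintegral_mono fun z => lintegral_mono fun h => lintegral_mono fun t => ?_
        have : F (z + t • h) - F z =
            (G (z + t • h) - G z) + (F (z + t • h) - G (z + t • h)) - (F z - G z) := by abel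
        dsimp only
        rw [this]
        exact (enorm_sub_le).trans (add_le_add (enorm_add_le _ _) le_rfl)
    _ = _ := by
        rw [lintegral_triple_add _ _ _ _ (by fun_prop), lintegral_triple_add _ _ _ _ (by fun_prop)]
    _ ≤ _ := by
        refine add_le_add (add_le_add le_rfl (lintegral_segment_le hem hκ x r)) ?_
        have : ∀ z, ∫⁻ h in Metric.ball (0 : Rn n) (2 * r), ∫⁻ t, e z ∂κ =
            volume (Metric.ball (0 : Rn n) (2 * r)) * e z := by
          intro z; simp [mul_comm]
        simp_rw [this]
        by_cases hr : 0 < r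
        · rw [lintegral_const_mul' _ _ measure_ball_lt_top.ne]
          exact mul_le_mul' le_rfl
            (lintegral_mono_set (Metric.ball_subset_ball (by linarith)))
        · rw [Metric.ball_eq_empty.2 (not_lt.1 hr)]
          simp

/-- The oscillation of a weakly differentiable function is controlled by the increments of its
derivatives of order `[s]`. -/
theorem exists_osc_le_increments (n m : ℕ) : ∃ (κ : Measure ℝ) (N : ℝ≥0), IsProbabilityMeasure κ ∧
    (∀ᵐ t ∂κ, t ∈ Set.Ioc (0 : ℝ) 1) ∧
    ∀ s : ℝ, ⌊s⌋₊ = m → ∀ (u : Rn n → ℝ) (G : Rn n → EuclideanSpace ℝ (MultiIndex n m)),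
      LocallyIntegrable u → Measurable G →
      (∀ α : MultiIndex n m, IsWeakDeriv α.1 u fun x => G x α) → ∀ (x : Rn n) (r : ℝ), 0 < r →
      volume (Metric.ball x r) * (volume (Metric.ball x r) *
        (ENNReal.ofReal (r ^ s) * osc s u x r)) ≤
        ENNReal.ofReal (2 * r) ^ m * (N * ∫⁻ z in Metric.ball x r,
          ∫⁻ h in Metric.ball (0 : Rn n) (2 * r), ∫⁻ t, ‖G (z + t • h) - G z‖ₑ ∂κ) := by
  obtain ⟨κ, N, hκ, hκ1, H⟩ := exists_taylor n m
  refine ⟨κ, N, hκ, hκ1, fun s hs u G hu hGm hG x r hr => ?_⟩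
  obtain ⟨φ, hφ⟩ := exists_isMollifier n
  set V := volume (Metric.ball x r) with hV
  have hVtop : V ≠ ∞ := measure_ball_lt_top.ne
  set J := ∫⁻ z in Metric.ball x r,
          ∫⁻ h in Metric.ball (0 : Rn n) (2 * r), ∫⁻ t, ‖G (z + t • h) - G z‖ₑ ∂κ with hJ
  set a : ℝ → ℝ≥0∞ := fun ρ => ∫⁻ y in Metric.ball x r, ‖conv (dil φ ρ) u y - u y‖ₑ with ha
  set b : ℝ → ℝ≥0∞ := fun ρ =>
    ∫⁻ y in Metric.ball x (3 * r), ‖smoothGrad m (conv (dil φ ρ) u) y - G y‖ₑ with hb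
  set W := volume (Metric.ball (0 : Rn n) (2 * r)) with hW
  have hWtop : W ≠ ∞ := measure_ball_lt_top.ne
  have hat : Tendsto a (𝓝[>] 0) (𝓝 0) := tendsto_conv_dil hφ hu x r
  have hbt : Tendsto b (𝓝[>] 0) (𝓝 0) := tendsto_lintegral_smoothGrad hφ hGm hG hu x (3 * r)
  have key : ∀ ρ, 0 < ρ → V * (V * (ENNReal.ofReal (r ^ s) * osc s u x r)) ≤
      V * a ρ + ENNReal.ofReal (2 * r) ^ m * (N * (J + W * b ρ + W * b ρ)) := by
    intro ρ hρ
    set f := conv (dil φ ρ) u with hf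
    have hfs : ContDiff ℝ (⊤ : ℕ∞) f :=
      contDiff_conv (hφ.contDiff_dil ρ) (hφ.hasCompactSupport_dil hρ) hu
    have hfG : Continuous (smoothGrad m f) := continuous_smoothGrad hfs m
    set e : Rn n → ℝ≥0∞ := fun y => ‖smoothGrad m f y - G y‖ₑ with he
    have hem : Measurable e := (hfG.measurable.sub hGm).enorm
    -- The Taylor centre z is left free in the ball. The oscillation does not depend on z, so the
    -- bound can be integrated in z, and the integrated form survives L¹ limits of the derivatives.
    have h1 : ∀ z ∈ Metric.ball x r, V * (ENNReal.ofReal (r ^ s) * osc s u x r) ≤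
        a ρ + ENNReal.ofReal (2 * r) ^ m * (N * ∫⁻ h in Metric.ball (0 : Rn n) (2 * r),
          ∫⁻ t, ‖smoothGrad m f (z + t • h) - smoothGrad m f z‖ₑ ∂κ) := by
      intro z hz
      obtain ⟨q, hq1, hq2⟩ := H f hfs z
      obtain ⟨q', hq1', hq2'⟩ := exists_polyFun_sub q z
      refine (mul_osc_le u x hr ((hq1'.trans hq1).trans hs.ge)).trans ?_
      calc ∫⁻ y in Metric.ball x r, ‖u y - polyFun q' y‖ₑ
          ≤ ∫⁻ y in Metric.ball x r, (‖f y - polyFun q' y‖ₑ + ‖f y - u y‖ₑ) := by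
            refine lintegral_mono fun y => ?_
            rw [← enorm_neg (f y - u y)]
            refine le_trans (le_of_eq ?_) (enorm_add_le _ _)
            congr 1; ring
        _ = (∫⁻ y in Metric.ball x r, ‖f y - polyFun q' y‖ₑ) + a ρ := by
            refine lintegral_add_left (Measurable.enorm ?_) _
            exact hfs.continuous.measurable.sub (contDiff_polyFun q').continuous.measurable
        _ ≤ (∫⁻ h in Metric.ball (0 : Rn n) (2 * r), ‖f (z + h) - polyFun q h‖ₑ) + a ρ := by
            refine add_le_add ?_ le_rfl
            rw [← lintegral_indicator measurableSet_ball, ← lintegral_indicator measurableSet_ball,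
              ← lintegral_add_left_eq_self _ z]
            refine lintegral_mono fun h => ?_
            by_cases hh : z + h ∈ Metric.ball x r
            · rw [Set.indicator_of_mem hh, Set.indicator_of_mem, hq2', add_sub_cancel_left]
              rw [Metric.mem_ball, dist_eq_norm] at hh hz
              rw [mem_ball_zero_iff]
              calc ‖h‖ = ‖(z + h - x) - (z - x)‖ := by congr 1; abel
                _ ≤ ‖z + h - x‖ + ‖z - x‖ := norm_sub_le _ _
                _ < 2 * r := by linarith
            · simp [Set.indicator_of_notMem hh]
        _ ≤ _ := by
            rw [add_comm]
            gcongr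
            have hfin : ENNReal.ofReal (2 * r) ^ m ≠ ∞ := ENNReal.pow_ne_top ENNReal.ofReal_ne_top
            rw [← lintegral_const_mul' _ _ ENNReal.coe_ne_top, ← lintegral_const_mul' _ _ hfin]
            refine setLIntegral_mono' measurableSet_ball fun h hh => (hq2 h).trans ?_
            gcongr
            rw [mem_ball_zero_iff] at hh
            rw [← ofReal_norm]
            exact ENNReal.ofReal_le_ofReal hh.le
    have hinc : ∫⁻ z in Metric.ball x r, ∫⁻ h in Metric.ball (0 : Rn n) (2 * r),
          ∫⁻ t, ‖smoothGrad m f (z + t • h) - smoothGrad m f z‖ₑ ∂κ ≤ J + W * b ρ + W * b ρ :=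
      lintegral_increments_le hfG.measurable hGm hκ1 x r
    have h2 : ∫⁻ z in Metric.ball x r, V * (ENNReal.ofReal (r ^ s) * osc s u x r) ≤
        ∫⁻ z in Metric.ball x r, (a ρ + ENNReal.ofReal (2 * r) ^ m *
          (N * ∫⁻ h in Metric.ball (0 : Rn n) (2 * r),
          ∫⁻ t, ‖smoothGrad m f (z + t • h) - smoothGrad m f z‖ₑ ∂κ)) :=
      setLIntegral_mono' measurableSet_ball h1
    rw [lintegral_const, Measure.restrict_apply_univ, lintegral_add_left measurable_const,
      lintegral_const, Measure.restrict_apply_univ, lintegral_const_mul' _ _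
        (ENNReal.pow_ne_top ENNReal.ofReal_ne_top), lintegral_const_mul' _ _ ENNReal.coe_ne_top,
      mul_comm _ V] at h2
    refine h2.trans ?_
    rw [mul_comm V (a ρ)]
    gcongr
  have hlim : Tendsto (fun ρ => V * a ρ + ENNReal.ofReal (2 * r) ^ m *
      (N * (J + W * b ρ + W * b ρ))) (𝓝[>] 0)
      (𝓝 (V * 0 + ENNReal.ofReal (2 * r) ^ m * (N * (J + W * 0 + W * 0)))) := by
    have c1 := ENNReal.Tendsto.const_mul (a := V) hat (Or.inr hVtop)
    have c2 := ENNReal.Tendsto.const_mul (a := W) hbt (Or.inr hWtop)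
    have c3 := ENNReal.Tendsto.const_mul (a := (N : ℝ≥0∞)) ((c2.const_add J).add c2)
      (Or.inr ENNReal.coe_ne_top)
    exact c1.add (ENNReal.Tendsto.const_mul c3
      (Or.inr (ENNReal.pow_ne_top ENNReal.ofReal_ne_top)))
  simp only [mul_zero, add_zero, zero_add] at hlim
  refine ge_of_tendsto hlim ?_
  filter_upwards [self_mem_nhdsWithin] with ρ hρ using key ρ hρ

/-! ### From increments to the oscillation seminorm: integration over all scales -/

theorem volume_ball_eq (x : Rn n) (r : ℝ) :
    volume (Metric.ball x r) = volume (Metric.ball (0 : Rn n) r) :=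
  Measure.addHaar_ball_center _ _ _

theorem volume_ball_mul (x : Rn n) {c : ℝ} (hc : 0 < c) (r : ℝ) :
    volume (Metric.ball x (c * r)) = ENNReal.ofReal c ^ n * volume (Metric.ball (0 : Rn n) r) := by
  rw [Measure.addHaar_ball_mul_of_pos _ _ hc]
  simp [ENNReal.ofReal_pow hc.le]

theorem lintegral_ball_swap {f : Rn n → ℝ≥0∞} (hf : Measurable f) (r : ℝ) :
    ∫⁻ x, ∫⁻ z in Metric.ball x r, f z = volume (Metric.ball (0 : Rn n) r) * ∫⁻ z, f z := by
  have hS : MeasurableSet {p : Rn n × Rn n | dist p.2 p.1 < r} :=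
    measurableSet_lt (by fun_prop) measurable_const
  have e : ∀ x : Rn n, ∫⁻ z in Metric.ball x r, f z =
      ∫⁻ z, {p : Rn n × Rn n | dist p.2 p.1 < r}.indicator (fun p => f p.2) (x, z) := by
    intro x
    rw [← lintegral_indicator measurableSet_ball]
    rfl
  simp_rw [e]
  rw [lintegral_lintegral_swap (f := fun x z =>
    {p : Rn n × Rn n | dist p.2 p.1 < r}.indicator (fun p => f p.2) (x, z))
    ((hf.comp measurable_snd).indicator hS).aemeasurable]
  have e2 : ∀ z : Rn n, ∫⁻ x, {p : Rn n × Rn n | dist p.2 p.1 < r}.indicator (fun p => f p.2) (x, z)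
      = volume (Metric.ball (0 : Rn n) r) * f z := by
    intro z
    have : ∀ x, {p : Rn n × Rn n | dist p.2 p.1 < r}.indicator (fun p => f p.2) (x, z) =
        (Metric.ball z r).indicator (fun _ => f z) x := by
      intro x
      simp only [Set.indicator, Set.mem_ofPred_eq, Metric.mem_ball, dist_comm]
    simp_rw [this]
    rw [lintegral_indicator measurableSet_ball, lintegral_const, Measure.restrict_apply_univ,
      volume_ball_eq, mul_comm]
  simp_rw [e2]
  rw [lintegral_const_mul _ hf]

/-- The point h lies in the ball of radius 2r only if r > |h|/2, and the integral of r^{-n-1} over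
(|h|/2, ∞) is a multiple of |h|^{-n}. At h = 0 the right-hand side is infinite, as n ≥ 1. -/
theorem lintegral_radial_kernel_le (hn : 1 ≤ n) : ∃ C : ℝ≥0∞, C ≠ ∞ ∧ C ≠ 0 ∧ ∀ h : Rn n,
    ∫⁻ r in Set.Ioo (0 : ℝ) 1, (Metric.ball (0 : Rn n) (2 * r)).indicator
      (fun _ => (volume (Metric.ball (0 : Rn n) (2 * r)))⁻¹ / ENNReal.ofReal r) h ≤
      C / ‖h‖ₑ ^ n := by
  set v := volume (Metric.ball (0 : Rn n) 1) with hv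
  have hv0 : v ≠ 0 := (Metric.measure_ball_pos _ _ one_pos).ne'
  have hvt : v ≠ ∞ := measure_ball_lt_top.ne
  refine ⟨v⁻¹, by simpa using hv0, by simpa using hvt, fun h => ?_⟩
  rcases eq_or_ne h 0 with rfl | hh
  · rw [enorm_zero, zero_pow (by omega), ENNReal.div_zero (by simpa using hvt)]
    exact le_top
  have ha : 0 < ‖h‖ / 2 := by have := norm_pos_iff.2 hh; positivity
  have hn' : (-(n : ℝ) - 1) < -1 := by
    have : (1 : ℝ) ≤ n := by exact_mod_cast hn
    linarith
  calc _ ≤ ∫⁻ r in Set.Ioi (‖h‖ / 2), v⁻¹ *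
        ENNReal.ofReal ((2 ^ n)⁻¹ * r ^ (-(n : ℝ) - 1)) := by
        rw [← lintegral_indicator measurableSet_Ioo, ← lintegral_indicator measurableSet_Ioi]
        refine lintegral_mono fun r => ?_
        by_cases hr : r ∈ Set.Ioo (0 : ℝ) 1
        swap
        · simp [Set.indicator_of_notMem hr]
        rw [Set.indicator_of_mem hr]
        by_cases hb : h ∈ Metric.ball (0 : Rn n) (2 * r)
        swap
        · simp [Set.indicator_of_notMem hb]
        rw [Set.indicator_of_mem hb, Set.indicator_of_mem]
        swap
        · rw [mem_ball_zero_iff] at hb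
          rw [Set.mem_Ioi]; linarith
        have h2r : 0 < 2 * r := by linarith [hr.1]
        have e := volume_ball_mul (0 : Rn n) h2r 1
        rw [mul_one, ← hv] at e
        rw [e, ENNReal.mul_inv (Or.inr hvt) (Or.inr hv0), mul_comm, mul_div_assoc]
        refine le_of_eq ?_
        congr 1
        rw [← ENNReal.ofReal_pow h2r.le, ← ENNReal.ofReal_inv_of_pos (by positivity),
          ← ENNReal.ofReal_div_of_pos hr.1]
        congr 1
        rw [Real.rpow_sub_one hr.1.ne', Real.rpow_neg hr.1.le, Real.rpow_natCast, mul_pow]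
        field_simp
    _ = v⁻¹ * ENNReal.ofReal (∫ r in Set.Ioi (‖h‖ / 2), (2 ^ n)⁻¹ * r ^ (-(n : ℝ) - 1)) := by
        rw [lintegral_const_mul' _ _ (by simpa using hv0), ← ofReal_integral_eq_lintegral_ofReal]
        · exact (integrableOn_Ioi_rpow_of_lt hn' ha).const_mul _
        · filter_upwards [ae_restrict_mem measurableSet_Ioi] with r hr
          have : 0 < r := ha.trans hr
          positivity
    _ ≤ v⁻¹ * (‖h‖ₑ ^ n)⁻¹ := by
        gcongr
        rw [integral_const_mul, integral_Ioi_rpow_of_lt hn' ha, ← ofReal_norm,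
          ← ENNReal.ofReal_pow (norm_nonneg _), ← ENNReal.ofReal_inv_of_pos (by positivity)]
        apply ENNReal.ofReal_le_ofReal
        have hn1 : (1 : ℝ) ≤ n := by exact_mod_cast hn
        have e1 : -(n : ℝ) - 1 + 1 = -n := by ring
        rw [e1, Real.rpow_neg ha.le, Real.rpow_natCast, div_pow]
        have : 0 < ‖h‖ := by linarith
        rw [neg_div_neg_eq]
        calc (2 ^ n : ℝ)⁻¹ * ((‖h‖ ^ n / 2 ^ n)⁻¹ / n) = (‖h‖ ^ n)⁻¹ / n := by field_simp
          _ ≤ (‖h‖ ^ n)⁻¹ := div_le_self (by positivity) hn1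

theorem gagliardo_congr {F : Type*} [NormedAddCommGroup F] {A : ℝ≥0 → ℝ≥0∞} {σ : ℝ}
    {f g : Rn n → F} (h : f =ᵐ[volume] g) : gagliardo A σ f = gagliardo A σ g := by
  unfold gagliardo
  congr 1
  funext l
  refine lintegral_congr_ae ?_
  filter_upwards [h] with x hx
  refine lintegral_congr_ae ?_
  filter_upwards [h] with y hy
  rw [hx, hy]

/-- The substitution y = x + h followed by Fubini separates the step h from the base point. -/
theorem gagliardo_modular_eq {F : Type*} [NormedAddCommGroup F] [MeasurableSpace F] [BorelSpace F]
    [SecondCountableTopology F] {B : ℝ≥0∞ → ℝ≥0∞} (hB : Measurable B) (σ : ℝ) (l : ℝ≥0∞)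
    {G : Rn n → F} (hG : Measurable G) :
    ∫⁻ x, ∫⁻ y, B (‖G x - G y‖ₑ / (l * ‖x - y‖ₑ ^ σ)) / ‖x - y‖ₑ ^ n =
      ∫⁻ h, (∫⁻ z, B (‖G (z + h) - G z‖ₑ / (l * ‖h‖ₑ ^ σ))) / ‖h‖ₑ ^ n := by
  have e : ∀ x, ∫⁻ y, B (‖G x - G y‖ₑ / (l * ‖x - y‖ₑ ^ σ)) / ‖x - y‖ₑ ^ n =
      ∫⁻ h, B (‖G (x + h) - G x‖ₑ / (l * ‖h‖ₑ ^ σ)) / ‖h‖ₑ ^ n := by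
    intro x
    rw [← lintegral_add_left_eq_self _ x]
    refine lintegral_congr fun h => ?_
    have e1 : ‖x - (x + h)‖ₑ = ‖h‖ₑ := by rw [sub_add_cancel_left, enorm_neg]
    rw [e1, ← enorm_neg (G x - G (x + h)), neg_sub]
  simp_rw [e]
  rw [lintegral_lintegral_swap (Measurable.aemeasurable (by fun_prop))]
  refine lintegral_congr fun h => ?_
  simp only [div_eq_mul_inv]
  rw [lintegral_mul_const _ (by fun_prop)]

theorem le_mul_div_of_le {a b c : ℝ≥0∞} (hbc : b ≤ c) (h0 : b = 0 → a = 0) (hb : b ≠ ∞) :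
    a ≤ c * (a / b) := by
  rcases eq_or_ne b 0 with hb0 | hb0
  · simp [h0 hb0]
  · calc a = b * (a / b) := (ENNReal.mul_div_cancel hb0 hb).symm
      _ ≤ c * (a / b) := by gcongr

/-- Bound of the oscillation at scale `r` by an average of difference quotients. -/
theorem exists_osc_le_quotients (n : ℕ) {s : ℝ} (hs : 0 < s) : ∃ (κ : Measure ℝ) (C : ℝ≥0),
    IsProbabilityMeasure κ ∧ (∀ᵐ t ∂κ, t ∈ Set.Ioc (0 : ℝ) 1) ∧ 0 < C ∧
    ∀ (u : Rn n → ℝ) (G : Rn n → EuclideanSpace ℝ (MultiIndex n ⌊s⌋₊)),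
      LocallyIntegrable u → Measurable G →
      (∀ α : MultiIndex n ⌊s⌋₊, IsWeakDeriv α.1 u fun x => G x α) →
      ∀ (l : ℝ≥0), 0 < l → ∀ (x : Rn n) (r : ℝ), 0 < r →
      osc s u x r / (C * l) ≤
        ((volume (Metric.ball (0 : Rn n) r))⁻¹ * (volume (Metric.ball (0 : Rn n) (2 * r)))⁻¹ *
        ∫⁻ z in Metric.ball x r, ∫⁻ h in Metric.ball (0 : Rn n) (2 * r),
          ∫⁻ t, ‖G (z + t • h) - G z‖ₑ / (l * ‖t • h‖ₑ ^ Int.fract s) ∂κ) / 2 := by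
  obtain ⟨κ, N, hκ, hκ1, H⟩ := exists_osc_le_increments n ⌊s⌋₊
  set σ := Int.fract s with hσ
  have hσ0 : 0 ≤ σ := Int.fract_nonneg s
  have hsσ : (⌊s⌋₊ : ℝ) + σ = s := by
    rw [natCast_floor_eq_intCast_floor hs.le, hσ, Int.floor_add_fract]
  -- The first 2 pays for the half in Jensen's inequality; 2^s comes from (2r)^s, and 2^n from the
  -- ratio of the volumes of the balls of radii 2r and r. N + 1 keeps the constant positive.
  refine ⟨κ, 2 * (2 ^ s * (N + 1) * 2 ^ n), hκ, hκ1, by positivity,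
    fun u G hu hGm hG l hl x r hr => ?_⟩
  have h2r : 0 < 2 * r := by linarith
  have h := H s rfl u G hu hGm hG x r hr
  set V := volume (Metric.ball (0 : Rn n) r) with hV
  have hVx : volume (Metric.ball x r) = V := volume_ball_eq x r
  rw [hVx] at h
  have hV0 : V ≠ 0 := (Metric.measure_ball_pos _ _ hr).ne'
  have hVt : V ≠ ∞ := measure_ball_lt_top.ne
  have hl0 : (l : ℝ≥0∞) ≠ 0 := by exact_mod_cast hl.ne'
  have hW : volume (Metric.ball (0 : Rn n) (2 * r)) = 2 ^ n * V := by
    rw [volume_ball_mul _ two_pos]; simp [hV]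
  rw [hW]
  set S := ENNReal.ofReal (r ^ s) with hS
  have hS0 : S ≠ 0 := by simpa [hS] using Real.rpow_pos_of_pos hr s
  have hSt : S ≠ ∞ := ENNReal.ofReal_ne_top
  set J := ∫⁻ z in Metric.ball x r, ∫⁻ h in Metric.ball (0 : Rn n) (2 * r),
      ∫⁻ t, ‖G (z + t • h) - G z‖ₑ ∂κ with hJ
  set J' := ∫⁻ z in Metric.ball x r, ∫⁻ h in Metric.ball (0 : Rn n) (2 * r),
      ∫⁻ t, ‖G (z + t • h) - G z‖ₑ / (l * ‖t • h‖ₑ ^ σ) ∂κ with hJ'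
  -- Since |th| ≤ 2r, the increment may be divided by |th|^σ at the cost of (2r)^σ. If th = 0 the
  -- increment vanishes and 0/0 = 0 does no harm.
  have hJJ : J ≤ (l * ENNReal.ofReal (2 * r) ^ σ) * J' := by
    have hfin : (l * ENNReal.ofReal (2 * r) ^ σ : ℝ≥0∞) ≠ ∞ :=
      ENNReal.mul_ne_top ENNReal.coe_ne_top (ENNReal.rpow_ne_top_of_nonneg hσ0 ENNReal.ofReal_ne_top)
    rw [hJ, hJ', ← lintegral_const_mul' _ _ hfin]
    refine lintegral_mono fun z => ?_
    rw [← lintegral_const_mul' _ _ hfin]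
    refine setLIntegral_mono' measurableSet_ball fun h hh => ?_
    rw [← lintegral_const_mul' _ _ hfin]
    refine lintegral_mono_ae ?_
    filter_upwards [hκ1] with t ht
    refine le_mul_div_of_le ?_ ?_ ?_
    · gcongr
      rw [← ofReal_norm]
      apply ENNReal.ofReal_le_ofReal
      rw [norm_smul, Real.norm_of_nonneg ht.1.le]
      rw [mem_ball_zero_iff] at hh
      exact (mul_le_of_le_one_left (norm_nonneg _) ht.2).trans hh.le
    · intro h0
      have h1 : ‖t • h‖ₑ ^ σ = 0 := by simpa [hl0] using h0
      have h2 : t • h = 0 := by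
        by_contra h3
        have h4 : ‖t • h‖ₑ ≠ 0 := by simpa using h3
        exact (ENNReal.rpow_pos (pos_iff_ne_zero.2 h4) enorm_ne_top).ne' h1
      rw [h2]; simp
    · exact ENNReal.mul_ne_top ENNReal.coe_ne_top
        (ENNReal.rpow_ne_top_of_nonneg hσ0 enorm_ne_top)
  have h1 : V * (V * (S * osc s u x r)) ≤ S * (2 ^ s * (N + 1) * l * J') := by
    calc V * (V * (S * osc s u x r)) ≤ ENNReal.ofReal (2 * r) ^ ⌊s⌋₊ * (N * J) := h
      _ ≤ ENNReal.ofReal (2 * r) ^ ⌊s⌋₊ *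
          ((N + 1) * ((l * ENNReal.ofReal (2 * r) ^ σ) * J')) := by
          gcongr
          exact le_self_add
      _ = (ENNReal.ofReal (2 * r) ^ ⌊s⌋₊ * ENNReal.ofReal (2 * r) ^ σ) * ((N + 1) * l * J') := by
          ring
      _ = (S * 2 ^ s) * ((N + 1) * l * J') := by
          congr 1
          rw [← ENNReal.rpow_natCast, ← ENNReal.rpow_add _ _ (by simpa using hr)
            ENNReal.ofReal_ne_top, hsσ, ENNReal.ofReal_mul two_pos.le,
            ENNReal.mul_rpow_of_nonneg _ _ hs.le, ENNReal.ofReal_rpow_of_pos hr, mul_comm]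
          simp [hS]
      _ = _ := by ring
  have h2 : V * (V * osc s u x r) ≤ 2 ^ s * (N + 1) * l * J' := by
    have : S * (V * (V * osc s u x r)) ≤ S * (2 ^ s * (N + 1) * l * J') := by
      refine le_trans (le_of_eq ?_) h1; ring
    exact (ENNReal.mul_le_mul_iff_right hS0 hSt).1 this
  have h3 : osc s u x r ≤ V⁻¹ * V⁻¹ * (2 ^ s * (N + 1) * l * J') := by
    calc osc s u x r = (V⁻¹ * V) * (V⁻¹ * V) * osc s u x r := by
          rw [ENNReal.inv_mul_cancel hV0 hVt]; simp
      _ = V⁻¹ * V⁻¹ * (V * (V * osc s u x r)) := by ring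
      _ ≤ _ := by gcongr
  have h2s : ((2 ^ s : ℝ≥0) : ℝ≥0∞) = 2 ^ s := by
    rw [ENNReal.coe_rpow_of_nonneg _ hs.le]; simp
  push_cast
  rw [h2s]
  refine ENNReal.div_le_of_le_mul (h3.trans (le_of_eq ?_))
  rw [ENNReal.mul_inv (by simp) (by simp), ENNReal.div_eq_inv_mul]
  have e1 : (2 ^ n : ℝ≥0∞)⁻¹ * 2 ^ n = 1 := ENNReal.inv_mul_cancel (by simp) (by simp)
  have e2 : (2 : ℝ≥0∞)⁻¹ * 2 = 1 := ENNReal.inv_mul_cancel (by simp) (by simp)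
  calc V⁻¹ * V⁻¹ * (2 ^ s * (N + 1) * l * J')
      = V⁻¹ * V⁻¹ * (2 ^ s * (N + 1) * l * J') * ((2 ^ n : ℝ≥0∞)⁻¹ * 2 ^ n) *
        ((2 : ℝ≥0∞)⁻¹ * 2) := by rw [e1, e2, mul_one, mul_one]
    _ = _ := by ring

theorem aestronglyMeasurable_weakGrad {k : ℕ} {u : Rn n → ℝ}
    (hG : ∀ α : MultiIndex n k, IsWeakDeriv α.1 u fun x => weakGrad k u x α) :
    AEStronglyMeasurable (weakGrad k u) := by
  have h : AEMeasurable fun x => fun α : MultiIndex n k => weakGrad k u x α :=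
    aemeasurable_pi_lambda _ fun α => (hG α).2.1.aestronglyMeasurable.aemeasurable
  exact ((PiLp.continuous_toLp 2 _).measurable.comp_aemeasurable h).aestronglyMeasurable

theorem IsWeakDeriv.congr {α : Fin n → ℕ} {u g g' : Rn n → ℝ} (h : IsWeakDeriv α u g)
    (hg : g =ᵐ[volume] g') : IsWeakDeriv α u g' := by
  refine ⟨h.1, h.2.1.congr hg, fun φ hφ hφc => (h.2.2 φ hφ hφc).trans ?_⟩
  congr 1
  refine integral_congr_ae ?_
  filter_upwards [hg] with x hx
  rw [hx]

theorem ennreal_div_mul {a b c : ℝ≥0∞} (h1 : b ≠ 0 ∨ c ≠ ∞) (h2 : b ≠ ∞ ∨ c ≠ 0) :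
    a / (b * c) = a / b / c := by
  rw [div_eq_mul_inv, ENNReal.mul_inv h1 h2, ← mul_assoc]
  rfl

/-- Jensen's inequality for the product of the uniform laws on the two balls and κ. The subsequent
integration in x cancels the normalization of the ball around x. -/
theorem Gauge.osc_modular_le {B : ℝ≥0∞ → ℝ≥0∞} (hB : Gauge B) {Φ : Rn n → Rn n → ℝ≥0∞}
    (hΦ : Measurable fun p : Rn n × Rn n => Φ p.1 p.2) {κ : Measure ℝ} [IsProbabilityMeasure κ]
    {r : ℝ} (hr : 0 < r) :
    ∫⁻ x, B (((volume (Metric.ball (0 : Rn n) r))⁻¹ *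
        (volume (Metric.ball (0 : Rn n) (2 * r)))⁻¹ *
        ∫⁻ z in Metric.ball x r, ∫⁻ h in Metric.ball (0 : Rn n) (2 * r),
          ∫⁻ t, Φ z (t • h) ∂κ) / 2) ≤
      (volume (Metric.ball (0 : Rn n) (2 * r)))⁻¹ *
        ∫⁻ h in Metric.ball (0 : Rn n) (2 * r), ∫⁻ t, (∫⁻ z, B (Φ z (t • h))) ∂κ := by
  set V := volume (Metric.ball (0 : Rn n) r) with hV
  set W := volume (Metric.ball (0 : Rn n) (2 * r)) with hW
  have hV0 : V ≠ 0 := (Metric.measure_ball_pos _ _ hr).ne'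
  have hVt : V ≠ ∞ := measure_ball_lt_top.ne
  have hW0 : W ≠ 0 := (Metric.measure_ball_pos _ _ (by linarith)).ne'
  have hWt : W ≠ ∞ := measure_ball_lt_top.ne
  have hm : Measurable fun p : (Rn n × Rn n) × ℝ => Φ p.1.1 (p.2 • p.1.2) :=
    hΦ.comp (f := fun p : (Rn n × Rn n) × ℝ => (p.1.1, p.2 • p.1.2)) (by fun_prop)
  have hprod : ∀ (x : Rn n) (f : (Rn n × Rn n) × ℝ → ℝ≥0∞), Measurable f →
      ∫⁻ p, f p ∂((V⁻¹ * W⁻¹) • (((volume.restrict (Metric.ball x r)).prod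
        (volume.restrict (Metric.ball (0 : Rn n) (2 * r)))).prod κ)) =
      V⁻¹ * W⁻¹ * ∫⁻ z in Metric.ball x r, ∫⁻ h in Metric.ball (0 : Rn n) (2 * r),
        ∫⁻ t, f ((z, h), t) ∂κ := by
    intro x f hf
    rw [lintegral_smul_measure, lintegral_prod _ hf.aemeasurable,
      lintegral_prod _ hf.lintegral_prod_right'.aemeasurable, smul_eq_mul]
  have h1 : ∀ x, B ((V⁻¹ * W⁻¹ * ∫⁻ z in Metric.ball x r,
      ∫⁻ h in Metric.ball (0 : Rn n) (2 * r), ∫⁻ t, Φ z (t • h) ∂κ) / 2) ≤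
      V⁻¹ * W⁻¹ * ∫⁻ z in Metric.ball x r, ∫⁻ h in Metric.ball (0 : Rn n) (2 * r),
        ∫⁻ t, B (Φ z (t • h)) ∂κ := by
    intro x
    have h2 := hprod x (fun p => B (Φ p.1.1 (p.2 • p.1.2))) (hB.measurable.comp hm)
    rw [← hprod x _ hm, ← h2]
    refine hB.half_lintegral_le ?_ hm.aemeasurable
    rw [Measure.smul_apply, ← Set.univ_prod_univ, Measure.prod_prod, ← Set.univ_prod_univ,
      Measure.prod_prod, Measure.restrict_apply_univ, Measure.restrict_apply_univ, measure_univ,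
      volume_ball_eq x, ← hV, ← hW, smul_eq_mul, mul_one]
    refine le_of_eq ?_
    calc V⁻¹ * W⁻¹ * (V * W) = (V⁻¹ * V) * (W⁻¹ * W) := by ring
      _ = 1 := by rw [ENNReal.inv_mul_cancel hV0 hVt, ENNReal.inv_mul_cancel hW0 hWt, one_mul]
  have hBm : Measurable fun p : (Rn n × Rn n) × ℝ => B (Φ p.1.1 (p.2 • p.1.2)) :=
    hB.measurable.comp hm
  have hBm1 : Measurable fun p : Rn n × Rn n => ∫⁻ t, B (Φ p.1 (t • p.2)) ∂κ :=
    hBm.lintegral_prod_right'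
  have hBm2 : Measurable fun z : Rn n => ∫⁻ h in Metric.ball (0 : Rn n) (2 * r),
      ∫⁻ t, B (Φ z (t • h)) ∂κ := hBm1.lintegral_prod_right'
  refine (lintegral_mono h1).trans (le_of_eq ?_)
  rw [lintegral_const_mul' _ _ (ENNReal.mul_ne_top (by simpa using hV0) (by simpa using hW0)),
    lintegral_ball_swap hBm2, ← hV]
  calc V⁻¹ * W⁻¹ * (V * ∫⁻ z, ∫⁻ h in Metric.ball (0 : Rn n) (2 * r), ∫⁻ t, B (Φ z (t • h)) ∂κ)
      = (V⁻¹ * V) * W⁻¹ * ∫⁻ z, ∫⁻ h in Metric.ball (0 : Rn n) (2 * r),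
          ∫⁻ t, B (Φ z (t • h)) ∂κ := by ring
    _ = W⁻¹ * ∫⁻ z, ∫⁻ h in Metric.ball (0 : Rn n) (2 * r),
          ∫⁻ t, B (Φ z (t • h)) ∂κ := by rw [ENNReal.inv_mul_cancel hV0 hVt, one_mul]
    _ = _ := by
        congr 1
        rw [lintegral_lintegral_swap (f := fun z h => ∫⁻ t, B (Φ z (t • h)) ∂κ) hBm1.aemeasurable]
        refine lintegral_congr fun h => ?_
        rw [lintegral_lintegral_swap (f := fun z t => B (Φ z (t • h)))]
        exact (hBm.comp (f := fun q : Rn n × ℝ => ((q.1, h), q.2)) (by fun_prop)).aemeasurable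

/-- The oscillation seminorm is controlled by the Gagliardo-Slobodeckij seminorm. -/
theorem exists_oscSeminorm_le (hn : 1 ≤ n) {s : ℝ} (hs : 0 < s) : ∃ C : ℝ≥0, 0 < C ∧
    ∀ A : ℝ≥0 → ℝ≥0∞, IsYoung A → ∀ u : Rn n → ℝ, LocallyIntegrable u →
      (∀ α : MultiIndex n ⌊s⌋₊, IsWeakDeriv α.1 u fun x => weakGrad ⌊s⌋₊ u x α) →
      oscSeminorm s A u ≤ C * gagliardo A (Int.fract s) (weakGrad ⌊s⌋₊ u) := by
  obtain ⟨κ, C₁, hκ, hκ1, hC₁, H⟩ := exists_osc_le_quotients n hs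
  obtain ⟨C₂, hC₂t, hC₂0, hC₂⟩ := lintegral_radial_kernel_le hn
  lift C₂ to ℝ≥0 using hC₂t
  -- The modular at C₁ l will be at most C₂; the further factor C₂ + 1 brings it below 1.
  refine ⟨C₁ * (C₂ + 1), by positivity, fun A hA u hu hG => ?_⟩
  obtain ⟨G, hGm, hGG⟩ := aestronglyMeasurable_weakGrad hG
  have hG' : ∀ α : MultiIndex n ⌊s⌋₊, IsWeakDeriv α.1 u fun x => G x α := fun α =>
    (hG α).congr (by filter_upwards [hGG] with x hx; rw [hx])
  rw [gagliardo_congr hGG]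
  have hGm : Measurable G := hGm.measurable
  clear hG hGG
  refine luxemburg_le_mul (by positivity) fun l hl hmod => ?_
  set B := youngExtend A
  have hB : Gauge B := hA.gauge
  set σ := Int.fract s
  set Φ : Rn n → Rn n → ℝ≥0∞ := fun z k => ‖G (z + k) - G z‖ₑ / (l * ‖k‖ₑ ^ σ) with hΦ
  have hΦm : Measurable fun p : Rn n × Rn n => Φ p.1 p.2 := by fun_prop
  rw [gagliardo_modular_eq hB.measurable σ l hGm] at hmod
  set Ψ : Rn n → ℝ≥0∞ := fun k => ∫⁻ z, B (Φ z k) with hΨ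
  have hΨm : Measurable Ψ :=
    Measurable.lintegral_prod_left' (f := fun p : Rn n × Rn n => B (Φ p.1 p.2))
      (hB.measurable.comp hΦm)
  have hmod' : ∫⁻ h, Ψ h / ‖h‖ₑ ^ n ≤ 1 := hmod
  set Θ : Rn n → ℝ≥0∞ := fun h => ∫⁻ t, Ψ (t • h) ∂κ with hΘ
  have hΘm : Measurable Θ :=
    Measurable.lintegral_prod_right' (f := fun p : Rn n × ℝ => Ψ (p.2 • p.1))
      (hΨm.comp (by fun_prop))
  set W : ℝ → ℝ≥0∞ := fun r => volume (Metric.ball (0 : Rn n) (2 * r)) with hW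
  have hosc : ∀ r ∈ Set.Ioo (0 : ℝ) 1, (∫⁻ x, B (osc s u x r / (C₁ * l))) / ENNReal.ofReal r ≤
      ∫⁻ h, (Metric.ball (0 : Rn n) (2 * r)).indicator
        (fun _ => (W r)⁻¹ / ENNReal.ofReal r) h * Θ h := by
    intro r hr
    have h1 := (lintegral_mono fun x => hB.mono (H u G hu hGm hG' l hl x r hr.1)).trans
      (hB.osc_modular_le (κ := κ) hΦm hr.1)
    refine (ENNReal.div_le_div_right h1 _).trans (le_of_eq ?_)
    have e : ∀ h, (Metric.ball (0 : Rn n) (2 * r)).indicator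
        (fun _ => (W r)⁻¹ / ENNReal.ofReal r) h * Θ h =
        (Metric.ball (0 : Rn n) (2 * r)).indicator
          (fun h => ((W r)⁻¹ / ENNReal.ofReal r) * Θ h) h := by
      intro h
      by_cases hh : h ∈ Metric.ball (0 : Rn n) (2 * r) <;> simp [hh]
    simp_rw [e]
    rw [lintegral_indicator measurableSet_ball, lintegral_const_mul _ hΘm]
    simp only [div_eq_mul_inv]
    rw [mul_right_comm]
  have hmain : ∫⁻ r in Set.Ioo (0 : ℝ) 1, (∫⁻ x, B (osc s u x r / (C₁ * l))) / ENNReal.ofReal r ≤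
      C₂ := by
    calc _ ≤ ∫⁻ r in Set.Ioo (0 : ℝ) 1, ∫⁻ h, (Metric.ball (0 : Rn n) (2 * r)).indicator
            (fun _ => (W r)⁻¹ / ENNReal.ofReal r) h * Θ h :=
          setLIntegral_mono' measurableSet_Ioo hosc
      _ = ∫⁻ h, ∫⁻ r in Set.Ioo (0 : ℝ) 1, (Metric.ball (0 : Rn n) (2 * r)).indicator
        (fun _ => (W r)⁻¹ / ENNReal.ofReal r) h * Θ h := by
          refine lintegral_lintegral_swap (Measurable.aemeasurable ?_)
          have hWm : Measurable W := by
            have := measurable_setLIntegral_ball (n := n) (T := ℝ) (c := fun _ => 0)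
              (ρ := fun r => 2 * r) (f := fun _ => 1) measurable_const (by fun_prop)
              measurable_const
            simpa using this
          have hS : MeasurableSet {p : ℝ × Rn n | dist p.2 0 < 2 * p.1} :=
            measurableSet_lt (by fun_prop) (by fun_prop)
          have h3 : Measurable fun p : ℝ × Rn n => (W p.1)⁻¹ / ENNReal.ofReal p.1 := by fun_prop
          exact (h3.indicator hS).mul (hΘm.comp measurable_snd)
      _ ≤ ∫⁻ h, C₂ / ‖h‖ₑ ^ n * Θ h := by
          refine lintegral_mono fun h => ?_
          rw [lintegral_mul_const]
          · gcongr
            exact hC₂ h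
          · have hWm : Measurable W := by
              have := measurable_setLIntegral_ball (n := n) (T := ℝ) (c := fun _ => 0)
                (ρ := fun r => 2 * r) (f := fun _ => 1) measurable_const (by fun_prop)
                measurable_const
              simpa using this
            have hS : MeasurableSet {r : ℝ | dist h 0 < 2 * r} :=
              measurableSet_lt (by fun_prop) (by fun_prop)
            have h3 : Measurable fun r : ℝ => (W r)⁻¹ / ENNReal.ofReal r := by fun_prop
            exact h3.indicator hS
      _ = C₂ * ∫⁻ h, ∫⁻ t, Ψ (t • h) / ‖h‖ₑ ^ n ∂κ := by
          rw [← lintegral_const_mul' _ _ ENNReal.coe_ne_top]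
          refine lintegral_congr fun h => ?_
          simp only [div_eq_mul_inv]
          have h4 : Measurable fun t : ℝ => Ψ (t • h) :=
            hΨm.comp (f := fun t : ℝ => t • h) (by fun_prop)
          rw [lintegral_mul_const _ h4, mul_assoc, mul_comm (Θ h)]
      _ = C₂ * ∫⁻ t, (∫⁻ h, Ψ (t • h) / ‖h‖ₑ ^ n) ∂κ := by
          rw [lintegral_lintegral_swap]
          exact ((hΨm.comp (f := fun p : Rn n × ℝ => p.2 • p.1) (by fun_prop)).div
            (by fun_prop)).aemeasurable
      -- Dilation invariance removes t; this is why κ must not charge t = 0.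
      _ = C₂ * ∫⁻ t, (∫⁻ h, Ψ h / ‖h‖ₑ ^ n) ∂κ := by
          congr 1
          refine lintegral_congr_ae ?_
          filter_upwards [hκ1] with t ht
          exact lintegral_comp_smul_div ht.1.ne' Ψ
      _ ≤ C₂ * ∫⁻ t, 1 ∂κ := by gcongr
      _ = C₂ := by simp
  have hfinal : ∀ r x, B (osc s u x r / (C₁ * (C₂ + 1) * l : ℝ≥0)) ≤
      (C₂ + 1 : ℝ≥0∞)⁻¹ * B (osc s u x r / (C₁ * l)) := by
    intro r x
    have h1 : (1 : ℝ≥0∞) ≤ C₂ + 1 := le_add_self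
    have h2 := hB.div_le h1 (osc s u x r / (C₁ * l))
    rw [ENNReal.div_eq_inv_mul (a := B _)] at h2
    refine le_trans (le_of_eq ?_) h2
    rw [← ennreal_div_mul (Or.inr (by simp)) (Or.inr (by simp))]
    congr 2
    push_cast
    ring
  calc _ ≤ ∫⁻ r in Set.Ioo (0 : ℝ) 1, (C₂ + 1 : ℝ≥0∞)⁻¹ *
        ((∫⁻ x, B (osc s u x r / (C₁ * l))) / ENNReal.ofReal r) := by
        refine lintegral_mono fun r => ?_
        rw [← mul_div_assoc, ← lintegral_const_mul' _ _ (by simp)]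
        gcongr
        exact hfinal r _
    _ ≤ (C₂ + 1 : ℝ≥0∞)⁻¹ * C₂ := by
        rw [lintegral_const_mul' _ _ (by simp)]
        gcongr
    _ ≤ 1 := by
        rw [mul_comm, ← div_eq_mul_inv]
        exact ENNReal.div_le_of_le_mul (by rw [one_mul]; exact le_self_add)

/-! ### Kernels reproducing polynomials -/

/-- Extrapolation to 0 by Lagrange interpolation at the nodes (j+1)/(m+1). Nodes in (0,1] are
required so that dilating by them keeps supports in the unit ball. -/
theorem exists_lagrange_coeff (m : ℕ) : ∃ c t : Fin (m + 1) → ℝ, (∀ j, 0 < t j ∧ t j ≤ 1) ∧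
    ∀ p : Polynomial ℝ, p.natDegree ≤ m → ∑ j, c j * p.eval (t j) = p.eval 0 := by
  set t : Fin (m + 1) → ℝ := fun j => ((j : ℕ) + 1 : ℝ) / (m + 1) with ht
  have hm : (0 : ℝ) < m + 1 := by positivity
  have hinj : Function.Injective t := by
    intro i j hij
    have h1 : ((i : ℕ) + 1 : ℝ) = (j : ℕ) + 1 := by
      have := congrArg (· * ((m : ℝ) + 1)) hij
      simpa [ht, div_mul_cancel₀ _ hm.ne'] using this
    ext
    exact_mod_cast add_right_cancel h1
  refine ⟨fun j => (Lagrange.basis Finset.univ t j).eval 0, t, fun j => ⟨by positivity, ?_⟩,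
    fun p hp => ?_⟩
  · rw [ht]
    simp only
    rw [div_le_one hm]
    have := j.2
    have h2 : (j : ℕ) ≤ m := by omega
    have h3 : ((j : ℕ) : ℝ) ≤ m := by exact_mod_cast h2
    linarith
  · have hdeg : p.degree < (Finset.univ : Finset (Fin (m + 1))).card := by
      rw [Finset.card_univ, Fintype.card_fin]
      refine lt_of_le_of_lt Polynomial.degree_le_natDegree ?_
      exact_mod_cast Nat.lt_succ_of_le hp
    have h := Lagrange.eq_interpolate (s := Finset.univ) (v := t) hinj.injOn hdeg
    conv_rhs => rw [h, Lagrange.interpolate_apply, Polynomial.eval_finsetSum]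
    refine Finset.sum_congr rfl fun j _ => ?_
    rw [Polynomial.eval_mul, Polynomial.eval_C, mul_comm]

/-- Restricted to the line through x in direction v, q is a polynomial in one variable of degree at
most m. -/
theorem sum_lagrange_polyFun {m : ℕ} {c t : Fin (m + 1) → ℝ}
    (h : ∀ p : Polynomial ℝ, p.natDegree ≤ m → ∑ j, c j * p.eval (t j) = p.eval 0)
    {q : MvPolynomial (Fin n) ℝ} (hq : q.totalDegree ≤ m) (x v : Rn n) :
    ∑ j, c j * polyFun q (x - t j • v) = polyFun q x := by
  set p : Polynomial ℝ :=
    MvPolynomial.aeval (fun i => Polynomial.C (x i) - Polynomial.C (v i) * Polynomial.X) q with hp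
  have hdeg : p.natDegree ≤ m := by
    have := MvPolynomial.aeval_natDegree_le (m := m) (n := 1) q hq
      (fun i => (Polynomial.C (x i) - Polynomial.C (v i) * Polynomial.X : Polynomial ℝ)) (fun i => by
        refine (Polynomial.natDegree_sub_le _ _).trans (max_le (by simp) ?_)
        exact Polynomial.natDegree_C_mul_le _ _ |>.trans Polynomial.natDegree_X_le)
    simpa using this
  have he : ∀ s : ℝ, p.eval s = polyFun q (x - s • v) := by
    intro s
    rw [hp]
    unfold polyFun
    rw [MvPolynomial.aeval_def, MvPolynomial.eval₂_eq', MvPolynomial.eval_eq',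
      Polynomial.eval_finsetSum]
    refine Finset.sum_congr rfl fun d _ => ?_
    rw [Polynomial.eval_mul, Polynomial.eval_prod]
    congr 1
    · simp
    · refine Finset.prod_congr rfl fun i _ => ?_
      simp only [Polynomial.eval_pow, Polynomial.eval_sub, Polynomial.eval_C, Polynomial.eval_mul,
        Polynomial.eval_X, PiLp.sub_apply, PiLp.smul_apply, smul_eq_mul, mul_comm s]
  have h1 := h p hdeg
  simp_rw [he] at h1
  simpa using h1

theorem conv_sum {ι : Type*} (S : Finset ι) (c : ι → ℝ) (f : ι → Rn n → ℝ) (u : Rn n → ℝ)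
    (x : Rn n) (h : ∀ j ∈ S, Integrable fun y => f j (x - y) * u y) :
    conv (fun y => ∑ j ∈ S, c j * f j y) u x = ∑ j ∈ S, c j * conv (f j) u x := by
  unfold conv
  simp_rw [Finset.sum_mul, mul_assoc]
  rw [integral_finsetSum _ fun j hj => (h j hj).const_mul _]
  simp_rw [integral_const_mul]

theorem locallyIntegrable_polyFun (q : MvPolynomial (Fin n) ℝ) : LocallyIntegrable (polyFun q) :=
  (contDiff_polyFun q).continuous.locallyIntegrable

theorem integral_dil (φ : Rn n → ℝ) {ρ : ℝ} (hρ : 0 < ρ) : ∫ x, dil φ ρ x = ∫ x, φ x := by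
  unfold dil
  rw [integral_const_mul, Measure.integral_comp_inv_smul]
  simp only [finrank_euclideanSpace, Fintype.card_fin, smul_eq_mul]
  rw [abs_of_pos (by positivity), ← mul_assoc, inv_mul_cancel₀ (by positivity), one_mul]

/-- There is a mollifier which reproduces the polynomials of degree at most `m`. -/
theorem exists_reproducing (n m : ℕ) : ∃ φ : Rn n → ℝ, IsMollifier φ ∧
    ∀ q : MvPolynomial (Fin n) ℝ, q.totalDegree ≤ m → ∀ ρ : ℝ, 0 < ρ →
      conv (dil φ ρ) (polyFun q) = polyFun q := by
  obtain ⟨ψ, hψ⟩ := exists_isMollifier n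
  obtain ⟨c, t, ht, h⟩ := exists_lagrange_coeff m
  have hint : ∀ ρ, 0 < ρ → Integrable (dil ψ ρ) := fun ρ hρ =>
    (hψ.contDiff_dil ρ).continuous.integrable_of_hasCompactSupport (hψ.hasCompactSupport_dil hρ)
  -- With this combination of dilations, φ_ρ * q(x) is the integral of ψ(w) times Σ c_j q(x - t_j ρ
  -- w), and the sum equals q(x) for each w. The case p = 1 of the Lagrange identity gives integral
  -- one.
  refine ⟨fun x => ∑ j, c j * dil ψ (t j) x, ⟨?_, fun x hx => ?_, ?_⟩, fun q hq ρ hρ => ?_⟩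
  · exact ContDiff.sum fun j _ => contDiff_const.mul (hψ.contDiff_dil (t j))
  · refine Finset.sum_eq_zero fun j _ => ?_
    rw [hψ.dil_eq_zero (ht j).1 ((ht j).2.trans hx), mul_zero]
  · rw [integral_finsetSum _ fun j _ => (hint _ (ht j).1).const_mul _]
    simp_rw [integral_const_mul, integral_dil _ (ht _).1, hψ.integral_eq]
    simpa using h 1 (by simp)
  · funext x
    have e : dil (fun x => ∑ j, c j * dil ψ (t j) x) ρ =
        fun x => ∑ j, c j * dil ψ (ρ * t j) x := by
      funext y
      unfold dil
      rw [Finset.mul_sum]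
      refine Finset.sum_congr rfl fun j _ => ?_
      rw [smul_smul, mul_inv_rev, mul_pow, mul_inv]
      ring
    have hρt : ∀ j, 0 < ρ * t j := fun j => mul_pos hρ (ht j).1
    rw [e, conv_sum _ _ _ _ _ fun j _ => integrable_conv (hψ.contDiff_dil _).continuous
      (hψ.hasCompactSupport_dil (hρt j)) (locallyIntegrable_polyFun q) x]
    simp_rw [conv_dil _ _ (hρt _)]
    have hi : ∀ j, Integrable fun w => c j * (ψ w * polyFun q (x - (ρ * t j) • w)) := by
      intro j
      have hc : Continuous fun w => ψ w * polyFun q (x - (ρ * t j) • w) :=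
        hψ.contDiff.continuous.mul ((contDiff_polyFun q).continuous.comp (by fun_prop))
      exact (hc.integrable_of_hasCompactSupport hψ.hasCompactSupport.mul_right).const_mul _
    simp_rw [← integral_const_mul]
    rw [← integral_finsetSum _ fun j _ => hi j]
    have e2 : ∀ w, ∑ j, c j * (ψ w * polyFun q (x - (ρ * t j) • w)) = ψ w * polyFun q x := by
      intro w
      rw [← sum_lagrange_polyFun h hq x (ρ • w), Finset.mul_sum]
      refine Finset.sum_congr rfl fun j _ => ?_
      rw [smul_smul, mul_comm ρ (t j)]; ring
    simp_rw [e2]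
    rw [integral_mul_const, hψ.integral_eq, one_mul]

/-! ### Estimates for mollified derivatives -/

theorem contDiff_multiD {f : Rn n → ℝ} (hf : ContDiff ℝ (⊤ : ℕ∞) f) (α : Fin n → ℕ) :
    ContDiff ℝ (⊤ : ℕ∞) (multiD α f) := by
  rw [multiD_eq_listD]; exact contDiff_listD hf _

theorem hasCompactSupport_multiD {f : Rn n → ℝ} (hf : HasCompactSupport f) (α : Fin n → ℕ) :
    HasCompactSupport (multiD α f) := by
  rw [multiD_eq_listD]; exact hasCompactSupport_listD hf _

theorem setLIntegral_closedBall (hn : 1 ≤ n) (x : Rn n) (r : ℝ) (f : Rn n → ℝ≥0∞) :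
    ∫⁻ y in Metric.closedBall x r, f y = ∫⁻ y in Metric.ball x r, f y := by
  have : Nonempty (Fin n) := ⟨⟨0, hn⟩⟩
  refine setLIntegral_congr ?_
  rw [← Metric.ball_union_sphere]
  exact union_ae_eq_left_of_ae_eq_empty (ae_eq_empty.2 (Measure.addHaar_sphere volume x r))

theorem multiD_dil {φ : Rn n → ℝ} (hφ : ContDiff ℝ (⊤ : ℕ∞) φ) (α : Fin n → ℕ) (ρ : ℝ) (x : Rn n) :
    multiD α (dil φ ρ) x = (ρ ^ (n + ∑ i, α i))⁻¹ * multiD α φ (ρ⁻¹ • x) := by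
  have h := listD_affine hφ 0 ρ⁻¹ (ρ ^ n)⁻¹ (listOf α)
  simp only [zero_add] at h
  rw [multiD_eq_listD, multiD_eq_listD]
  unfold dil
  rw [h, length_listOf, pow_add, mul_inv, inv_pow]

/-- The kernel ∂^α φ_ρ is bounded by a multiple of ρ^{-n-|α|} and vanishes outside the closed ball
of radius ρ; the bounding sphere is null. -/
theorem exists_conv_multiD_dil_le (hn : 1 ≤ n) {φ : Rn n → ℝ} (hφ : IsMollifier φ)
    (α : Fin n → ℕ) : ∃ M : ℝ≥0, ∀ ρ : ℝ, 0 < ρ → ∀ (v : Rn n → ℝ) (x : Rn n),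
      ‖conv (multiD α (dil φ ρ)) v x‖ₑ ≤
        M * (ENNReal.ofReal ρ ^ (n + ∑ i, α i))⁻¹ * ∫⁻ y in Metric.ball x ρ, ‖v y‖ₑ := by
  have hc := (contDiff_multiD hφ.contDiff α).continuous
  obtain ⟨M, hM⟩ := hc.bounded_above_of_compact_support
    (hasCompactSupport_multiD hφ.hasCompactSupport α)
  have hsupp : ∀ y : Rn n, 1 < ‖y‖ → multiD α φ y = 0 := by
    intro y hy
    have h1 : tsupport (multiD α φ) ⊆ Metric.closedBall 0 1 := by
      rw [multiD_eq_listD]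
      refine (tsupport_listD_subset _ _).trans (closure_minimal (fun z hz => ?_)
        Metric.isClosed_closedBall)
      by_contra h
      simp at h
      exact hz (hφ.eq_zero z h.le)
    by_contra h
    have := h1 (subset_closure h)
    simp at this
    linarith
  refine ⟨M.toNNReal, fun ρ hρ v x => ?_⟩
  have hfin : (M.toNNReal : ℝ≥0∞) * (ENNReal.ofReal ρ ^ (n + ∑ i, α i))⁻¹ ≠ ∞ :=
    ENNReal.mul_ne_top ENNReal.coe_ne_top (by simpa using fun h => absurd h hρ.not_ge)
  rw [← setLIntegral_closedBall hn, ← lintegral_const_mul' _ _ hfin,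
    ← lintegral_indicator Metric.isClosed_closedBall.measurableSet]
  refine (enorm_integral_le_lintegral_enorm _).trans (lintegral_mono fun y => ?_)
  rw [multiD_dil hφ.contDiff]
  by_cases hy : y ∈ Metric.closedBall x ρ
  · rw [Set.indicator_of_mem hy, enorm_mul, enorm_mul, mul_comm ‖(ρ ^ _)⁻¹‖ₑ]
    refine mul_le_mul' (mul_le_mul' ?_ (le_of_eq ?_)) le_rfl
    · rw [← ofReal_norm]
      exact ENNReal.ofReal_le_ofReal (hM _)
    · rw [← ENNReal.ofReal_pow hρ.le, ← ENNReal.ofReal_inv_of_pos (by positivity),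
        Real.enorm_of_nonneg (by positivity)]
  · rw [Set.indicator_of_notMem hy, hsupp, mul_zero, zero_mul, enorm_zero]
    rw [norm_smul, norm_inv, Real.norm_of_nonneg hρ.le, ← div_eq_inv_mul, one_lt_div hρ]
    rw [Metric.mem_closedBall, dist_comm, dist_eq_norm] at hy
    exact not_le.1 hy

/-- Bookkeeping of powers: the kernel size ρ^{-n-k}, the normalization ρ^s of the oscillation and
the volume ρ^n combine to ρ^{s-k}. -/
theorem scale_identity (s : ℝ) {a ρ : ℝ} (ha : 0 < a) (hρ : 0 < ρ) (k : ℕ) (x : Rn n) :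
    (ENNReal.ofReal ρ ^ (n + k))⁻¹ * ENNReal.ofReal ((a * ρ) ^ s) *
      volume (Metric.ball x (a * ρ)) =
    ENNReal.ofReal (a ^ s) * ENNReal.ofReal a ^ n * volume (Metric.ball (0 : Rn n) 1) *
      ENNReal.ofReal (ρ ^ (s - k)) := by
  have h := volume_ball_mul x (mul_pos ha hρ) 1
  rw [mul_one] at h
  rw [h, ← ENNReal.ofReal_pow hρ.le, ← ENNReal.ofReal_pow (by positivity),
    ← ENNReal.ofReal_pow ha.le, ← ENNReal.ofReal_inv_of_pos (by positivity), ← mul_assoc,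
    ← ENNReal.ofReal_mul (by positivity), ← ENNReal.ofReal_mul (by positivity),
    ← ENNReal.ofReal_mul (by positivity)]
  rw [mul_right_comm (ENNReal.ofReal (a ^ s * a ^ n)), ← ENNReal.ofReal_mul (by positivity)]
  congr 2
  rw [Real.mul_rpow ha.le hρ.le, Real.rpow_sub hρ, Real.rpow_natCast, pow_add, mul_pow]
  field_simp

/-- A mollifier reproducing the polynomials of degree at most `m`. -/
structure IsReproducing (m : ℕ) (φ : Rn n → ℝ) : Prop extends IsMollifier φ where
  conv_polyFun : ∀ q : MvPolynomial (Fin n) ℝ, q.totalDegree ≤ m → ∀ ρ : ℝ, 0 < ρ →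
    conv (dil φ ρ) (polyFun q) = polyFun q

theorem exists_isReproducing (n m : ℕ) : ∃ φ : Rn n → ℝ, IsReproducing m φ := by
  obtain ⟨φ, h1, h2⟩ := exists_reproducing n m
  exact ⟨φ, h1, h2⟩

section Mollified

variable {m : ℕ} {φ : Rn n → ℝ}

theorem IsReproducing.conv_multiD_polyFun (hφ : IsReproducing m φ) (α : Fin n → ℕ)
    {q : MvPolynomial (Fin n) ℝ} (hq : q.totalDegree ≤ m) {ρ : ℝ} (hρ : 0 < ρ) :
    conv (multiD α (dil φ ρ)) (polyFun q) = multiD α (polyFun q) := by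
  rw [multiD_eq_listD, ← listD_conv (hφ.contDiff_dil ρ) (hφ.hasCompactSupport_dil hρ)
    (locallyIntegrable_polyFun q), hφ.conv_polyFun q hq ρ hρ, multiD_eq_listD]

theorem conv_sub_right {f u v : Rn n → ℝ} (hf : Continuous f) (hfc : HasCompactSupport f)
    (hu : LocallyIntegrable u) (hv : LocallyIntegrable v) (x : Rn n) :
    conv f (fun y => u y - v y) x = conv f u x - conv f v x := by
  unfold conv
  simp_rw [mul_sub]
  exact integral_sub (integrable_conv hf hfc hu x) (integrable_conv hf hfc hv x)

theorem IsReproducing.conv_multiD_sub_polyFun (hφ : IsReproducing m φ) (α : Fin n → ℕ)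
    {u : Rn n → ℝ} (hu : LocallyIntegrable u)
    {q : MvPolynomial (Fin n) ℝ} (hq : q.totalDegree ≤ m) {ρ : ℝ} (hρ : 0 < ρ) (x : Rn n) :
    conv (multiD α (dil φ ρ)) (fun y => u y - polyFun q y) x =
      conv (multiD α (dil φ ρ)) u x - multiD α (polyFun q) x := by
  rw [conv_sub_right (contDiff_multiD (hφ.contDiff_dil ρ) α).continuous
    (hasCompactSupport_multiD (hφ.hasCompactSupport_dil hρ) α) hu (locallyIntegrable_polyFun q),
    hφ.conv_multiD_polyFun α hq hρ]

/-- Both mollifications send q to ∂^α q, so u may be replaced by u - q in the difference; the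
infimum over q then gives the oscillation. -/
theorem exists_mollified_sub_le (hn : 1 ≤ n) {s : ℝ} (hφ : IsReproducing ⌊s⌋₊ φ)
    (α : Fin n → ℕ) : ∃ C : ℝ≥0, ∀ u : Rn n → ℝ, LocallyIntegrable u → ∀ ρ : ℝ, 0 < ρ →
      ∀ x, ‖conv (multiD α (dil φ (ρ / 2))) u x - conv (multiD α (dil φ ρ)) u x‖ₑ ≤
        C * ENNReal.ofReal (ρ ^ (s - (∑ i, α i : ℕ))) * osc s u x ρ := by
  obtain ⟨M, hM⟩ := exists_conv_multiD_dil_le hn hφ.toIsMollifier α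
  set k := ∑ i, α i with hk
  set v := volume (Metric.ball (0 : Rn n) 1) with hv
  have hvt : v ≠ ∞ := measure_ball_lt_top.ne
  -- The two summands belong to the kernels at the scales ρ/2 and ρ.
  refine ⟨M * (2 ^ (n + k) + 1) * v.toNNReal, fun u hu ρ hρ x => ?_⟩
  have hρ2 : 0 < ρ / 2 := by positivity
  have hc : (M * (2 ^ (n + k) + 1) * (ENNReal.ofReal ρ ^ (n + k))⁻¹ : ℝ≥0∞) ≠ ∞ := by
    refine ENNReal.mul_ne_top ?_ (by simpa using fun h => absurd h hρ.not_ge)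
    exact ENNReal.mul_ne_top ENNReal.coe_ne_top (by simp)
  have h := le_osc (s := s) (u := u) (x := x) hρ (c := M * (2 ^ (n + k) + 1) *
    (ENNReal.ofReal ρ ^ (n + k))⁻¹)
    (X := ‖conv (multiD α (dil φ (ρ / 2))) u x - conv (multiD α (dil φ ρ)) u x‖ₑ) hc ?_
  · refine h.trans (le_of_eq ?_)
    have h1 := scale_identity s one_pos hρ k x
    simp only [one_mul, Real.one_rpow, ENNReal.ofReal_one, one_pow] at h1
    push_cast
    rw [ENNReal.coe_toNNReal hvt, mul_assoc (M * (2 ^ (n + k) + 1) : ℝ≥0∞),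
      mul_assoc (M * (2 ^ (n + k) + 1) : ℝ≥0∞), h1]
    ring
  · intro q hq
    have e : conv (multiD α (dil φ (ρ / 2))) u x - conv (multiD α (dil φ ρ)) u x =
        conv (multiD α (dil φ (ρ / 2))) (fun y => u y - polyFun q y) x -
          conv (multiD α (dil φ ρ)) (fun y => u y - polyFun q y) x := by
      rw [hφ.conv_multiD_sub_polyFun α hu hq hρ, hφ.conv_multiD_sub_polyFun α hu hq hρ2]
      ring
    rw [e]
    refine enorm_sub_le.trans ((add_le_add (hM _ hρ2 _ x) (hM _ hρ _ x)).trans ?_)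
    set I := ∫⁻ y in Metric.ball x ρ, ‖u y - polyFun q y‖ₑ with hI
    have hI2 : ∫⁻ y in Metric.ball x (ρ / 2), ‖u y - polyFun q y‖ₑ ≤ I :=
      lintegral_mono_set (Metric.ball_subset_ball (by linarith))
    have e2 : (ENNReal.ofReal (ρ / 2) ^ (n + k))⁻¹ =
        2 ^ (n + k) * (ENNReal.ofReal ρ ^ (n + k))⁻¹ := by
      rw [ENNReal.ofReal_div_of_pos two_pos, ENNReal.ofReal_ofNat, div_eq_mul_inv, mul_pow,
        ENNReal.mul_inv (Or.inr (by simp)) (Or.inr (by simp)), ← ENNReal.inv_pow (a := 2), inv_inv,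
        mul_comm]
    rw [e2]
    calc _ ≤ M * (2 ^ (n + k) * (ENNReal.ofReal ρ ^ (n + k))⁻¹) * I +
        M * (ENNReal.ofReal ρ ^ (n + k))⁻¹ * I := by gcongr
      _ = M * (2 ^ (n + k) + 1) * (ENNReal.ofReal ρ ^ (n + k))⁻¹ * I := by ring
      _ = _ := rfl

/-- For |α| = [s] the derivative ∂^α q is constant and drops out of the increment. The balls of
radius |x - x'| around x and x' both lie in the ball of twice that radius around x, hence a single
oscillation suffices. -/
theorem exists_mollified_increment_le (hn : 1 ≤ n) {s : ℝ} (hφ : IsReproducing ⌊s⌋₊ φ)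
    (α : Fin n → ℕ) (hα : ∑ i, α i = ⌊s⌋₊) : ∃ C : ℝ≥0, ∀ u : Rn n → ℝ, LocallyIntegrable u →
      ∀ x x' : Rn n, x ≠ x' →
      ‖conv (multiD α (dil φ ‖x - x'‖)) u x - conv (multiD α (dil φ ‖x - x'‖)) u x'‖ₑ ≤
        C * ENNReal.ofReal (‖x - x'‖ ^ (s - ⌊s⌋₊)) * osc s u x (2 * ‖x - x'‖) := by
  obtain ⟨M, hM⟩ := exists_conv_multiD_dil_le hn hφ.toIsMollifier α
  rw [hα] at hM
  set k := ⌊s⌋₊ with hk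
  set v := volume (Metric.ball (0 : Rn n) 1) with hv
  have hvt : v ≠ ∞ := measure_ball_lt_top.ne
  refine ⟨M * 2 * ((2 : ℝ) ^ s).toNNReal * 2 ^ n * v.toNNReal, fun u hu x x' hxx => ?_⟩
  have hρ : 0 < ‖x - x'‖ := norm_sub_pos_iff.2 hxx
  set ρ := ‖x - x'‖ with hρdef
  have h2ρ : 0 < 2 * ρ := by positivity
  have hc : (M * 2 * (ENNReal.ofReal ρ ^ (n + k))⁻¹ : ℝ≥0∞) ≠ ∞ := by
    refine ENNReal.mul_ne_top ?_ (by simpa using fun h => absurd h hρ.not_ge)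
    exact ENNReal.mul_ne_top ENNReal.coe_ne_top (by simp)
  have h := le_osc (s := s) (u := u) (x := x) h2ρ (c := M * 2 * (ENNReal.ofReal ρ ^ (n + k))⁻¹)
    (X := ‖conv (multiD α (dil φ ρ)) u x - conv (multiD α (dil φ ρ)) u x'‖ₑ) hc ?_
  · refine h.trans (le_of_eq ?_)
    have h1 := scale_identity s two_pos hρ k x
    push_cast
    rw [ENNReal.coe_toNNReal hvt, mul_assoc (M * 2 : ℝ≥0∞), mul_assoc (M * 2 : ℝ≥0∞), h1]
    simp only [ENNReal.ofReal, Real.toNNReal_ofNat, ENNReal.coe_ofNat, ← hv]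
    ring
  · intro q hq
    obtain ⟨q', hq1, hq2⟩ := exists_listD_polyFun q (listOf α)
    have hq0 : q'.totalDegree = 0 := by
      rw [length_listOf, hα] at hq1; omega
    have hconst : multiD α (polyFun q) x = multiD α (polyFun q) x' := by
      rw [multiD_eq_listD, hq2, MvPolynomial.totalDegree_eq_zero_iff_eq_C.1 hq0]
      simp [polyFun]
    have e : conv (multiD α (dil φ ρ)) u x - conv (multiD α (dil φ ρ)) u x' =
        conv (multiD α (dil φ ρ)) (fun y => u y - polyFun q y) x -
          conv (multiD α (dil φ ρ)) (fun y => u y - polyFun q y) x' := by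
      rw [hφ.conv_multiD_sub_polyFun α hu hq hρ, hφ.conv_multiD_sub_polyFun α hu hq hρ, hconst]
      ring
    rw [e]
    refine enorm_sub_le.trans ((add_le_add (hM _ hρ _ x) (hM _ hρ _ x')).trans ?_)
    set I := ∫⁻ y in Metric.ball x (2 * ρ), ‖u y - polyFun q y‖ₑ with hI
    have hI1 : ∫⁻ y in Metric.ball x ρ, ‖u y - polyFun q y‖ₑ ≤ I :=
      lintegral_mono_set (Metric.ball_subset_ball (by linarith))
    have hI2 : ∫⁻ y in Metric.ball x' ρ, ‖u y - polyFun q y‖ₑ ≤ I := by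
      refine lintegral_mono_set (Metric.ball_subset_ball' ?_)
      rw [dist_comm, dist_eq_norm]; linarith
    calc _ ≤ M * (ENNReal.ofReal ρ ^ (n + k))⁻¹ * I + M * (ENNReal.ofReal ρ ^ (n + k))⁻¹ * I := by
          gcongr
      _ = M * 2 * (ENNReal.ofReal ρ ^ (n + k))⁻¹ * I := by ring
      _ = _ := rfl

/-- At almost every point, mollifications converge. -/
theorem ae_tendsto_conv_dil (hφ : IsMollifier φ) {g : Rn n → ℝ} (hg : LocallyIntegrable g) :
    ∀ᵐ x, Tendsto (fun ρ => conv (dil φ ρ) g x) (𝓝[>] 0) (𝓝 (g x)) := by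
  obtain ⟨M, hM⟩ := hφ.contDiff.continuous.bounded_above_of_compact_support hφ.hasCompactSupport
  filter_upwards [IsUnifLocDoublingMeasure.ae_tendsto_average_norm_sub volume hg 1] with x hx
  have h := hx (l := 𝓝[>] (0 : ℝ)) (fun _ => x) id tendsto_id (by
    filter_upwards [self_mem_nhdsWithin] with ρ hρ
    have : (0 : ℝ) < ρ := hρ
    simpa using this.le)
  set v := volume.real (Metric.ball (0 : Rn n) 1) with hv
  have h2 := h.const_mul (M * v)
  rw [mul_zero] at h2
  rw [tendsto_iff_norm_sub_tendsto_zero]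
  refine tendsto_of_tendsto_of_tendsto_of_le_of_le' tendsto_const_nhds h2
    (Eventually.of_forall fun _ => norm_nonneg _) ?_
  filter_upwards [self_mem_nhdsWithin] with ρ hρ
  have hρ : (0 : ℝ) < ρ := hρ
  have hint1 : Integrable fun y => dil φ ρ (x - y) * g y :=
    integrable_conv (hφ.contDiff_dil ρ).continuous (hφ.hasCompactSupport_dil hρ) hg x
  have hd : Integrable (dil φ ρ) := (hφ.contDiff_dil ρ).continuous.integrable_of_hasCompactSupport
    (hφ.hasCompactSupport_dil hρ)
  have hint2 : Integrable fun y => dil φ ρ (x - y) * g x := (hd.comp_sub_left x).mul_const _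
  have e : conv (dil φ ρ) g x - g x = ∫ y, dil φ ρ (x - y) * (g y - g x) := by
    simp_rw [mul_sub]
    rw [integral_sub hint1 hint2, integral_mul_const, integral_sub_left_eq_self (dil φ ρ),
      integral_dil _ hρ, hφ.integral_eq, one_mul]
    rfl
  have hvol : volume.real (Metric.closedBall x ρ) = ρ ^ n * v := by
    rw [measureReal_def, Measure.addHaar_closedBall _ _ hρ.le, ENNReal.toReal_mul,
      ENNReal.toReal_ofReal (by positivity)]
    simp [hv, measureReal_def]
  have hv0 : 0 < v := by
    rw [hv, measureReal_def]
    exact ENNReal.toReal_pos (Metric.measure_ball_pos _ _ one_pos).ne' measure_ball_lt_top.ne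
  have hgi : IntegrableOn (fun y => ‖g y - g x‖) (Metric.closedBall x ρ) :=
    ((hg.integrableOn_isCompact (isCompact_closedBall x ρ)).sub
      (integrableOn_const (isCompact_closedBall x ρ).measure_lt_top.ne)).norm
  simp only [id]
  rw [e, setAverage_eq, hvol, smul_eq_mul]
  calc ‖∫ y, dil φ ρ (x - y) * (g y - g x)‖
      ≤ ∫ y, (Metric.closedBall x ρ).indicator (fun y => (M * (ρ ^ n)⁻¹) * ‖g y - g x‖) y := by
        refine norm_integral_le_of_norm_le
          (IntegrableOn.integrable_indicator (hgi.const_mul _)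
            Metric.isClosed_closedBall.measurableSet)
          (Eventually.of_forall fun y => ?_)
        by_cases hy : y ∈ Metric.closedBall x ρ
        · rw [Set.indicator_of_mem hy, norm_mul]
          gcongr
          unfold dil
          rw [norm_mul, mul_comm, Real.norm_of_nonneg (by positivity : (0 : ℝ) ≤ (ρ ^ n)⁻¹)]
          gcongr
          exact hM _
        · rw [Set.indicator_of_notMem hy, hφ.dil_eq_zero hρ, zero_mul, norm_zero]
          rw [Metric.mem_closedBall, dist_comm, dist_eq_norm] at hy
          exact (not_le.1 hy).le
    _ = M * v * ((ρ ^ n * v)⁻¹ * ∫ y in Metric.closedBall x ρ, ‖g y - g x‖) := by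
        rw [integral_indicator Metric.isClosed_closedBall.measurableSet, integral_const_mul]
        field_simp

/-- Telescoping over the scales ρ/2^j, whose mollifications converge to g at almost every point. The
exceptional set does not depend on ρ, so that ρ may later be chosen as |x - y|. -/
theorem exists_weakDeriv_sub_mollified_le (hn : 1 ≤ n) {s : ℝ} (hφ : IsReproducing ⌊s⌋₊ φ)
    (α : Fin n → ℕ) : ∃ C : ℝ≥0, ∀ u g : Rn n → ℝ, IsWeakDeriv α u g →
      ∀ᵐ x, ∀ ρ : ℝ, 0 < ρ → ‖g x - conv (multiD α (dil φ ρ)) u x‖ₑ ≤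
        C * ∑' j : ℕ, ENNReal.ofReal ((ρ / 2 ^ j) ^ (s - (∑ i, α i : ℕ))) *
          osc s u x (ρ / 2 ^ j) := by
  obtain ⟨C, hC⟩ := exists_mollified_sub_le hn hφ α
  refine ⟨C, fun u g h => ?_⟩
  filter_upwards [ae_tendsto_conv_dil hφ.toIsMollifier h.2.1] with x hx ρ hρ
  set U : ℕ → ℝ := fun j => conv (multiD α (dil φ (ρ / 2 ^ j))) u x with hU
  set a : ℕ → ℝ≥0∞ := fun j => C * (ENNReal.ofReal ((ρ / 2 ^ j) ^ (s - (∑ i, α i : ℕ))) *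
          osc s u x (ρ / 2 ^ j)) with ha
  have hstep : ∀ j, ‖U (j + 1) - U j‖ₑ ≤ a j := by
    intro j
    have := hC u h.1 (ρ / 2 ^ j) (by positivity) x
    rw [div_div, ← pow_succ] at this
    rw [ha]
    simp only [← mul_assoc]
    exact this
  have htel : ∀ J, ‖U J - U 0‖ₑ ≤ ∑ j ∈ Finset.range J, a j := by
    intro J
    rw [← Finset.sum_range_sub]
    exact (enorm_sum_le _ _).trans (Finset.sum_le_sum fun j _ => hstep j)
  have hρ0 : Tendsto (fun j : ℕ => ρ / 2 ^ j) atTop (𝓝[>] 0) := by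
    refine tendsto_nhdsWithin_iff.2 ⟨?_, Eventually.of_forall fun j => by
      simp only [Set.mem_Ioi]; positivity⟩
    exact tendsto_const_nhds.div_atTop (tendsto_pow_atTop_atTop_of_one_lt one_lt_two)
  have hlim : Tendsto U atTop (𝓝 (g x)) := by
    refine (hx.comp hρ0).congr fun j => ?_
    simp only [Function.comp, hU]
    rw [h.conv_multiD (hφ.contDiff_dil _) (hφ.hasCompactSupport_dil (by positivity))]
  have hlim2 : Tendsto (fun J => ‖U J - U 0‖ₑ) atTop (𝓝 ‖g x - U 0‖ₑ) :=
    (hlim.sub tendsto_const_nhds).enorm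
  have h0 : U 0 = conv (multiD α (dil φ ρ)) u x := by simp [hU]
  rw [← h0, ← ENNReal.tsum_mul_left]
  exact le_of_tendsto hlim2 (Eventually.of_forall fun J =>
    (htel J).trans (ENNReal.sum_le_tsum _))

end Mollified

/-! ### Dyadic sums -/

/-- Applied with τ = s - k. For k = [s] its positivity is where s must not be an integer. -/
theorem exists_tsum_dyadic_rpow {τ : ℝ} (hτ : 0 < τ) : ∃ C : ℝ≥0, 0 < C ∧ ∀ ρ : ℝ, 0 < ρ →
    ∑' j : ℕ, ENNReal.ofReal ((ρ / 2 ^ j) ^ τ) = C * ENNReal.ofReal (ρ ^ τ) := by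
  set r := ENNReal.ofReal ((2 : ℝ) ^ (-τ)) with hr
  have hr1 : r < 1 := by
    rw [hr, ENNReal.ofReal_lt_one]
    exact Real.rpow_lt_one_of_one_lt_of_neg one_lt_two (by linarith)
  have ht : (1 - r)⁻¹ ≠ ∞ := ENNReal.inv_ne_top.2 (tsub_pos_of_lt hr1).ne'
  refine ⟨(1 - r)⁻¹.toNNReal, ENNReal.toNNReal_pos (by simp) ht, fun ρ hρ => ?_⟩
  rw [ENNReal.coe_toNNReal ht, ← ENNReal.tsum_geometric, ← ENNReal.tsum_mul_right]
  refine tsum_congr fun j => ?_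
  rw [hr, ← ENNReal.ofReal_pow (by positivity), ← ENNReal.ofReal_mul (by positivity)]
  congr 1
  rw [Real.div_rpow hρ.le (by positivity), Real.rpow_neg (by norm_num), inv_pow,
    ← Real.rpow_natCast, ← Real.rpow_natCast, ← Real.rpow_mul (by norm_num),
    ← Real.rpow_mul (by norm_num), mul_comm τ]
  field_simp

/-- The substitution r = ρ/2^j preserves dρ/ρ, and the images of (1/2, 1) are disjoint subsets of
(0, 1). -/
theorem tsum_lintegral_dyadic_le (F : ℝ → ℝ≥0∞) :
    ∑' j : ℕ, ∫⁻ ρ in Set.Ioo (1 / 2 : ℝ) 1, F (ρ / 2 ^ j) / ENNReal.ofReal ρ ≤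
      ∫⁻ r in Set.Ioo (0 : ℝ) 1, F r / ENNReal.ofReal r := by
  set S : ℕ → Set ℝ := fun j => Set.Ioo (1 / 2 / 2 ^ j : ℝ) (1 / 2 ^ j) with hS
  have himg : ∀ j : ℕ, (fun ρ : ℝ => ρ / 2 ^ j) '' Set.Ioo (1 / 2 : ℝ) 1 = S j := fun j => by
    have hj : (0 : ℝ) < 2 ^ j := by positivity
    ext r
    simp only [hS, Set.mem_image, Set.mem_Ioo]
    constructor
    · rintro ⟨x, hx, rfl⟩
      exact ⟨by have := hx.1; gcongr, by have := hx.2; gcongr⟩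
    · rintro ⟨h1, h2⟩
      exact ⟨r * 2 ^ j, ⟨(div_lt_iff₀ hj).1 h1, (lt_div_iff₀ hj).1 h2⟩,
        mul_div_cancel_right₀ _ hj.ne'⟩
  have hterm : ∀ j : ℕ, ∫⁻ ρ in Set.Ioo (1 / 2 : ℝ) 1, F (ρ / 2 ^ j) / ENNReal.ofReal ρ =
      ∫⁻ r in S j, F r / ENNReal.ofReal r := by
    intro j
    rw [← himg, lintegral_image_eq_lintegral_abs_deriv_mul (f := fun ρ : ℝ => ρ / 2 ^ j) (f' := fun _ => 1 / 2 ^ j)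
      measurableSet_Ioo (fun x _ => ((hasDerivAt_id x).div_const _).hasDerivWithinAt)
      (fun x _ y _ h => by
        have h : x / 2 ^ j = y / 2 ^ j := h
        field_simp at h
        exact h)]
    refine setLIntegral_congr_fun measurableSet_Ioo fun ρ hρ => ?_
    have hρ0 : 0 < ρ := by have := hρ.1; linarith
    have hj : ENNReal.ofReal (1 / 2 ^ j) ≠ 0 := by
      simp
    have e : ENNReal.ofReal (ρ / 2 ^ j) = ENNReal.ofReal (1 / 2 ^ j) * ENNReal.ofReal ρ := by
      rw [← ENNReal.ofReal_mul (by positivity), one_div_mul_eq_div]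
    rw [abs_of_pos (by positivity), e, ← mul_div_assoc, ENNReal.mul_div_mul_left _ _ hj
      ENNReal.ofReal_ne_top]
  simp_rw [hterm]
  have hdisj : Pairwise (Function.onFun Disjoint S) := by
    have key : ∀ i j : ℕ, i < j → Disjoint (S i) (S j) := by
      intro i j hij
      refine Set.disjoint_left.2 fun x hx hx' => ?_
      have h1 : (1 : ℝ) / 2 ^ j ≤ 1 / 2 / 2 ^ i := by
        rw [div_div, ← pow_succ']
        gcongr
        · norm_num
        · exact hij
      linarith [hx.1, hx'.2]
    intro i j hij
    rcases lt_or_gt_of_ne hij with h | h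
    · exact key i j h
    · exact (key j i h).symm
  rw [← lintegral_iUnion (fun j => measurableSet_Ioo) hdisj]
  refine lintegral_mono_set (Set.iUnion_subset fun j x hx => ⟨lt_trans (by positivity) hx.1, ?_⟩)
  refine hx.2.trans_le ?_
  rw [div_le_one (by positivity)]
  exact one_le_pow₀ (by norm_num)

/-! ### Existence of weak derivatives -/

/-- Completeness of L¹ on balls: the telescoping series converges absolutely almost everywhere, and
its tails bound the distance to the limit. One limit serves all radii. -/
theorem exists_limit_of_tsum_lintegral_ne_top {U : ℕ → Rn n → ℝ} (hU : ∀ j, Continuous (U j))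
    (h : ∀ R : ℝ, ∑' j, ∫⁻ x in Metric.ball (0 : Rn n) R, ‖U (j + 1) x - U j x‖ₑ ≠ ∞) :
    ∃ g : Rn n → ℝ, LocallyIntegrable g ∧ ∀ R : ℝ,
      Tendsto (fun J => ∫⁻ x in Metric.ball (0 : Rn n) R, ‖U J x - g x‖ₑ) atTop (𝓝 0) := by
  have hm : ∀ j, Measurable fun x => ‖U (j + 1) x - U j x‖ₑ := fun j =>
    (((hU (j + 1)).sub (hU j)).measurable).enorm
  have hfin : ∀ᵐ x, ∑' j, ‖U (j + 1) x - U j x‖ₑ ≠ ∞ := by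
    have h1 : ∀ R : ℕ, ∀ᵐ x, x ∈ Metric.ball (0 : Rn n) R →
        ∑' j, ‖U (j + 1) x - U j x‖ₑ ≠ ∞ := by
      intro R
      rw [← ae_restrict_iff' measurableSet_ball]
      have h2 := h R
      rw [← lintegral_tsum fun j => (hm j).aemeasurable] at h2
      exact (ae_lt_top (Measurable.tsum hm) h2).mono fun x hx => hx.ne
    filter_upwards [ae_all_iff.2 h1] with x hx
    obtain ⟨R, hR⟩ := exists_nat_gt ‖x‖
    exact hx R (by simpa using hR)
  set g : Rn n → ℝ := fun x => U 0 x + ∑' j, (U (j + 1) x - U j x) with hg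
  have hlim : ∀ᵐ x, Tendsto (fun J => U J x) atTop (𝓝 (g x)) := by
    filter_upwards [hfin] with x hx
    have hs : Summable fun j => U (j + 1) x - U j x := by
      refine Summable.of_norm ?_
      simp_rw [← ofReal_norm] at hx
      have h2 := ENNReal.summable_toReal hx
      simpa [ENNReal.toReal_ofReal] using h2
    have h2 := (hs.hasSum.tendsto_sum_nat).const_add (U 0 x)
    refine h2.congr fun J => ?_
    rw [Finset.sum_range_sub (fun j => U j x)]
    ring
  have hgm : AEStronglyMeasurable g :=
    aestronglyMeasurable_of_tendsto_ae atTop (fun j => (hU j).aestronglyMeasurable) hlim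
  have htail : ∀ᵐ x, ∀ J, ‖U J x - g x‖ₑ ≤ ∑' j, ‖U (j + J + 1) x - U (j + J) x‖ₑ := by
    filter_upwards [hlim] with x hx J
    have h1 : Tendsto (fun N => ‖U J x - U (N + J) x‖ₑ) atTop (𝓝 ‖U J x - g x‖ₑ) :=
      (tendsto_const_nhds.sub (hx.comp (tendsto_add_atTop_nat J))).enorm
    refine le_of_tendsto h1 (Eventually.of_forall fun N => ?_)
    have h2 : U (N + J) x - U J x = ∑ j ∈ Finset.range N, (U (j + J + 1) x - U (j + J) x) := by
      rw [show U J x = U (0 + J) x by rw [zero_add], ← Finset.sum_range_sub fun j => U (j + J) x]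
      refine Finset.sum_congr rfl fun j _ => ?_
      rw [add_right_comm]
    rw [enorm_sub_rev, h2]
    exact (enorm_sum_le _ _).trans (ENNReal.sum_le_tsum _)
  have hbound : ∀ R : ℝ, ∀ J, ∫⁻ x in Metric.ball (0 : Rn n) R, ‖U J x - g x‖ₑ ≤
      ∑' j, ∫⁻ x in Metric.ball (0 : Rn n) R, ‖U (j + J + 1) x - U (j + J) x‖ₑ := by
    intro R J
    rw [← lintegral_tsum fun j => (hm (j + J)).aemeasurable]
    exact lintegral_mono_ae (ae_restrict_of_ae (htail.mono fun x hx => hx J))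
  refine ⟨g, fun x => ⟨Metric.ball 0 (‖x‖ + 1), Metric.isOpen_ball.mem_nhds (by simp), ?_⟩, fun R => ?_⟩
  · have h0 : IntegrableOn (U 0) (Metric.ball (0 : Rn n) (‖x‖ + 1)) :=
      ((hU 0).continuousOn.integrableOn_compact (isCompact_closedBall _ _)).mono_set
        Metric.ball_subset_closedBall
    have h1 : IntegrableOn (fun y => U 0 y - g y) (Metric.ball (0 : Rn n) (‖x‖ + 1)) := by
      refine ⟨((hU 0).aestronglyMeasurable.sub hgm).restrict, ?_⟩
      have := hbound (‖x‖ + 1) 0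
      simp only [add_zero] at this
      exact this.trans_lt (h _).lt_top
    refine (h0.sub h1).congr (Eventually.of_forall fun y => ?_)
    simp
  · exact tendsto_of_tendsto_of_tendsto_of_le_of_le tendsto_const_nhds
      (ENNReal.tendsto_sum_nat_add _ (h R)) (fun _ => bot_le) (hbound R)

theorem tendsto_integral_mul_of_tendsto_lintegral {U : ℕ → Rn n → ℝ} {g ψ : Rn n → ℝ}
    (hU : ∀ j, LocallyIntegrable (U j)) (hg : LocallyIntegrable g) (hψ : Continuous ψ)
    (hψc : HasCompactSupport ψ)
    (h : ∀ R : ℝ, Tendsto (fun J => ∫⁻ x in Metric.ball (0 : Rn n) R, ‖U J x - g x‖ₑ)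
      atTop (𝓝 0)) :
    Tendsto (fun J => ∫ x, U J x * ψ x) atTop (𝓝 (∫ x, g x * ψ x)) := by
  obtain ⟨M, hM⟩ := hψ.bounded_above_of_compact_support hψc
  obtain ⟨R, hR⟩ := hψc.isBounded.subset_ball (0 : Rn n)
  have hint : ∀ v : Rn n → ℝ, LocallyIntegrable v → Integrable fun x => v x * ψ x := fun v hv => by
    have := hv.integrable_smul_left_of_hasCompactSupport hψ hψc
    simpa [mul_comm] using this
  refine tendsto_integral_of_L1 _ (hint g hg).aestronglyMeasurable
    (Eventually.of_forall fun J => hint _ (hU J)) ?_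
  have h1 := ENNReal.Tendsto.const_mul (a := ENNReal.ofReal M) (h R)
    (Or.inr ENNReal.ofReal_ne_top)
  rw [mul_zero] at h1
  refine tendsto_of_tendsto_of_tendsto_of_le_of_le tendsto_const_nhds h1 (fun _ => bot_le)
    fun J => ?_
  rw [← lintegral_const_mul' _ _ ENNReal.ofReal_ne_top, ← lintegral_indicator measurableSet_ball]
  refine lintegral_mono fun x => ?_
  rw [← sub_mul, enorm_mul]
  by_cases hx : x ∈ Metric.ball (0 : Rn n) R
  · rw [Set.indicator_of_mem hx, mul_comm]
    gcongr
    rw [← ofReal_norm]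
    exact ENNReal.ofReal_le_ofReal (hM x)
  · have : ψ x = 0 := by
      by_contra h0
      exact hx (hR (subset_tsupport _ h0))
    simp [this]

/-- Mollifications of u satisfy the integration by parts formula classically. Both of its sides pass
to the limit by local L¹ convergence. -/
theorem exists_isWeakDeriv_of_tsum_lintegral_ne_top {φ : Rn n → ℝ} (hφ : IsMollifier φ)
    {u : Rn n → ℝ} (hu : LocallyIntegrable u) (α : Fin n → ℕ) {ρ : ℝ} (hρ : 0 < ρ)
    (h : ∀ R : ℝ, ∑' j : ℕ, ∫⁻ x in Metric.ball (0 : Rn n) R,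
      ‖conv (multiD α (dil φ (ρ / 2 ^ (j + 1)))) u x -
        conv (multiD α (dil φ (ρ / 2 ^ j))) u x‖ₑ ≠ ∞) :
    ∃ g, IsWeakDeriv α u g := by
  have hρ0 : Tendsto (fun j : ℕ => ρ / 2 ^ j) atTop (𝓝[>] 0) := by
    refine tendsto_nhdsWithin_iff.2 ⟨?_, Eventually.of_forall fun j => by
      simp only [Set.mem_Ioi]; positivity⟩
    exact tendsto_const_nhds.div_atTop (tendsto_pow_atTop_atTop_of_one_lt one_lt_two)
  have hdc : ∀ j : ℕ, HasCompactSupport (dil φ (ρ / 2 ^ j)) := fun j =>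
    hφ.hasCompactSupport_dil (by positivity)
  have hU : ∀ j : ℕ, Continuous (conv (multiD α (dil φ (ρ / 2 ^ j))) u) := fun j =>
    (contDiff_conv (contDiff_multiD (hφ.contDiff_dil _) α)
      (hasCompactSupport_multiD (hdc j) α) hu).continuous
  have hV : ∀ j : ℕ, ContDiff ℝ (⊤ : ℕ∞) (conv (dil φ (ρ / 2 ^ j)) u) := fun j =>
    contDiff_conv (hφ.contDiff_dil _) (hdc j) hu
  obtain ⟨g, hg, hlim⟩ := exists_limit_of_tsum_lintegral_ne_top hU h
  refine ⟨g, hu, hg, fun ψ hψ hψc => ?_⟩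
  have h1 := tendsto_integral_mul_of_tendsto_lintegral
    (fun j => (hV j).continuous.locallyIntegrable) hu (contDiff_multiD hψ α).continuous
    (hasCompactSupport_multiD hψc α) fun R => (tendsto_conv_dil hφ hu 0 R).comp hρ0
  have h2 := (tendsto_integral_mul_of_tendsto_lintegral (fun j => (hU j).locallyIntegrable) hg
    hψ.continuous hψc hlim).const_mul ((-1) ^ ∑ i, α i)
  refine tendsto_nhds_unique h1 (h2.congr fun j => ?_)
  rw [multiD_eq_listD, multiD_eq_listD, integral_mul_listD (hV j) hψ hψc,
    listD_conv (hφ.contDiff_dil _) (hdc j) hu, length_listOf]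

theorem Gauge.setLIntegral_le {B : ℝ≥0∞ → ℝ≥0∞} (hB : Gauge B) : ∃ b M : ℝ≥0∞, b ≠ ∞ ∧ M ≠ ∞ ∧
    ∀ (l : ℝ≥0), 0 < l → ∀ (f : Rn n → ℝ≥0∞) (S : Set (Rn n)),
      ∫⁻ x in S, f x ≤ l * (b * volume S + M * ∫⁻ x, B (f x / l)) := by
  obtain ⟨b, M, hb, hM, hbM⟩ := hB.exists_le_add
  refine ⟨b, M, hb, hM, fun l hl f S => ?_⟩
  have hl0 : (l : ℝ≥0∞) ≠ 0 := by exact_mod_cast hl.ne'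
  calc ∫⁻ x in S, f x = ∫⁻ x in S, l * (f x / l) := by
        simp_rw [ENNReal.mul_div_cancel hl0 ENNReal.coe_ne_top]
    _ ≤ ∫⁻ x in S, l * (b + M * B (f x / l)) := by
        gcongr with x
        exact hbM _
    _ = l * (b * volume S + M * ∫⁻ x in S, B (f x / l)) := by
        rw [lintegral_const_mul' _ _ ENNReal.coe_ne_top, lintegral_add_left measurable_const,
          lintegral_const_mul' _ _ hM, setLIntegral_const]
    _ ≤ _ := by
        gcongr
        exact Measure.restrict_le_self

theorem measurable_lintegral_osc {B : ℝ≥0∞ → ℝ≥0∞} (hB : Measurable B) {s : ℝ} {u : Rn n → ℝ}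
    (hu : AEMeasurable u) (l : ℝ≥0∞) : Measurable fun r : ℝ => ∫⁻ x, B (osc s u x r / l) :=
  Measurable.lintegral_prod_left' (f := fun p : Rn n × ℝ => B (osc s u p.1 p.2 / l))
    (hB.comp ((measurable_osc hu).div_const l))

theorem exists_isWeakDeriv_of_osc (hn : 1 ≤ n) {s : ℝ} {B : ℝ≥0∞ → ℝ≥0∞} (hB : Gauge B)
    {u : Rn n → ℝ} (hu : LocallyIntegrable u) {l : ℝ≥0} (hl : 0 < l)
    (h : ∫⁻ r in Set.Ioo (0 : ℝ) 1, (∫⁻ x, B (osc s u x r / l)) / ENNReal.ofReal r ≠ ∞)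
    (α : Fin n → ℕ) (hα : ((∑ i, α i : ℕ) : ℝ) < s) : ∃ g, IsWeakDeriv α u g := by
  obtain ⟨φ, hφ⟩ := exists_isReproducing n ⌊s⌋₊
  obtain ⟨C, hC⟩ := exists_mollified_sub_le hn hφ α
  obtain ⟨D, -, hD⟩ := exists_tsum_dyadic_rpow (sub_pos.2 hα)
  obtain ⟨b, M, hb, hM, hbM⟩ := hB.setLIntegral_le (n := n)
  set F : ℝ → ℝ≥0∞ := fun r => ∫⁻ x, B (osc s u x r / l) with hF
  have hFm : Measurable F :=
    measurable_lintegral_osc hB.measurable hu.aestronglyMeasurable.aemeasurable l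
  -- The modulars F(r) are only integrable against dr/r. Averaging over ρ in (1/2, 1) selects one ρ
  -- for which the sum of F(ρ/2^j) over j is finite. All the F(ρ/2^j) are then bounded by one
  -- constant, and the geometric factors give convergence.
  have h1 : ∫⁻ ρ in Set.Ioo (1 / 2 : ℝ) 1, ∑' j : ℕ, F (ρ / 2 ^ j) / ENNReal.ofReal ρ ≠ ∞ := by
    rw [lintegral_tsum fun j => by fun_prop]
    exact ne_top_of_le_ne_top h (tsum_lintegral_dyadic_le F)
  have h2 := ae_lt_top (Measurable.tsum fun j => by fun_prop) h1
  have h3 : (ae (volume.restrict (Set.Ioo (1 / 2 : ℝ) 1))).NeBot := by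
    rw [ae_neBot]
    intro h0
    have := congrArg (fun μ => μ Set.univ) h0
    simp at this
    norm_num at this
  obtain ⟨ρ, hρ1, hρ⟩ := (h2.and (ae_restrict_mem measurableSet_Ioo)).exists
  have hρ0 : 0 < ρ := by have := hρ.1; linarith
  have hFj : ∀ j : ℕ, F (ρ / 2 ^ j) ≤ ENNReal.ofReal ρ * ∑' j : ℕ, F (ρ / 2 ^ j) / ENNReal.ofReal ρ := by
    intro j
    calc F (ρ / 2 ^ j) = ENNReal.ofReal ρ * (F (ρ / 2 ^ j) / ENNReal.ofReal ρ) :=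
          (ENNReal.mul_div_cancel (by simpa using hρ0) ENNReal.ofReal_ne_top).symm
      _ ≤ _ := by gcongr; exact ENNReal.le_tsum j
  set F₀ := ENNReal.ofReal ρ * ∑' j : ℕ, F (ρ / 2 ^ j) / ENNReal.ofReal ρ with hF₀
  have hF₀t : F₀ ≠ ∞ := ENNReal.mul_ne_top ENNReal.ofReal_ne_top hρ1.ne
  refine exists_isWeakDeriv_of_tsum_lintegral_ne_top hφ.toIsMollifier hu α hρ0 fun R => ?_
  set K := l * (b * volume (Metric.ball (0 : Rn n) R) + M * F₀) with hK
  have hKt : K ≠ ∞ := ENNReal.mul_ne_top ENNReal.coe_ne_top (ENNReal.add_ne_top.2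
    ⟨ENNReal.mul_ne_top hb measure_ball_lt_top.ne, ENNReal.mul_ne_top hM hF₀t⟩)
  have hj : ∀ j : ℕ, ∫⁻ x in Metric.ball (0 : Rn n) R,
      ‖conv (multiD α (dil φ (ρ / 2 ^ (j + 1)))) u x -
        conv (multiD α (dil φ (ρ / 2 ^ j))) u x‖ₑ ≤
      C * K * ENNReal.ofReal ((ρ / 2 ^ j) ^ (s - (∑ i, α i : ℕ))) := by
    intro j
    have hρj : 0 < ρ / 2 ^ j := by positivity
    calc _ ≤ ∫⁻ x in Metric.ball (0 : Rn n) R,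
          C * ENNReal.ofReal ((ρ / 2 ^ j) ^ (s - (∑ i, α i : ℕ))) * osc s u x (ρ / 2 ^ j) := by
          refine lintegral_mono fun x => ?_
          have := hC u hu _ hρj x
          rwa [div_div, ← pow_succ] at this
      _ = C * ENNReal.ofReal ((ρ / 2 ^ j) ^ (s - (∑ i, α i : ℕ))) *
          ∫⁻ x in Metric.ball (0 : Rn n) R, osc s u x (ρ / 2 ^ j) :=
          lintegral_const_mul' _ _ (ENNReal.mul_ne_top ENNReal.coe_ne_top ENNReal.ofReal_ne_top)
      _ ≤ C * ENNReal.ofReal ((ρ / 2 ^ j) ^ (s - (∑ i, α i : ℕ))) * K := by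
          gcongr
          refine (hbM l hl _ _).trans ?_
          rw [hK]
          gcongr
          exact hFj j
      _ = _ := by ring
  refine ne_top_of_le_ne_top ?_ (ENNReal.tsum_le_tsum hj)
  rw [ENNReal.tsum_mul_left, hD ρ hρ0]
  exact ENNReal.mul_ne_top (ENNReal.mul_ne_top ENNReal.coe_ne_top hKt)
    (ENNReal.mul_ne_top ENNReal.coe_ne_top ENNReal.ofReal_ne_top)

/-! ### The chosen weak derivatives -/

theorem isWeakDeriv_zero {u : Rn n → ℝ} (hu : LocallyIntegrable u) : IsWeakDeriv 0 u u := by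
  refine ⟨hu, hu, fun φ hφ hφc => ?_⟩
  have : multiD (0 : Fin n → ℕ) φ = φ := by
    unfold multiD
    simp only [Pi.zero_apply, Function.iterate_zero, id]
    induction List.finRange n with
    | nil => rfl
    | cons i l ih => simp
  simp [this]

theorem isWeakDeriv_weakDeriv {α : Fin n → ℕ} {u : Rn n → ℝ} (h : ∃ g, IsWeakDeriv α u g) :
    IsWeakDeriv α u (weakDeriv α u) := by
  unfold weakDeriv
  by_cases hα : α = 0
  · subst hα
    obtain ⟨g, hg⟩ := h
    simpa using isWeakDeriv_zero hg.1
  · rw [if_neg hα, dif_pos h]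
    exact h.choose_spec

theorem orliczNorm_weakGrad_zero (A : ℝ≥0 → ℝ≥0∞) (u : Rn n → ℝ) :
    orliczNorm A (weakGrad 0 u) = orliczNorm A u := by
  unfold orliczNorm
  congr 1; funext l
  refine lintegral_congr fun x => ?_
  have h0 : ∀ α : MultiIndex n 0, α.1 = 0 := fun α => by
    have := α.2
    simpa using this
  have : ‖weakGrad 0 u x‖ₑ = ‖u x‖ₑ := by
    let α₀ : MultiIndex n 0 := ⟨0, by simp⟩
    have hu : Unique (MultiIndex n 0) := ⟨⟨α₀⟩, fun α => Subtype.ext ((h0 α).trans (h0 α₀).symm)⟩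
    rw [← ofReal_norm, ← ofReal_norm, EuclideanSpace.norm_eq, Fintype.sum_unique]
    congr 1
    rw [Real.sqrt_sq (norm_nonneg _)]
    simp [weakGrad, weakDeriv, h0]
  rw [this]

/-! ### Lower order norms -/

/-- The mollified derivative at scale ρ is controlled by a local integral of |u|, the rest by the
telescoping sum. The scale is left free in (1/2, 1) so that one can average over it later. -/
theorem exists_enorm_weakGrad_le (hn : 1 ≤ n) {s : ℝ} {k : ℕ} (hk : (k : ℝ) < s) :
    ∃ E : ℝ≥0, ∀ u : Rn n → ℝ,
      (∀ α : MultiIndex n k, IsWeakDeriv α.1 u fun x => weakGrad k u x α) →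
      ∀ᵐ x, ∀ ρ ∈ Set.Ioo (1 / 2 : ℝ) 1, ‖weakGrad k u x‖ₑ ≤
        E * ((∫⁻ y in Metric.ball x 1, ‖u y‖ₑ) +
          ∑' j : ℕ, ENNReal.ofReal ((1 / 2 ^ j) ^ (s - k)) * osc s u x (ρ / 2 ^ j)) := by
  obtain ⟨φ, hφ⟩ := exists_isReproducing n ⌊s⌋₊
  choose M hM using fun α : MultiIndex n k => exists_conv_multiD_dil_le hn hφ.toIsMollifier α.1
  choose C hC using fun α : MultiIndex n k =>
    exists_weakDeriv_sub_mollified_le (s := s) hn hφ α.1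
  simp only [sum_multiIndex] at hM hC
  -- Here 2^(n+k) bounds ρ^{-n-k} for ρ > 1/2.
  refine ⟨∑ α, (M α * 2 ^ (n + k) + C α), fun u hG => ?_⟩
  filter_upwards [ae_all_iff.2 fun α => hC α u _ (hG α)] with x hx ρ hρ
  have hρ0 : 0 < ρ := by have := hρ.1; linarith
  refine (enorm_le_sum _).trans ?_
  rw [ENNReal.ofNNReal_finsetSum, Finset.sum_mul]
  refine Finset.sum_le_sum fun α _ => ?_
  set I := ∫⁻ y in Metric.ball x 1, ‖u y‖ₑ with hI
  set T := ∑' j : ℕ, ENNReal.ofReal ((1 / 2 ^ j) ^ (s - k)) * osc s u x (ρ / 2 ^ j) with hT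
  have h1 := hx α ρ hρ0
  have h2 : ∑' j : ℕ, ENNReal.ofReal ((ρ / 2 ^ j) ^ (s - k)) * osc s u x (ρ / 2 ^ j) ≤ T := by
    refine ENNReal.tsum_le_tsum fun j => ?_
    have := hρ.2.le
    gcongr
  have h3 : ‖conv (multiD α.1 (dil φ ρ)) u x‖ₑ ≤ M α * 2 ^ (n + k) * I := by
    refine (hM α ρ hρ0 u x).trans ?_
    have e : (ENNReal.ofReal ρ ^ (n + k))⁻¹ ≤ 2 ^ (n + k) := by
      rw [ENNReal.inv_le_iff_inv_le, ENNReal.inv_pow]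
      gcongr
      rw [← ENNReal.ofReal_ofNat 2, ← ENNReal.ofReal_inv_of_pos two_pos]
      exact ENNReal.ofReal_le_ofReal (by have := hρ.1; linarith)
    gcongr
    exact lintegral_mono_set (Metric.ball_subset_ball hρ.2.le)
  calc ‖weakGrad k u x α‖ₑ
      ≤ ‖weakGrad k u x α - conv (multiD α.1 (dil φ ρ)) u x‖ₑ +
          ‖conv (multiD α.1 (dil φ ρ)) u x‖ₑ := by
        simpa using enorm_add_le (weakGrad k u x α - conv (multiD α.1 (dil φ ρ)) u x)
          (conv (multiD α.1 (dil φ ρ)) u x)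
    _ ≤ C α * T + M α * 2 ^ (n + k) * I := by
        gcongr
        exact h1.trans (by gcongr)
    _ ≤ C α * (I + T) + M α * 2 ^ (n + k) * (I + T) := by
        gcongr
        · exact le_add_self
        · exact le_self_add
    _ = _ := by push_cast; ring

theorem Gauge.ball_average_le {B : ℝ≥0∞ → ℝ≥0∞} (hB : Gauge B) {f : Rn n → ℝ≥0∞}
    (hf : AEMeasurable f) (x : Rn n) :
    B ((volume (Metric.ball (0 : Rn n) 1))⁻¹ * (∫⁻ y in Metric.ball x 1, f y) / 2) ≤
      (volume (Metric.ball (0 : Rn n) 1))⁻¹ * ∫⁻ y in Metric.ball x 1, B (f y) := by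
  set v := volume (Metric.ball (0 : Rn n) 1) with hv
  have hv0 : v ≠ 0 := (Metric.measure_ball_pos _ _ one_pos).ne'
  have hvt : v ≠ ∞ := measure_ball_lt_top.ne
  have h := hB.half_lintegral_le (μ := v⁻¹ • volume.restrict (Metric.ball x 1)) (f := f) (by
    simp only [Measure.smul_apply, smul_eq_mul, Measure.restrict_apply_univ]
    rw [volume_ball_eq, ENNReal.inv_mul_cancel hv0 hvt]) (hf.restrict.smul_measure _)
  simpa only [lintegral_smul_measure, smul_eq_mul] using h

theorem lintegral_ball_average {f : Rn n → ℝ≥0∞} (hf : AEMeasurable f) :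
    ∫⁻ x, (volume (Metric.ball (0 : Rn n) 1))⁻¹ * ∫⁻ y in Metric.ball x 1, f y = ∫⁻ y, f y := by
  set v := volume (Metric.ball (0 : Rn n) 1) with hv
  have hv0 : v ≠ 0 := (Metric.measure_ball_pos _ _ one_pos).ne'
  have hvt : v ≠ ∞ := measure_ball_lt_top.ne
  have e : ∀ x, ∫⁻ y in Metric.ball x 1, f y = ∫⁻ y in Metric.ball x 1, hf.mk f y := fun x =>
    lintegral_congr_ae (ae_restrict_of_ae hf.ae_eq_mk)
  simp_rw [e]
  rw [lintegral_const_mul' _ _ (ENNReal.inv_ne_top.2 hv0), lintegral_ball_swap hf.measurable_mk,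
    ← mul_assoc, ENNReal.inv_mul_cancel hv0 hvt, one_mul, lintegral_congr_ae hf.ae_eq_mk]

/-- Integrate over ρ in (1/2, 1), where 1 ≤ 1/ρ: the dyadic sum becomes one integral over (0, 1), so
I/2 ≤ 1/2 + 1. -/
theorem le_three_of_le_dyadic {F : ℝ → ℝ≥0∞} (hF : Measurable F)
    (hF1 : ∫⁻ r in Set.Ioo (0 : ℝ) 1, F r / ENNReal.ofReal r ≤ 1) {I : ℝ≥0∞}
    (hI : ∀ ρ ∈ Set.Ioo (1 / 2 : ℝ) 1, I ≤ 1 + ∑' j : ℕ, F (ρ / 2 ^ j)) : I ≤ 3 := by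
  have h1 : ∫⁻ _ in Set.Ioo (1 / 2 : ℝ) 1, I ≤
      ∫⁻ ρ in Set.Ioo (1 / 2 : ℝ) 1, (1 + ∑' j : ℕ, F (ρ / 2 ^ j) / ENNReal.ofReal ρ) := by
    refine setLIntegral_mono' measurableSet_Ioo fun ρ hρ => (hI ρ hρ).trans ?_
    gcongr with j
    refine ENNReal.le_div_iff_mul_le (Or.inl ?_) (Or.inl ENNReal.ofReal_ne_top) |>.2 ?_
    · have := hρ.1
      simpa using (by linarith : 0 < ρ)
    · exact mul_le_of_le_one_right' (ENNReal.ofReal_le_one.2 hρ.2.le)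
  have hvol : volume (Set.Ioo (1 / 2 : ℝ) 1) = 2⁻¹ := by
    rw [Real.volume_Ioo, show (1 - 1 / 2 : ℝ) = 2⁻¹ by norm_num,
      ENNReal.ofReal_inv_of_pos two_pos, ENNReal.ofReal_ofNat]
  rw [setLIntegral_const, hvol, lintegral_add_left measurable_const, setLIntegral_const, hvol,
    lintegral_tsum fun j => by fun_prop, one_mul] at h1
  have h2 : I * 2⁻¹ ≤ 2⁻¹ + 1 := h1.trans (by
    gcongr
    exact (tsum_lintegral_dyadic_le F).trans hF1)
  calc I = I * 2⁻¹ * 2 := by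
        rw [mul_assoc, ENNReal.inv_mul_cancel (by simp) (by simp), mul_one]
    _ ≤ (2⁻¹ + 1) * 2 := by gcongr
    _ = 3 := by
        rw [add_mul, ENNReal.inv_mul_cancel (by simp) (by simp)]; norm_num

theorem enorm_le_mul_mul_add {g I T a b E v D l₁ l₂ : ℝ≥0∞} (h : g ≤ E * (I + T))
    (hI : I ≤ v * l₁ * a) (hT : T ≤ D * l₂ * b) :
    g ≤ E * (v + D) * (l₁ + l₂) * (a + b) := by
  calc g ≤ E * (v * l₁ * a + D * l₂ * b) := h.trans (by gcongr)
    _ ≤ E * ((v + D) * (l₁ + l₂) * a + (v + D) * (l₁ + l₂) * b) := by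
        gcongr
        · exact le_self_add
        · exact le_self_add
        · exact le_add_self
        · exact le_add_self
    _ = _ := by ring

theorem exists_modular_weakGrad_le (hn : 1 ≤ n) {s : ℝ} {k : ℕ} (hk : (k : ℝ) < s) :
    ∃ C : ℝ≥0, 0 < C ∧ ∀ B : ℝ≥0∞ → ℝ≥0∞, Gauge B → ∀ u : Rn n → ℝ, LocallyIntegrable u →
      (∀ α : MultiIndex n k, IsWeakDeriv α.1 u fun x => weakGrad k u x α) →
      ∀ l₁ l₂ : ℝ≥0, 0 < l₁ → 0 < l₂ → ∫⁻ x, B (‖u x‖ₑ / l₁) ≤ 1 →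
      ∫⁻ r in Set.Ioo (0 : ℝ) 1, (∫⁻ x, B (osc s u x r / l₂)) / ENNReal.ofReal r ≤ 1 →
      ∫⁻ x, B (‖weakGrad k u x‖ₑ / (C * (l₁ + l₂) : ℝ≥0)) ≤ 1 := by
  obtain ⟨E, hE⟩ := exists_enorm_weakGrad_le hn hk
  obtain ⟨D, hD0, hD⟩ := exists_tsum_dyadic_rpow (sub_pos.2 hk)
  set v := volume (Metric.ball (0 : Rn n) 1) with hv
  have hv0 : v ≠ 0 := (Metric.measure_ball_pos _ _ one_pos).ne'
  have hvt : v ≠ ∞ := measure_ball_lt_top.ne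
  have hD0' : (D : ℝ≥0∞) ≠ 0 := by exact_mod_cast hD0.ne'
  set w : ℕ → ℝ≥0∞ := fun j => ENNReal.ofReal ((1 / 2 ^ j) ^ (s - k)) with hw
  have hwD : ∑' j, w j = D := by simpa [hw] using hD 1 one_pos
  have hwD1 : ∑' j, w j / D = 1 := by
    simp_rw [div_eq_mul_inv]
    rw [ENNReal.tsum_mul_right, hwD, ENNReal.mul_inv_cancel hD0' ENNReal.coe_ne_top]
  set E' : ℝ≥0 := E * (v.toNNReal + D) + 1 with hE'
  -- 12 = 4 · 3: the 4 pays for splitting a sum of two terms and for the half in Jensen's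
  -- inequality, the 3 for the modular bound of `le_three_of_le_dyadic`.
  refine ⟨12 * E', by positivity, fun B hB u hu hG l₁ l₂ hl₁ hl₂ h1 h2 => ?_⟩
  have hl₁0 : (l₁ : ℝ≥0∞) ≠ 0 := by exact_mod_cast hl₁.ne'
  have hl₂0 : (l₂ : ℝ≥0∞) ≠ 0 := by exact_mod_cast hl₂.ne'
  have hum : AEMeasurable u := hu.aestronglyMeasurable.aemeasurable
  have huB : AEMeasurable fun y => B (‖u y‖ₑ / l₁) :=
    hB.measurable.comp_aemeasurable (hum.enorm.div_const _)
  set F : ℝ → ℝ≥0∞ := fun r => ∫⁻ x, B (osc s u x r / l₂) with hF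
  have hFm : Measurable F := measurable_lintegral_osc hB.measurable hum l₂
  have hoscm : ∀ r, Measurable fun x => B (osc s u x r / l₂) := fun r =>
    hB.measurable.comp (((measurable_osc hum).comp measurable_prodMk_right).div_const _)
  set N : ℝ≥0∞ := ((4 * E' * (l₁ + l₂) : ℝ≥0) : ℝ≥0∞) with hN
  have hN0 : N ≠ 0 := by
    have : 0 < 4 * E' * (l₁ + l₂) := by positivity
    rw [hN]
    exact_mod_cast this.ne'
  have hmain : ∫⁻ x, B (‖weakGrad k u x‖ₑ / N) ≤ 3 := by
    refine le_three_of_le_dyadic hFm h2 fun ρ hρ => ?_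
    calc ∫⁻ x, B (‖weakGrad k u x‖ₑ / N)
        ≤ ∫⁻ x, (v⁻¹ * (∫⁻ y in Metric.ball x 1, B (‖u y‖ₑ / l₁)) +
            ∑' j, w j / D * B (osc s u x (ρ / 2 ^ j) / l₂)) := by
          refine lintegral_mono_ae ?_
          filter_upwards [hE u hG] with x hx
          set a := v⁻¹ * ∫⁻ y in Metric.ball x 1, ‖u y‖ₑ / l₁ with ha
          set b := ∑' j, w j / D * (osc s u x (ρ / 2 ^ j) / l₂) with hb
          have hI : ∫⁻ y in Metric.ball x 1, ‖u y‖ₑ ≤ v * l₁ * a := by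
            rw [ha, mul_comm v, mul_assoc, ← mul_assoc v, ENNReal.mul_inv_cancel hv0 hvt, one_mul,
              ← lintegral_const_mul' _ _ ENNReal.coe_ne_top]
            simp_rw [ENNReal.mul_div_cancel hl₁0 ENNReal.coe_ne_top]
            exact le_rfl
          have hT : ∑' j : ℕ, w j * osc s u x (ρ / 2 ^ j) ≤ D * l₂ * b := by
            rw [hb, ← ENNReal.tsum_mul_left]
            refine ENNReal.tsum_le_tsum fun j => le_of_eq ?_
            rw [mul_mul_mul_comm, ENNReal.mul_div_cancel hD0' ENNReal.coe_ne_top,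
              ENNReal.mul_div_cancel hl₂0 ENNReal.coe_ne_top]
          have h3 := enorm_le_mul_mul_add (hx ρ hρ) hI hT
          have h4 : ‖weakGrad k u x‖ₑ / N ≤ (a / 2 + b / 2) / 2 := by
            refine ENNReal.div_le_of_le_mul (h3.trans ?_)
            have e : (a / 2 + b / 2) / 2 * N = E' * (l₁ + l₂) * (a + b) := by
              rw [hN]
              push_cast
              simp only [div_eq_mul_inv]
              calc (a * 2⁻¹ + b * 2⁻¹) * 2⁻¹ * (4 * E' * (l₁ + l₂))
                  = (2⁻¹ * 2) * (2⁻¹ * 2) * (E' * (l₁ + l₂) * (a + b)) := by ring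
                _ = _ := by
                  rw [ENNReal.inv_mul_cancel (by simp) (by simp), one_mul, one_mul]
            rw [e, hE']
            push_cast
            rw [ENNReal.coe_toNNReal hvt]
            gcongr
            exact le_self_add
          refine (hB.mono h4).trans ((hB.half_add_le _ _).trans (add_le_add ?_ ?_))
          · exact hB.ball_average_le (hum.enorm.div_const _) x
          · exact hB.tsum_le hwD1.le _
      _ = 1 * (∫⁻ x, B (‖u x‖ₑ / l₁)) + ∑' j, w j / D * F (ρ / 2 ^ j) := by
          rw [lintegral_add_right _ (Measurable.tsum fun j => (hoscm _).const_mul _),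
            lintegral_ball_average huB, one_mul,
            lintegral_tsum fun j => ((hoscm _).const_mul _).aemeasurable]
          congr 1
          exact tsum_congr fun j => lintegral_const_mul _ (hoscm _)
      -- After Jensen the weights are no longer needed: the scales ρ/2^j fill disjoint intervals as
      -- ρ varies, so the unweighted sum is affordable.
      _ ≤ 1 * 1 + ∑' j, 1 * F (ρ / 2 ^ j) := by
          gcongr with j
          rw [← hwD1]
          exact ENNReal.le_tsum j
      _ = _ := by simp
  have e : ∀ x, ‖weakGrad k u x‖ₑ / (12 * E' * (l₁ + l₂) : ℝ≥0) =
      ‖weakGrad k u x‖ₑ / N / 3 := by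
    intro x
    rw [← ennreal_div_mul (Or.inl hN0) (Or.inr (by simp)), hN]
    congr 1
    push_cast
    ring
  simp_rw [e]
  calc ∫⁻ x, B (‖weakGrad k u x‖ₑ / N / 3) ≤ ∫⁻ x, 3⁻¹ * B (‖weakGrad k u x‖ₑ / N) := by
        gcongr with x
        rw [mul_comm, ← div_eq_mul_inv]
        exact hB.div_le (by norm_num) _
    _ ≤ 3⁻¹ * 3 := by
        rw [lintegral_const_mul' _ _ (by simp)]
        gcongr
    _ = 1 := ENNReal.inv_mul_cancel (by simp) (by simp)

theorem exists_orliczNorm_weakGrad_le (hn : 1 ≤ n) {s : ℝ} {k : ℕ} (hk : (k : ℝ) < s) :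
    ∃ C : ℝ≥0, 0 < C ∧ ∀ A : ℝ≥0 → ℝ≥0∞, IsYoung A → ∀ u : Rn n → ℝ, LocallyIntegrable u →
      (∀ α : MultiIndex n k, IsWeakDeriv α.1 u fun x => weakGrad k u x α) →
      orliczNorm A (weakGrad k u) ≤ C * oscNorm s A u := by
  obtain ⟨C, hC0, hC⟩ := exists_modular_weakGrad_le hn hk
  exact ⟨C, hC0, fun A hA u hu hG => luxemburg_le_mul_add hC0 fun l₁ l₂ hl₁ hl₂ h1 h2 =>
    hC _ hA.gauge u hu hG l₁ l₂ hl₁ hl₂ h1 h2⟩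

/-! ### The measure `dx dy / |x - y|ⁿ` -/

/-- The measure `dx dy / |x - y|ⁿ` on `ℝⁿ × ℝⁿ`. -/
def diffMeasure (n : ℕ) : Measure (Rn n × Rn n) :=
  (volume.prod volume).withDensity fun p => (‖p.1 - p.2‖ₑ ^ n)⁻¹

theorem lintegral_diffMeasure {H : Rn n × Rn n → ℝ≥0∞} (hH : Measurable H) :
    ∫⁻ p, H p ∂diffMeasure n = ∫⁻ x, ∫⁻ y, H (x, y) / ‖x - y‖ₑ ^ n := by
  have hm : Measurable fun p : Rn n × Rn n => (‖p.1 - p.2‖ₑ ^ n)⁻¹ := by fun_prop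
  rw [diffMeasure, lintegral_withDensity_eq_lintegral_mul _ hm hH,
    lintegral_prod _ (hm.mul hH).aemeasurable]
  refine lintegral_congr fun x => lintegral_congr fun y => ?_
  rw [Pi.mul_apply, mul_comm, div_eq_mul_inv]

theorem lintegral_diffMeasure_swap {H : Rn n × Rn n → ℝ≥0∞} (hH : Measurable H) :
    ∫⁻ p, H p.swap ∂diffMeasure n = ∫⁻ p, H p ∂diffMeasure n := by
  rw [lintegral_diffMeasure (H := fun p => H p.swap) (hH.comp measurable_swap),
    lintegral_diffMeasure hH,
    lintegral_lintegral_swap (f := fun x y : Rn n => H (Prod.swap (x, y)) / ‖x - y‖ₑ ^ n)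
      (Measurable.aemeasurable (by unfold Function.uncurry; fun_prop))]
  refine lintegral_congr fun x => lintegral_congr fun y => ?_
  rw [Prod.swap_prod_mk, enorm_sub_rev]

theorem lintegral_diffMeasure_sub {Ψ : Rn n × Rn n → ℝ≥0∞} (hΨ : Measurable Ψ) :
    ∫⁻ p, Ψ (p.1, p.1 - p.2) ∂diffMeasure n = ∫⁻ h, (∫⁻ x, Ψ (x, h)) / ‖h‖ₑ ^ n := by
  rw [lintegral_diffMeasure (H := fun p => Ψ (p.1, p.1 - p.2)) (by fun_prop)]
  have e : ∀ x : Rn n, ∫⁻ y, Ψ (x, x - y) / ‖x - y‖ₑ ^ n = ∫⁻ h, Ψ (x, h) / ‖h‖ₑ ^ n := fun x =>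
    lintegral_sub_left_eq_self (fun h => Ψ (x, h) / ‖h‖ₑ ^ n) x
  simp only [e]
  rw [lintegral_lintegral_swap (f := fun x h : Rn n => Ψ (x, h) / ‖h‖ₑ ^ n)
      (Measurable.aemeasurable (by unfold Function.uncurry; fun_prop))]
  refine lintegral_congr fun h => ?_
  simp_rw [div_eq_mul_inv]
  exact lintegral_mul_const _ (by fun_prop)

/-- Integrate in x first, then use dilation invariance to absorb c, and polar coordinates in h. The
restrictions |h| < 1/2 and c ≤ 2 keep c|h| below 1, in the range of scales of the seminorm. -/
theorem lintegral_diffMeasure_near_le (hn : 1 ≤ n) {Φ : Rn n × ℝ → ℝ≥0∞} (hΦ : Measurable Φ)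
    {c : ℝ} (hc : 0 < c) (hc2 : c ≤ 2) :
    ∫⁻ p, (if ‖p.1 - p.2‖ < 1 / 2 then Φ (p.1, c * ‖p.1 - p.2‖) else 0) ∂diffMeasure n ≤
      n * volume (Metric.ball (0 : Rn n) 1) *
        ∫⁻ r in Set.Ioo (0 : ℝ) 1, (∫⁻ x, Φ (x, r)) / ENNReal.ofReal r := by
  set F : ℝ → ℝ≥0∞ := fun r => ∫⁻ x, Φ (x, r) with hF
  have hFm : Measurable F := hΦ.lintegral_prod_left'
  have hΨ : Measurable fun q : Rn n × Rn n => if ‖q.2‖ < 1 / 2 then Φ (q.1, c * ‖q.2‖) else 0 :=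
    Measurable.ite (measurableSet_lt (by fun_prop) measurable_const) (by fun_prop)
      measurable_const
  rw [lintegral_diffMeasure_sub hΨ]
  have hI : Measurable ((Set.Iio (1 : ℝ)).indicator F) := hFm.indicator measurableSet_Iio
  calc ∫⁻ h : Rn n, (∫⁻ x, if ‖h‖ < 1 / 2 then Φ (x, c * ‖h‖) else 0) / ‖h‖ₑ ^ n
      ≤ ∫⁻ h : Rn n, (Set.Iio (1 : ℝ)).indicator F ‖c • h‖ / ‖h‖ₑ ^ n := by
        gcongr with h
        by_cases h1 : ‖h‖ < 1 / 2
        · have h2 : ‖c • h‖ = c * ‖h‖ := by rw [norm_smul, Real.norm_of_nonneg hc.le]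
          have h3 : c * ‖h‖ ∈ Set.Iio (1 : ℝ) := by
            simp only [Set.mem_Iio]
            nlinarith [norm_nonneg h]
          rw [h2, Set.indicator_of_mem h3]
          simp only [h1, if_true, hF, le_refl]
        · simp only [h1, if_false, lintegral_zero]
          exact bot_le
    _ = ∫⁻ h : Rn n, (Set.Iio (1 : ℝ)).indicator F ‖h‖ / ‖h‖ₑ ^ n :=
        lintegral_comp_smul_div hc.ne' fun h => (Set.Iio (1 : ℝ)).indicator F ‖h‖
    _ = n * volume (Metric.ball (0 : Rn n) 1) *
        ∫⁻ r in Set.Ioi (0 : ℝ), (Set.Iio (1 : ℝ)).indicator F r / ENNReal.ofReal r :=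
        lintegral_fun_norm_div hn hI
    _ = _ := by
        congr 1
        have e : ∀ r, (Set.Iio (1 : ℝ)).indicator F r / ENNReal.ofReal r =
            (Set.Iio (1 : ℝ)).indicator (fun r => F r / ENNReal.ofReal r) r := fun r => by
          by_cases hr : r ∈ Set.Iio (1 : ℝ)
          · simp only [Set.indicator_of_mem hr]
          · simp only [Set.indicator_of_notMem hr, ENNReal.zero_div]
        simp_rw [e]
        rw [setLIntegral_indicator measurableSet_Iio, Set.inter_comm, Set.Ioi_inter_Iio]

theorem exists_lintegral_diffMeasure_far_le (hn : 1 ≤ n) {σ : ℝ} (hσ : 0 < σ) :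
    ∃ K : ℝ≥0, ∀ f : Rn n → ℝ≥0∞, Measurable f →
      ∫⁻ p, (if 1 / 2 ≤ ‖p.1 - p.2‖ then
        ENNReal.ofReal ((2 * ‖p.1 - p.2‖) ^ (-σ)) * f p.1 else 0) ∂diffMeasure n ≤
      K * ∫⁻ x, f x := by
  set v := volume (Metric.ball (0 : Rn n) 1) with hv
  have hvt : v ≠ ∞ := measure_ball_lt_top.ne
  -- The lower limit 1/4 makes r = 1/2 an interior point; the factor 4 is generous, as 2^{-σ} ≤ 1.
  set J := ∫⁻ r in Set.Ioi (1 / 4 : ℝ), ENNReal.ofReal (4 * r ^ (-σ - 1)) with hJ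
  have hJt : J ≠ ∞ := by
    have h1 : IntegrableOn (fun r : ℝ => 4 * r ^ (-σ - 1)) (Set.Ioi (1 / 4)) :=
      (integrableOn_Ioi_rpow_of_lt (by linarith) (by norm_num)).const_mul _
    exact (h1.lintegral_lt_top).ne
  have hKt : n * v * J ≠ ∞ := ENNReal.mul_ne_top (ENNReal.mul_ne_top (by simp) hvt) hJt
  refine ⟨(n * v * J).toNNReal, fun f hf => ?_⟩
  rw [ENNReal.coe_toNNReal hKt]
  set ω : ℝ → ℝ≥0∞ := fun r => if 1 / 2 ≤ r then ENNReal.ofReal ((2 * r) ^ (-σ)) else 0 with hω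
  have hωm : Measurable ω :=
    Measurable.ite measurableSet_Ici (by fun_prop) measurable_const
  have e1 : ∀ p : Rn n × Rn n, (if 1 / 2 ≤ ‖p.1 - p.2‖ then
        ENNReal.ofReal ((2 * ‖p.1 - p.2‖) ^ (-σ)) * f p.1 else 0) =
      (fun q : Rn n × Rn n => ω ‖q.2‖ * f q.1) (p.1, p.1 - p.2) := by
    intro p
    simp only [hω]
    split_ifs <;> simp
  simp_rw [e1]
  rw [lintegral_diffMeasure_sub (Ψ := fun q : Rn n × Rn n => ω ‖q.2‖ * f q.1) (by fun_prop)]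
  simp only
  have e2 : ∀ h : Rn n, (∫⁻ x, ω ‖h‖ * f x) / ‖h‖ₑ ^ n = ω ‖h‖ / ‖h‖ₑ ^ n * ∫⁻ x, f x := by
    intro h
    rw [lintegral_const_mul _ hf, div_eq_mul_inv, div_eq_mul_inv, mul_right_comm]
  simp_rw [e2]
  rw [lintegral_mul_const _ (by fun_prop), lintegral_fun_norm_div hn hωm]
  gcongr
  rw [hJ, ← lintegral_indicator measurableSet_Ioi, ← lintegral_indicator measurableSet_Ioi]
  refine lintegral_mono fun r => ?_
  by_cases hr : 1 / 2 ≤ r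
  · have hr0 : 0 < r := by linarith
    rw [Set.indicator_of_mem (by exact hr0),
      Set.indicator_of_mem (by simp only [Set.mem_Ioi]; linarith)]
    simp only [hω, hr, if_true]
    rw [← ENNReal.ofReal_div_of_pos hr0]
    refine ENNReal.ofReal_le_ofReal ?_
    rw [Real.mul_rpow (by norm_num) hr0.le, Real.rpow_sub_one hr0.ne', mul_div_assoc]
    gcongr
    calc (2 : ℝ) ^ (-σ) ≤ 1 := Real.rpow_le_one_of_one_le_of_nonpos (by norm_num) (by linarith)
      _ ≤ 4 := by norm_num
  · have : ω r = 0 := by simp only [hω, hr, if_false]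
    have h2 : (Set.Ioi (0 : ℝ)).indicator (fun r => ω r / ENNReal.ofReal r) r = 0 := by
      simp [Set.indicator, this]
    rw [h2]
    exact bot_le

/-! ### The top order increments -/

/-- Compare both values with the mollified derivative at scale |x - y|: two telescoping sums and one
increment of the mollification appear. The set S of good points is fixed before the pair (x, y). -/
theorem exists_weakGrad_sub_le (hn : 1 ≤ n) (s : ℝ) :
    ∃ E : ℝ≥0, ∀ u : Rn n → ℝ, LocallyIntegrable u →
      (∀ α : MultiIndex n ⌊s⌋₊, IsWeakDeriv α.1 u fun x => weakGrad ⌊s⌋₊ u x α) →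
      ∃ S : Set (Rn n), (∀ᵐ x, x ∈ S) ∧ ∀ x ∈ S, ∀ y ∈ S, x ≠ y →
        ‖weakGrad ⌊s⌋₊ u x - weakGrad ⌊s⌋₊ u y‖ₑ ≤
          E * ENNReal.ofReal (‖x - y‖ ^ (s - ⌊s⌋₊)) * (osc s u x (2 * ‖x - y‖) +
            ((∑' j : ℕ, ENNReal.ofReal ((1 / 2 ^ j) ^ (s - ⌊s⌋₊)) * osc s u x (‖x - y‖ / 2 ^ j)) +
            ∑' j : ℕ, ENNReal.ofReal ((1 / 2 ^ j) ^ (s - ⌊s⌋₊)) * osc s u y (‖x - y‖ / 2 ^ j))) := by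
  obtain ⟨φ, hφ⟩ := exists_isReproducing n ⌊s⌋₊
  choose M hM using fun α : MultiIndex n ⌊s⌋₊ =>
    exists_mollified_increment_le hn hφ α.1 (sum_multiIndex α)
  choose C hC using fun α : MultiIndex n ⌊s⌋₊ =>
    exists_weakDeriv_sub_mollified_le (s := s) hn hφ α.1
  simp only [sum_multiIndex] at hC
  refine ⟨∑ α, (M α + C α), fun u hu hG => ⟨_, ae_all_iff.2 fun α => hC α u _ (hG α),
    fun x hx y hy hxy => ?_⟩⟩
  have hρ : 0 < ‖x - y‖ := norm_sub_pos_iff.2 hxy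
  refine (enorm_le_sum _).trans ?_
  rw [ENNReal.ofNNReal_finsetSum, Finset.sum_mul, Finset.sum_mul]
  refine Finset.sum_le_sum fun α _ => ?_
  set ρ := ‖x - y‖ with hρdef
  set σ := s - ⌊s⌋₊ with hσ
  set T : Rn n → ℝ≥0∞ := fun z =>
    ∑' j : ℕ, ENNReal.ofReal ((1 / 2 ^ j) ^ σ) * osc s u z (ρ / 2 ^ j) with hT
  have hTz : ∀ z, ∑' j : ℕ, ENNReal.ofReal ((ρ / 2 ^ j) ^ σ) * osc s u z (ρ / 2 ^ j) =
      ENNReal.ofReal (ρ ^ σ) * T z := by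
    intro z
    rw [hT, ← ENNReal.tsum_mul_left]
    refine tsum_congr fun j => ?_
    rw [← mul_assoc, ← ENNReal.ofReal_mul (by positivity), ← Real.mul_rpow hρ.le (by positivity),
      mul_one_div]
  have h1 := hx α ρ hρ
  have h2 := hy α ρ hρ
  have h3 := hM α u hu x y hxy
  rw [hTz] at h1 h2
  set c := conv (multiD α.1 (dil φ ρ)) u with hc
  have e : (weakGrad ⌊s⌋₊ u x - weakGrad ⌊s⌋₊ u y) α =
      ((weakGrad ⌊s⌋₊ u x α - c x) - (weakGrad ⌊s⌋₊ u y α - c y)) + (c x - c y) := by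
    rw [PiLp.sub_apply]; ring
  rw [e]
  calc _ ≤ ‖weakGrad ⌊s⌋₊ u x α - c x‖ₑ + ‖weakGrad ⌊s⌋₊ u y α - c y‖ₑ + ‖c x - c y‖ₑ :=
        (enorm_add_le _ _).trans (add_le_add enorm_sub_le le_rfl)
    _ ≤ C α * (ENNReal.ofReal (ρ ^ σ) * T x) + C α * (ENNReal.ofReal (ρ ^ σ) * T y) +
        M α * ENNReal.ofReal (ρ ^ σ) * osc s u x (2 * ρ) := by gcongr
    _ = ENNReal.ofReal (ρ ^ σ) * (C α * (T x + T y) + M α * osc s u x (2 * ρ)) := by ring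
    _ ≤ ENNReal.ofReal (ρ ^ σ) * (C α * (osc s u x (2 * ρ) + (T x + T y)) +
          M α * (osc s u x (2 * ρ) + (T x + T y))) := by
        exact mul_le_mul' le_rfl (add_le_add (mul_le_mul' le_rfl le_add_self)
          (mul_le_mul' le_rfl le_self_add))
    _ = _ := by push_cast; ring

theorem half_add_half_mul (a b c X : ℝ≥0∞) :
    (a + (b / 2 + c / 2) / 2) / 2 * (8 * X) = (4 * a + (b + c)) * X := by
  have h : (2⁻¹ : ℝ≥0∞) * 2 = 1 := ENNReal.inv_mul_cancel (by simp) (by simp)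
  simp only [div_eq_mul_inv]
  calc (a + (b * 2⁻¹ + c * 2⁻¹) * 2⁻¹) * 2⁻¹ * (8 * X)
      = (4 * a * (2⁻¹ * 2) + (b + c) * ((2⁻¹ * 2) * (2⁻¹ * 2) * (2⁻¹ * 2))) * X := by ring
    _ = _ := by rw [h]; ring

/-- To be read with R = |x-y|^σ and θ = (2|x-y|)^{-σ}, so that 2Rθ = 2^{1-σ} ≥ 1. It isolates the
factor θ, which B(θt) ≤ θB(t) then pulls out as decay at infinity. -/
theorem div_le_of_far {g gx gy L L₃ R θ : ℝ≥0∞} (hg : g ≤ gx + gy) (h0 : L₃ ≠ 0) (ht : L₃ ≠ ∞)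
    (hL : 4 * L₃ ≤ L) (hR : 1 ≤ 2 * (R * θ)) :
    g / (L * R) ≤ θ * ((gx / L₃ + gy / L₃) / 2) := by
  refine ENNReal.div_le_of_le_mul (hg.trans ?_)
  have h : (2⁻¹ : ℝ≥0∞) * 2 = 1 := ENNReal.inv_mul_cancel (by simp) (by simp)
  calc gx + gy = 1 * (L₃ * (gx / L₃) + L₃ * (gy / L₃)) := by
        rw [ENNReal.mul_div_cancel h0 ht, ENNReal.mul_div_cancel h0 ht, one_mul]
    _ ≤ 2 * (R * θ) * (L₃ * (gx / L₃) + L₃ * (gy / L₃)) := by gcongr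
    _ = 2 * (R * θ) * (L₃ * (gx / L₃) + L₃ * (gy / L₃)) * (2⁻¹ * 2) := by rw [h, mul_one]
    _ = θ * ((gx / L₃ + gy / L₃) * 2⁻¹) * (4 * L₃ * R) := by ring
    _ ≤ _ := by
      rw [div_eq_mul_inv (_ + _)]
      gcongr

theorem exists_modular_gagliardo_le (hn : 1 ≤ n) {s : ℝ} (hs : (⌊s⌋₊ : ℝ) < s) :
    ∃ C : ℝ≥0, 0 < C ∧ ∀ B : ℝ≥0∞ → ℝ≥0∞, Gauge B → ∀ u : Rn n → ℝ, LocallyIntegrable u →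
      (∀ α : MultiIndex n ⌊s⌋₊, IsWeakDeriv α.1 u fun x => weakGrad ⌊s⌋₊ u x α) →
      ∀ l₁ l₂ : ℝ≥0, 0 < l₁ → 0 < l₂ → ∫⁻ x, B (‖u x‖ₑ / l₁) ≤ 1 →
      ∫⁻ r in Set.Ioo (0 : ℝ) 1, (∫⁻ x, B (osc s u x r / l₂)) / ENNReal.ofReal r ≤ 1 →
      ∫⁻ x, ∫⁻ y, B (‖weakGrad ⌊s⌋₊ u x - weakGrad ⌊s⌋₊ u y‖ₑ /
        ((C * (l₁ + l₂) : ℝ≥0) * ‖x - y‖ₑ ^ (s - ⌊s⌋₊))) / ‖x - y‖ₑ ^ n ≤ 1 := by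
  obtain ⟨E, hE⟩ := exists_weakGrad_sub_le hn s
  obtain ⟨C₃, hC₃, H₃⟩ := exists_modular_weakGrad_le hn hs
  have hσ0 : 0 < s - ⌊s⌋₊ := sub_pos.2 hs
  obtain ⟨D, hD0, hD⟩ := exists_tsum_dyadic_rpow hσ0
  obtain ⟨K, hK⟩ := exists_lintegral_diffMeasure_far_le hn hσ0
  have hσ1 : s - ⌊s⌋₊ ≤ 1 := by linarith [Nat.lt_floor_add_one s]
  set σ := s - ⌊s⌋₊ with hσ
  set v := volume (Metric.ball (0 : Rn n) 1) with hv
  have hvt : v ≠ ∞ := measure_ball_lt_top.ne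
  have hD0' : (D : ℝ≥0∞) ≠ 0 := by exact_mod_cast hD0.ne'
  set w : ℕ → ℝ≥0∞ := fun j => ENNReal.ofReal ((1 / 2 ^ j) ^ σ) with hw
  have hwD : ∑' j, w j = D := by simpa [hw] using hD 1 one_pos
  have hwD1 : ∑' j, w j / D = 1 := by
    simp_rw [div_eq_mul_inv]
    rw [ENNReal.tsum_mul_right, hwD, ENNReal.mul_inv_cancel hD0' ENNReal.coe_ne_top]
  set E₁ : ℝ≥0 := E * (1 + D) with hE₁
  -- The five terms are the masses of the pieces of the majorant `H`: the oscillation at scale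
  -- 2|x-y|, the dyadic sums at x and at y, and the far contributions of x and of y. The 1 ensures N
  -- ≥ 1.
  set N : ℝ≥0 := n * v.toNNReal + n * v.toNNReal + n * v.toNNReal + K + K + 1 with hN
  have hN1 : 1 ≤ N := le_add_self
  -- The near part needs 8E₁, for three nested halvings, and the far part 4C₃; division by N finally
  -- brings the modular to at most 1.
  refine ⟨N * (8 * E₁ + 4 * C₃), by positivity, fun B hB u hu hG l₁ l₂ hl₁ hl₂ h1 h2 => ?_⟩
  have h3 := H₃ B hB u hu hG l₁ l₂ hl₁ hl₂ h1 h2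
  have hl₂0 : (l₂ : ℝ≥0∞) ≠ 0 := by exact_mod_cast hl₂.ne'
  have hum : AEMeasurable u := hu.aestronglyMeasurable.aemeasurable
  set L₃ : ℝ≥0 := C₃ * (l₁ + l₂) with hL₃
  have hL₃0 : (L₃ : ℝ≥0∞) ≠ 0 := by
    have : 0 < L₃ := by positivity
    exact_mod_cast this.ne'
  set L : ℝ≥0 := (8 * E₁ + 4 * C₃) * (l₁ + l₂) with hL
  have hL₃L : 4 * (L₃ : ℝ≥0∞) ≤ L := by
    rw [hL₃, hL]
    push_cast
    rw [← mul_assoc]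
    gcongr
    exact le_add_self
  have hE₁L : 8 * (E₁ * l₂ : ℝ≥0∞) ≤ L := by
    rw [hL]
    push_cast
    rw [← mul_assoc]
    gcongr <;> first | exact le_add_self | exact le_self_add
  obtain ⟨G, hGm, hGG⟩ := aestronglyMeasurable_weakGrad hG
  obtain ⟨S, hS, hSE⟩ := hE u hu hG
  set f : Rn n → ℝ≥0∞ := fun x => B (‖G x‖ₑ / L₃) with hf
  have hfm : Measurable f := hB.measurable.comp (hGm.measurable.enorm.div_const _)
  have hf1 : ∫⁻ x, f x ≤ 1 := by
    refine le_trans (le_of_eq (lintegral_congr_ae ?_)) h3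
    filter_upwards [hGG] with x hx
    rw [hf, hx]
  set Φ : Rn n × ℝ → ℝ≥0∞ := fun p => B (osc s u p.1 p.2 / l₂) with hΦ
  have hΦm : Measurable Φ := hB.measurable.comp ((measurable_osc hum).div_const _)
  have hset : MeasurableSet {p : Rn n × Rn n | ‖p.1 - p.2‖ < 1 / 2} :=
    measurableSet_lt (by fun_prop) measurable_const
  set Q : ℝ → Rn n × Rn n → ℝ≥0∞ := fun c p =>
    if ‖p.1 - p.2‖ < 1 / 2 then Φ (p.1, c * ‖p.1 - p.2‖) else 0 with hQ
  have hQm : ∀ c, Measurable (Q c) := fun c => Measurable.ite hset (by fun_prop) measurable_const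
  have hQ1 : ∀ c, 0 < c → c ≤ 2 → ∫⁻ p, Q c p ∂diffMeasure n ≤ n * v := fun c hc hc2 =>
    (lintegral_diffMeasure_near_le hn hΦm hc hc2).trans (mul_le_of_le_one_right' h2)
  set T : Rn n × Rn n → ℝ≥0∞ := fun p => ∑' j : ℕ, w j / D * Q (1 / 2 ^ j) p with hT
  have hTm : Measurable T := Measurable.tsum fun j => (hQm _).const_mul _
  have hT1 : ∫⁻ p, T p ∂diffMeasure n ≤ n * v := by
    rw [hT, lintegral_tsum fun j => ((hQm _).const_mul _).aemeasurable]
    simp_rw [lintegral_const_mul _ (hQm _)]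
    calc _ ≤ ∑' j : ℕ, w j / D * (n * v) := by
          gcongr with j
          refine hQ1 _ (by positivity) (le_trans ?_ one_le_two)
          rw [div_le_one (by positivity)]
          exact one_le_pow₀ one_le_two
      _ = n * v := by rw [ENNReal.tsum_mul_right, hwD1, one_mul]
  set Z : Rn n × Rn n → ℝ≥0∞ := fun p => if 1 / 2 ≤ ‖p.1 - p.2‖ then
    ENNReal.ofReal ((2 * ‖p.1 - p.2‖) ^ (-σ)) * f p.1 else 0 with hZ
  have hZm : Measurable Z :=
    Measurable.ite (measurableSet_le measurable_const (by fun_prop)) (by fun_prop) measurable_const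
  have hZ1 : ∫⁻ p, Z p ∂diffMeasure n ≤ K := (hK f hfm).trans (mul_le_of_le_one_right' hf1)
  have hpt : ∀ x ∈ S, G x = weakGrad ⌊s⌋₊ u x → ∀ y ∈ S, G y = weakGrad ⌊s⌋₊ u y →
      B (‖weakGrad ⌊s⌋₊ u x - weakGrad ⌊s⌋₊ u y‖ₑ / (L * ‖x - y‖ₑ ^ σ)) ≤
        Q 2 (x, y) + T (x, y) + T (y, x) + Z (x, y) + Z (y, x) := by
    intro x hx hGx y hy hGy
    rcases eq_or_ne x y with rfl | hxy
    · simp [hB.zero]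
    have hρ : 0 < ‖x - y‖ := norm_sub_pos_iff.2 hxy
    have hR : ‖x - y‖ₑ ^ σ = ENNReal.ofReal (‖x - y‖ ^ σ) := by
      rw [← ofReal_norm, ENNReal.ofReal_rpow_of_pos hρ]
    rw [hR]
    by_cases hnear : ‖x - y‖ < 1 / 2
    · refine le_trans ?_ (le_self_add.trans le_self_add)
      set a := osc s u x (2 * ‖x - y‖) / l₂ with ha
      set b : Rn n → ℝ≥0∞ := fun z =>
        ∑' j : ℕ, w j / D * (osc s u z (‖x - y‖ / 2 ^ j) / l₂) with hb
      have ha' : osc s u x (2 * ‖x - y‖) = l₂ * a :=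
        (ENNReal.mul_div_cancel hl₂0 ENNReal.coe_ne_top).symm
      have hb' : ∀ z, ∑' j : ℕ, ENNReal.ofReal ((1 / 2 ^ j) ^ σ) *
          osc s u z (‖x - y‖ / 2 ^ j) = D * l₂ * b z := by
        intro z
        rw [hb, ← ENNReal.tsum_mul_left]
        refine tsum_congr fun j => ?_
        rw [mul_mul_mul_comm, ENNReal.mul_div_cancel hD0' ENNReal.coe_ne_top,
          ENNReal.mul_div_cancel hl₂0 ENNReal.coe_ne_top]
      have hle : ‖weakGrad ⌊s⌋₊ u x - weakGrad ⌊s⌋₊ u y‖ₑ /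
          (L * ENNReal.ofReal (‖x - y‖ ^ σ)) ≤ (a + (b x / 2 + b y / 2) / 2) / 2 := by
        refine ENNReal.div_le_of_le_mul ((hSE x hx y hy hxy).trans ?_)
        rw [ha', hb', hb']
        set R := ENNReal.ofReal (‖x - y‖ ^ σ)
        calc E * R * (l₂ * a + (D * l₂ * b x + D * l₂ * b y))
            = E * l₂ * R * (1 * a + D * (b x + b y)) := by ring
          _ ≤ E * l₂ * R * ((1 + D) * (4 * a) + (1 + D) * (b x + b y)) := by
              gcongr
              · exact le_self_add
              · exact le_mul_of_one_le_left' (by norm_num)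
              · exact le_add_self
          _ = (4 * a + (b x + b y)) * (E₁ * l₂ * R) := by
              rw [hE₁]; push_cast; ring
          _ = (a + (b x / 2 + b y / 2) / 2) / 2 * (8 * (E₁ * l₂) * R) := by
              rw [← half_add_half_mul]; ring
          _ ≤ _ := by gcongr
      have hQT : ∀ z z' : Rn n, ‖z - z'‖ = ‖x - y‖ → B (b z / 2) ≤ T (z, z') := by
        intro z z' hz
        refine (hB.tsum_le hwD1.le _).trans (le_of_eq (tsum_congr fun j => ?_))
        simp only [hQ, hz, hnear, if_true, hΦ]
        rw [one_div_mul_eq_div]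
      refine (hB.mono hle).trans ((hB.half_add_le _ _).trans ?_)
      rw [add_assoc]
      refine add_le_add (le_of_eq ?_) ((hB.half_add_le _ _).trans
        (add_le_add (hQT x y rfl) (hQT y x (norm_sub_rev _ _))))
      simp only [hQ, hnear, if_true, hΦ, ha]
    · have hfar : 1 / 2 ≤ ‖x - y‖ := not_lt.1 hnear
      have hfar' : 1 / 2 ≤ ‖y - x‖ := by rwa [norm_sub_rev]
      set θ := ENNReal.ofReal ((2 * ‖x - y‖) ^ (-σ)) with hθ
      -- The factor 2 in θ serves this bound: 2|x-y| ≥ 1 in the far region.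
      have hθ1 : θ ≤ 1 := ENNReal.ofReal_le_one.2
        (Real.rpow_le_one_of_one_le_of_nonpos (by linarith) (by linarith))
      have hRθ : 1 ≤ 2 * (ENNReal.ofReal (‖x - y‖ ^ σ) * θ) := by
        have h2σ : (2 : ℝ) ^ σ ≤ 2 := by
          simpa using Real.rpow_le_rpow_of_exponent_le one_le_two hσ1
        have h2σ0 : (0 : ℝ) < 2 ^ σ := by positivity
        have hρσ : ‖x - y‖ ^ σ ≠ 0 := by positivity
        have e : 2 * (‖x - y‖ ^ σ * (((2 : ℝ) ^ σ)⁻¹ * (‖x - y‖ ^ σ)⁻¹)) = 2 / 2 ^ σ := by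
          field_simp
        calc (1 : ℝ≥0∞) ≤ ENNReal.ofReal
              (2 * (‖x - y‖ ^ σ * (((2 : ℝ) ^ σ)⁻¹ * (‖x - y‖ ^ σ)⁻¹))) := by
              rw [ENNReal.one_le_ofReal, e, one_le_div h2σ0]
              exact h2σ
          _ = _ := by
              rw [hθ, Real.mul_rpow (by norm_num) hρ.le, Real.rpow_neg hρ.le,
                Real.rpow_neg (by norm_num), ENNReal.ofReal_mul (by norm_num),
                ENNReal.ofReal_mul (by positivity), ENNReal.ofReal_ofNat]
      have hle := div_le_of_far (R := ENNReal.ofReal (‖x - y‖ ^ σ)) (θ := θ)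
        (enorm_sub_le (a := weakGrad ⌊s⌋₊ u x) (b := weakGrad ⌊s⌋₊ u y)) hL₃0
        ENNReal.coe_ne_top hL₃L hRθ
      rw [add_assoc]
      refine le_trans ?_ le_add_self
      refine (hB.mono hle).trans ((hB.mul_le _ _ hθ1).trans ?_)
      have e : Z (x, y) + Z (y, x) = θ * (f x + f y) := by
        simp only [hZ, hfar, hfar', if_true]
        rw [norm_sub_rev y x, mul_add]
      rw [e]
      gcongr
      rw [hf]
      simp only
      rw [hGx, hGy]
      exact hB.half_add_le _ _
  have hTs : Measurable fun p : Rn n × Rn n => T p.swap := hTm.comp measurable_swap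
  have hZs : Measurable fun p : Rn n × Rn n => Z p.swap := hZm.comp measurable_swap
  set H : Rn n × Rn n → ℝ≥0∞ := fun p => Q 2 p + T p + T p.swap + Z p + Z p.swap with hH
  have hHm : Measurable H :=
    ((((hQm 2).add hTm).add hTs).add hZm).add hZs
  have hH1 : ∫⁻ p, H p ∂diffMeasure n ≤ N := by
    rw [hH, lintegral_add_right _ hZs, lintegral_add_right _ hZm, lintegral_add_right _ hTs,
      lintegral_add_right _ hTm, lintegral_diffMeasure_swap hTm, lintegral_diffMeasure_swap hZm, hN]
    push_cast
    rw [ENNReal.coe_toNNReal hvt]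
    refine le_trans ?_ le_self_add
    gcongr
    exact hQ1 2 two_pos le_rfl
  have hN0 : (N : ℝ≥0∞) ≠ 0 := by
    have : 0 < N := by positivity
    exact_mod_cast this.ne'
  have hae : ∀ᵐ x, x ∈ S ∧ G x = weakGrad ⌊s⌋₊ u x := by
    filter_upwards [hS, hGG] with x h h' using ⟨h, h'.symm⟩
  calc _ ≤ ∫⁻ x, ∫⁻ y, (N : ℝ≥0∞)⁻¹ * H (x, y) / ‖x - y‖ₑ ^ n := by
        refine lintegral_mono_ae ?_
        filter_upwards [hae] with x hx
        refine lintegral_mono_ae ?_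
        filter_upwards [hae] with y hy
        gcongr
        have e : ((N * (8 * E₁ + 4 * C₃) * (l₁ + l₂) : ℝ≥0) : ℝ≥0∞) * ‖x - y‖ₑ ^ σ =
            L * ‖x - y‖ₑ ^ σ * N := by
          rw [hL]; push_cast; ring
        rw [e, ennreal_div_mul (Or.inr ENNReal.coe_ne_top) (Or.inr hN0), mul_comm _ (H _),
          ← div_eq_mul_inv]
        exact (hB.div_le (by exact_mod_cast hN1) _).trans
          (ENNReal.div_le_div_right (hpt x hx.1 hx.2 y hy.1 hy.2) _)
    _ = (N : ℝ≥0∞)⁻¹ * ∫⁻ p, H p ∂diffMeasure n := by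
        rw [← lintegral_const_mul _ hHm, lintegral_diffMeasure (hHm.const_mul _)]
    _ ≤ (N : ℝ≥0∞)⁻¹ * N := by gcongr
    _ = 1 := ENNReal.inv_mul_cancel hN0 ENNReal.coe_ne_top

theorem exists_gagliardo_weakGrad_le (hn : 1 ≤ n) {s : ℝ} (hs : (⌊s⌋₊ : ℝ) < s) :
    ∃ C : ℝ≥0, 0 < C ∧ ∀ A : ℝ≥0 → ℝ≥0∞, IsYoung A → ∀ u : Rn n → ℝ, LocallyIntegrable u →
      (∀ α : MultiIndex n ⌊s⌋₊, IsWeakDeriv α.1 u fun x => weakGrad ⌊s⌋₊ u x α) →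
      gagliardo A (s - ⌊s⌋₊) (weakGrad ⌊s⌋₊ u) ≤ C * oscNorm s A u := by
  obtain ⟨C, hC0, hC⟩ := exists_modular_gagliardo_le hn hs
  exact ⟨C, hC0, fun A hA u hu hG => luxemburg_le_mul_add hC0 fun l₁ l₂ hl₁ hl₂ h1 h2 =>
    hC _ hA.gauge u hu hG l₁ l₂ hl₁ hl₂ h1 h2⟩

/-! ### Comparison of the norms -/

theorem natFloor_lt {s : ℝ} (hs : 0 < s) (hsN : ∀ m : ℕ, s ≠ m) : (⌊s⌋₊ : ℝ) < s :=
  lt_of_le_of_ne (Nat.floor_le hs.le) (hsN _).symm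

/-- `u` is locally integrable and has weak derivatives up to order `m`. -/
def HasWeakDerivs (m : ℕ) (u : Rn n → ℝ) : Prop :=
  LocallyIntegrable u ∧ ∀ k ≤ m, ∀ α : MultiIndex n k, IsWeakDeriv α.1 u fun x => weakGrad k u x α

theorem hasWeakDerivs_of_mem_oscSpace (hn : 1 ≤ n) {s : ℝ} (hs : (⌊s⌋₊ : ℝ) < s)
    {A : ℝ≥0 → ℝ≥0∞} (hA : IsYoung A) {u : Rn n → ℝ} (hu : u ∈ oscSpace n s A) :
    HasWeakDerivs ⌊s⌋₊ u := by
  have hloc := locallyIntegrable_of_mem_orliczSpace hA hu.1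
  refine ⟨hloc, fun k hk α => isWeakDeriv_weakDeriv ?_⟩
  obtain ⟨l, hl, hl1⟩ := luxemburg_lt_top.1 hu.2
  refine exists_isWeakDeriv_of_osc hn hA.gauge hloc hl (ne_top_of_le_ne_top ENNReal.one_ne_top hl1)
    α.1 ?_
  rw [sum_multiIndex]
  exact lt_of_le_of_lt (by exact_mod_cast hk) hs

theorem hasWeakDerivs_of_mem_fracSobolevSpace {s : ℝ} {A : ℝ≥0 → ℝ≥0∞} (hA : IsYoung A)
    {u : Rn n → ℝ} (hu : u ∈ fracSobolevSpace n s A) : HasWeakDerivs ⌊s⌋₊ u := by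
  have hloc := locallyIntegrable_of_mem_orliczSpace hA hu.1.1
  refine ⟨hloc, fun k hk α => isWeakDeriv_weakDeriv ?_⟩
  rcases Nat.eq_zero_or_pos k with rfl | hk0
  · have h0 : α.1 = 0 := by simpa using α.2
    rw [h0]
    exact ⟨u, isWeakDeriv_zero hloc⟩
  · exact (hu.1.2 k (Finset.mem_Icc.2 ⟨hk0, hk⟩)).1 α

theorem orliczNorm_weakGrad_le_sobolevNorm {A : ℝ≥0 → ℝ≥0∞} {u : Rn n → ℝ} {k m : ℕ} (hk : k ≤ m) :
    orliczNorm A (weakGrad k u) ≤ sobolevNorm m A u :=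
  Finset.single_le_sum (f := fun k => orliczNorm A (weakGrad k u)) (fun _ _ => bot_le)
    (Finset.mem_range.2 (Nat.lt_succ_of_le hk))

/-- Only the existence of the weak derivatives is assumed, not the finiteness of a norm. The same
inequality thus also gives an inclusion of spaces. -/
theorem exists_oscNorm_le (hn : 1 ≤ n) {s : ℝ} (hs : 0 < s) : ∃ C : ℝ≥0, 0 < C ∧
    ∀ A : ℝ≥0 → ℝ≥0∞, IsYoung A → ∀ u : Rn n → ℝ, HasWeakDerivs ⌊s⌋₊ u →
      oscNorm s A u ≤ C * fracSobolevNorm s A u := by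
  obtain ⟨C, hC, H⟩ := exists_oscSeminorm_le hn hs
  refine ⟨1 + C, by positivity, fun A hA u hu => ?_⟩
  have h1 : orliczNorm A u ≤ fracSobolevNorm s A u := by
    rw [← orliczNorm_weakGrad_zero]
    exact (orliczNorm_weakGrad_le_sobolevNorm (Nat.zero_le _)).trans le_self_add
  have h2 : oscSeminorm s A u ≤ C * fracSobolevNorm s A u :=
    (H A hA u hu.1 (hu.2 _ le_rfl)).trans (by gcongr; exact le_add_self)
  calc oscNorm s A u ≤ fracSobolevNorm s A u + C * fracSobolevNorm s A u := add_le_add h1 h2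
    _ = _ := by push_cast; ring

theorem exists_fracSobolevNorm_le (hn : 1 ≤ n) {s : ℝ} (hs : (⌊s⌋₊ : ℝ) < s) (hs0 : 0 < s) :
    ∃ C : ℝ≥0, 0 < C ∧ ∀ A : ℝ≥0 → ℝ≥0∞, IsYoung A → ∀ u : Rn n → ℝ, HasWeakDerivs ⌊s⌋₊ u →
      fracSobolevNorm s A u ≤ C * oscNorm s A u := by
  -- The condition on k is placed after the constant, so that constants can be chosen for all k at
  -- once and summed over the range.
  have h1 : ∀ k : ℕ, ∃ C : ℝ≥0, k ≤ ⌊s⌋₊ → ∀ A : ℝ≥0 → ℝ≥0∞, IsYoung A → ∀ u : Rn n → ℝ,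
      HasWeakDerivs ⌊s⌋₊ u → orliczNorm A (weakGrad k u) ≤ C * oscNorm s A u := by
    intro k
    by_cases hk : k ≤ ⌊s⌋₊
    · obtain ⟨C, -, H⟩ := exists_orliczNorm_weakGrad_le hn
        (lt_of_le_of_lt (Nat.cast_le.2 hk) hs)
      exact ⟨C, fun _ A hA u hu => H A hA u hu.1 (hu.2 k hk)⟩
    · exact ⟨0, fun h => absurd h hk⟩
  choose C₁ H₁ using h1
  obtain ⟨C₂, hC₂, H₂⟩ := exists_gagliardo_weakGrad_le hn hs
  have hfract : Int.fract s = s - ⌊s⌋₊ := by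
    rw [Int.fract, natCast_floor_eq_intCast_floor hs0.le]
  refine ⟨∑ k ∈ Finset.range (⌊s⌋₊ + 1), C₁ k + C₂, by positivity, fun A hA u hu => ?_⟩
  rw [fracSobolevNorm, sobolevNorm, hfract, ENNReal.coe_add, ENNReal.ofNNReal_finsetSum, add_mul,
    Finset.sum_mul]
  exact add_le_add (Finset.sum_le_sum fun k hk =>
    H₁ k (Nat.lt_succ_iff.1 (Finset.mem_range.1 hk)) A hA u hu) (H₂ A hA u hu.1 (hu.2 _ le_rfl))

theorem oscSpace_eq_fracSobolevSpace (hn : 1 ≤ n) {s : ℝ} (hs : 0 < s) (hsN : ∀ m : ℕ, s ≠ m)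
    {A : ℝ≥0 → ℝ≥0∞} (hA : IsYoung A) : oscSpace n s A = fracSobolevSpace n s A := by
  have hs' := natFloor_lt hs hsN
  obtain ⟨C, -, hC⟩ := exists_oscNorm_le hn hs
  obtain ⟨C', -, hC'⟩ := exists_fracSobolevNorm_le hn hs' hs
  ext u
  constructor
  · intro hu
    have hW := hasWeakDerivs_of_mem_oscSpace hn hs' hA hu
    have hfin : fracSobolevNorm s A u < ∞ := (hC' A hA u hW).trans_lt
      (ENNReal.mul_lt_top ENNReal.coe_lt_top (ENNReal.add_lt_top.2 ⟨hu.1.2, hu.2⟩))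
    refine ⟨⟨hu.1, fun k hk => ⟨fun α => ⟨_, hW.2 k (Finset.mem_Icc.1 hk).2 α⟩, ?_⟩⟩, ?_⟩
    · exact ((orliczNorm_weakGrad_le_sobolevNorm (Finset.mem_Icc.1 hk).2).trans
        le_self_add).trans_lt hfin
    · exact lt_of_le_of_lt le_add_self hfin
  · intro hu
    have hW := hasWeakDerivs_of_mem_fracSobolevSpace hA hu
    have hfin : fracSobolevNorm s A u < ∞ := by
      refine ENNReal.add_lt_top.2 ⟨ENNReal.sum_lt_top.2 fun k hk => ?_, hu.2⟩
      rcases Nat.eq_zero_or_pos k with rfl | hk0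
      · rw [orliczNorm_weakGrad_zero]
        exact hu.1.1.2
      · exact (hu.1.2 k (Finset.mem_Icc.2
          ⟨hk0, Nat.lt_succ_iff.1 (Finset.mem_range.1 hk)⟩)).2
    exact ⟨hu.1.1, lt_of_le_of_lt le_add_self ((hC A hA u hW).trans_lt
      (ENNReal.mul_lt_top ENNReal.coe_lt_top hfin))⟩

end OrliczOsc

end

theorem theorem3p2 (n : ℕ) (hn : 1 ≤ n) (s : ℝ) (hs : 0 < s) (hsN : ∀ m : ℕ, s ≠ m) :
    ∃ c₁ c₂ : ℝ≥0, 0 < c₁ ∧ 0 < c₂ ∧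
      ∀ A : ℝ≥0 → ℝ≥0∞, OrliczOsc.IsYoung A →
        OrliczOsc.oscSpace n s A = OrliczOsc.fracSobolevSpace n s A ∧
        ∀ u ∈ OrliczOsc.fracSobolevSpace n s A,
          c₁ * OrliczOsc.fracSobolevNorm s A u ≤ OrliczOsc.oscNorm s A u ∧
          OrliczOsc.oscNorm s A u ≤ c₂ * OrliczOsc.fracSobolevNorm s A u := by
  have hs' := OrliczOsc.natFloor_lt hs hsN
  obtain ⟨C, hC0, hC⟩ := OrliczOsc.exists_oscNorm_le hn hs
  obtain ⟨C', hC0', hC'⟩ := OrliczOsc.exists_fracSobolevNorm_le hn hs' hs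
  refine ⟨C'⁻¹, C, inv_pos.2 hC0', hC0, fun A hA =>
    ⟨OrliczOsc.oscSpace_eq_fracSobolevSpace hn hs hsN hA, fun u hu => ?_⟩⟩
  have hW := OrliczOsc.hasWeakDerivs_of_mem_fracSobolevSpace hA hu
  refine ⟨?_, hC A hA u hW⟩
  have h0 : (C' : ℝ≥0∞) ≠ 0 := by exact_mod_cast hC0'.ne'
  rw [ENNReal.coe_inv hC0'.ne']
  calc (C' : ℝ≥0∞)⁻¹ * OrliczOsc.fracSobolevNorm s A u
      ≤ (C' : ℝ≥0∞)⁻¹ * (C' * OrliczOsc.oscNorm s A u) := by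
        gcongr
        exact hC' A hA u hW
    _ = OrliczOsc.oscNorm s A u := by
        rw [← mul_assoc, ENNReal.inv_mul_cancel h0 ENNReal.coe_ne_top, one_mul]
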